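/- **Setting.** Fix positive numbers $(a_i)_{i\ge 1}$ with $\sum_i a_i<1$, let $\ell^2=\ell^2(\mathbb N)$ with unit vectors $e_i$, let $P$ be the restriction to $\ell^2$ of the product $\prod_i \mathcal N(0,a_i^2)$ of centred Gaussian measures with standard deviations $a_i$, and put $\mathbb H=\{x\in\ell^2: x_1>0\}$. Write $D_{x_i}$ for the partial derivative along $e_i$ and $D^k_{x_{i_1}\cdots x_{i_k}}=D_{x_{i_1}}\circ\cdots\circ D_{x_{i_k}}$. A set $E$ is *uniformly included* in $V$ if $E$ is bounded and, for some $r>0$, $B_r(x)\subset V$ for all $x\in E$. For an open set $V\subset\ell^2$, a function is *F-continuous* on $V$ if for all $x\in V$ and $l\in\mathbb N$ the map $(s_1,\dots,s_l)\mapsto f(x+\sum_{i\le l}s_ie_i)$ is continuous where $x+\sum_{i\le l} s_ie_i\in V$. $C_F^\infty(V)$ is the set of F-continuous Borel functions $V\to\mathbb R$ all of whose iterated partial derivatives exist and are bounded, F-continuous and Borel. $C^\infty_{\mathcal F}(V)$ is the set of $\varphi\in C_F^\infty(V)$ such that $\{\varphi\neq0\}$ is uniformly included in $V$ and $\sup_V\sum_{i_1,\dots,i_k}a_{i_1}^2\cdots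 a_{i_k}^2|D^k_{x_{i_1}\cdots x_{i_k}}\varphi|^2<\infty$ for every $k\ge1$. Put $$\|f\|_{W^{n,\infty}(V)}=\max\Big\{\max_{1\le k\le n}\sup_V\sum_{i_1,\dots,i_k}a_{i_1}\cdots a_{i_k}|D^k_{x_{i_1}\cdots x_{i_k}}f|,\ \sup_V|f|\Big\}.$$ Let $D_{x_i}^*\varphi=-D_{x_i}\varphi+\frac{x_i}{a_i^2}\varphi$. For $1\le p<\infty$ and $f\in L^p(V,P)$, a function $g\in L^p(V,P)$ is the weak derivative $D^k_{x_{i_1}\cdots x_{i_k}}f$ if $\int_V g\varphi\,dP=\int_V f\,(D^*_{x_{i_k}}\cdots D^*_{x_{i_1}}\varphi)\,dP$ for all $\varphi\in C^\infty_{\mathcal F}(V)$. $W^{m,p}(V)$ is the space of $f\in L^p(V,P)$ having all weak derivatives of orders $1,\dots,m$ in $L^p(V,P)$ with $$\|f\|^p_{W^{m,p}(V)}=\int_V|f|^p\,dP+\sum_{k=1}^m\sum_{i_1,\dots,i_k}a_{i_1}^p\cdots a_{i_k}^p\int_V|D^k_{x_{i_1}\cdots x_{i_k}}f|^p\,dP<\infty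 .$$ **Hypotheses.** Let $m\ge 1$, $1\le p<\infty$, let $O\subset\ell^2$ be open and $x_0\in\partial O$. Let $U$ be an open neighbourhood of $x_0$ and $g\in C_F^\infty(U)$ with $U\cap O=\{y\in U:g(y)>0\}$, $U\cap\partial O=\{y\in U:g(y)=0\}$ and $(D_{x_i}g(y))_i\ne0$ for all $y\in U$. Let $i_0\in\mathbb N$, let $U_1=B_{r_0}(x_0)\subset U$ with $r_0>0$, and let $\psi(x)\in\ell^2$, for $x\in U_1$, be obtained from $x$ by putting $g(x)$ in position $1$ and, if $i_0\neq1$, $x_1$ in position $i_0$. Assume that $\psi$ is a homeomorphism of $U_1$ onto an open set $\psi(U_1)$ and $\psi(U_1\cap O)=\psi(U_1)\cap\mathbb H$; that the function $h$ on $\psi(U_1)$ determined by $h(\psi(x))=x_{i_0}$ belongs to $C_F^\infty(\psi(U_1))$; and that, with $\tau=\psi^{-1}$, $\psi$ maps sets uniformly included in $U_1\cap O$ to sets uniformly included in $\psi(U_1)\cap\mathbb H$, and $\tau$ maps sets uniformly included in $\psi(U_1)\cap\mathbb H$ to sets uniformly included in $U_1\cap O$. Finally let $0<r_1<r_0$,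 $U_0=B_{r_1}(x_0)$ and $\delta\in(0,\infty)$ be such that $|x_{i_0}|<\delta$ and $\frac1\delta<|D_{x_{i_0}}g(x)|<\delta$ for $x\in U_0$, $|\widehat x_1|<\delta$ and $\frac1\delta<|D_{x_1}h(\widehat x)|<\delta$ for $\widehat x\in\psi(U_0)$, $\|g\|_{W^{m,\infty}(O\cap U_0)}<\delta$ and $\|h\|_{W^{m,\infty}(\psi(U_0)\cap\mathbb H)}<\delta$. **Theorem.** There is a constant $C\in(0,\infty)$ such that: 1. for every $f\in W^{m,p}(U_0\cap O)$ one has $f\circ\tau\in W^{m,p}(\psi(U_0)\cap\mathbb H)$ and $$C^{-1}\|f\|_{W^{m,p}(U_0\cap O)}\le\|f\circ\tau\|_{W^{m,p}(\psi(U_0)\cap\mathbb H)}\le C\,\|f\|_{W^{m,p}(U_0\cap O)};$$ 2. for every $F\in W^{m,p}(\psi(U_0)\cap\mathbb H)$ one has $F\circ\psi\in W^{m,p}(U_0\cap O)$ and $$C^{-1}\|F\|_{W^{m,p}(\psi(U_0)\cap\mathbb H)}\le\|F\circ\psi\|_{W^{m,p}(U_0\cap O)}\le C\,\|F\|_{W^{m,p}(\psi(U_0)\cap\mathbb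 H)}.$$ -/

import Mathlib

open MeasureTheory ProbabilityTheory
open scoped ENNReal

noncomputable section

namespace GaussSobolev

/-- The real Hilbert space of square summable sequences. Coordinates are numbered from `0`, so
the first coordinate is the one with index `0`. -/
abbrev Ell2 : Type := lp (fun _ : ℕ => ℝ) 2

instance instMeasurableSpaceEll2 : MeasurableSpace Ell2 := borel Ell2

instance instBorelSpaceEll2 : BorelSpace Ell2 := ⟨rfl⟩

/-- The standard unit vectors. -/
def e (i : ℕ) : Ell2 := lp.single 2 i (1 : ℝ)

/-- The Gaussian measure `P`: the restriction to the Borel sets of `Ell2` of the product over `i`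
of the centred Gaussian measures on the line with standard deviation `a i`. -/
def gaussP (a : ℕ → ℝ) : Measure Ell2 :=
  (Measure.infinitePi (fun i => gaussianReal 0 ((a i) ^ 2).toNNReal)).comap
    (fun (x : Ell2) (i : ℕ) => x i)

/-- `E` is uniformly included in `V`. -/
def UnifIncl (E V : Set Ell2) : Prop :=
  ∃ r R : ℝ, 0 < r ∧ 0 < R ∧ (∀ x ∈ E, Metric.ball x r ⊆ V) ∧ E ⊆ Metric.ball 0 R

/-- Continuity on `U` along all finite dimensional slices in the directions of the first `l`
coordinates. -/
def FContinuousOn (U : Set Ell2) (f : Ell2 → ℝ) : Prop :=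
  ∀ x ∈ U, ∀ l : ℕ, ContinuousOn
    (fun s : Fin l → ℝ => f (x + ∑ i : Fin l, s i • e (i : ℕ)))
    {s : Fin l → ℝ | x + ∑ i : Fin l, s i • e (i : ℕ) ∈ U}

/-- Iterated classical partial derivatives: for `I = [i₁, …, iₖ]` this is
`D_{i₁} (D_{i₂} (⋯ (D_{iₖ} f)))`. On an open set it only depends on `f` there. -/
def partialD : List ℕ → (Ell2 → ℝ) → Ell2 → ℝ
  | [], f => f
  | i :: I, f => fun x => lineDeriv ℝ (partialD I f) x (e i)

/-- The class of functions which are, together with all their iterated partial derivatives,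
`F`-continuous and Borel measurable on the open set `U`, the partial derivatives (of order at
least one) being moreover bounded on `U`. -/
structure IsCFInfty (U : Set Ell2) (f : Ell2 → ℝ) : Prop where
  differentiable : ∀ (I : List ℕ) (i : ℕ), ∀ x ∈ U, LineDifferentiableAt ℝ (partialD I f) x (e i)
  fcontinuous : ∀ I : List ℕ, FContinuousOn U (partialD I f)
  measurable : ∀ I : List ℕ, Measurable (fun x : U => partialD I f x)
  bounded : ∀ I : List ℕ, I ≠ [] → ∃ M : ℝ, ∀ x ∈ U, |partialD I f x| ≤ M

/-- Test functions on the open set `U`. -/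
structure IsTest (a : ℕ → ℝ) (U : Set Ell2) (φ : Ell2 → ℝ) : Prop where
  smooth : IsCFInfty U φ
  bounded : ∀ k : ℕ, 1 ≤ k →
    (⨆ x ∈ U, ∑' I : Fin k → ℕ,
      ENNReal.ofReal ((∏ j, a (I j) ^ 2) * |partialD (List.ofFn I) φ x| ^ 2)) < ⊤
  support : UnifIncl {x ∈ U | φ x ≠ 0} U

/-- The norm of `W^{n,∞}(U)`, with value `⊤` if one of the suprema is infinite. -/
def wInftyNorm (a : ℕ → ℝ) (n : ℕ) (U : Set Ell2) (f : Ell2 → ℝ) : ℝ≥0∞ :=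
  max
    (⨆ k ∈ Finset.Icc 1 n, ⨆ x ∈ U, ∑' I : Fin k → ℕ,
      ENNReal.ofReal ((∏ j, a (I j)) * |partialD (List.ofFn I) f x|))
    (⨆ x ∈ U, ENNReal.ofReal |f x|)

/-- The formal adjoint of the `i`-th partial derivative with respect to `gaussP a`. -/
def dualD (a : ℕ → ℝ) (i : ℕ) (φ : Ell2 → ℝ) : Ell2 → ℝ :=
  fun x => -lineDeriv ℝ φ x (e i) + x i / (a i) ^ 2 * φ x

/-- For `I = [i₁, …, iₖ]` this is `D*_{iₖ} (⋯ (D*_{i₁} φ))`. -/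
def iterDualD (a : ℕ → ℝ) : List ℕ → (Ell2 → ℝ) → Ell2 → ℝ
  | [], φ => φ
  | i :: I, φ => iterDualD a I (dualD a i φ)

/-- `g` is a weak derivative of `f` on `U`, of multi-index `I`, lying in `L^p(U, P)`. -/
def IsWeakDeriv (a : ℕ → ℝ) (p : ℝ) (U : Set Ell2) (I : List ℕ) (f g : Ell2 → ℝ) : Prop :=
  MemLp g (ENNReal.ofReal p) ((gaussP a).restrict U) ∧
    ∀ φ : Ell2 → ℝ, IsTest a U φ →
      ∫ x in U, g x * φ x ∂(gaussP a) = ∫ x in U, f x * iterDualD a I φ x ∂(gaussP a)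

open Classical in
/-- A representative of the weak derivative of `f` (`0` if there is none in `L^p`). -/
def weakD (a : ℕ → ℝ) (p : ℝ) (U : Set Ell2) (I : List ℕ) (f : Ell2 → ℝ) : Ell2 → ℝ :=
  if H : ∃ g, IsWeakDeriv a p U I f g then H.choose else 0

/-- The `p`-th power of the Sobolev norm, as an extended nonnegative real. -/
def sobolevEnergy (a : ℕ → ℝ) (m : ℕ) (p : ℝ) (U : Set Ell2) (f : Ell2 → ℝ) : ℝ≥0∞ :=
  (∫⁻ x in U, ‖f x‖ₑ ^ p ∂(gaussP a)) +
    ∑ k ∈ Finset.Icc 1 m, ∑' I : Fin k → ℕ,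
      ENNReal.ofReal (∏ j, a (I j) ^ p) *
        ∫⁻ x in U, ‖weakD a p U (List.ofFn I) f x‖ₑ ^ p ∂(gaussP a)

/-- Membership of (the class of) `f` in `W^{m,p}(U)`. -/
structure MemW (a : ℕ → ℝ) (m : ℕ) (p : ℝ) (U : Set Ell2) (f : Ell2 → ℝ) : Prop where
  memLp : MemLp f (ENNReal.ofReal p) ((gaussP a).restrict U)
  exists_weakDeriv : ∀ k ∈ Finset.Icc 1 m, ∀ I : Fin k → ℕ,
    ∃ g, IsWeakDeriv a p U (List.ofFn I) f g
  energy_lt_top : sobolevEnergy a m p U f < ⊤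

/-- The norm of `W^{m,p}(U)`. -/
def sobolevNorm (a : ℕ → ℝ) (m : ℕ) (p : ℝ) (U : Set Ell2) (f : Ell2 → ℝ) : ℝ :=
  (sobolevEnergy a m p U f).toReal ^ (1 / p)

/-- The half-space `x₁ > 0` (the first coordinate has index `0`). -/
def halfSpace : Set Ell2 := {x | 0 < x 0}

/-- The straightening map `ψ`: the first coordinate is replaced by `g x`, and, if `i₀` is not the
first index, the old first coordinate is moved to position `i₀`. -/
def psi (i₀ : ℕ) (g : Ell2 → ℝ) (x : Ell2) : Ell2 :=
  x + (g x - x 0) • e 0 + (if i₀ = 0 then 0 else (x 0 - x i₀) • e i₀)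

/-- The inverse map `τ`: coordinate `i₀` is replaced by `h y`, and, if `i₀` is not the first index,
the old coordinate `i₀` is moved to the first position. -/
def tau (i₀ : ℕ) (h : Ell2 → ℝ) (y : Ell2) : Ell2 :=
  y + (h y - y i₀) • e i₀ + (if i₀ = 0 then 0 else (y i₀ - y 0) • e 0)

theorem e_apply (i j : ℕ) : (e i : Ell2) j = if j = i then 1 else 0 := by
  unfold e
  rw [lp.coeFn_single]
  by_cases hij : j = i
  · subst hij; simp
  · simp [hij]

theorem psi_apply (i₀ : ℕ) (g : Ell2 → ℝ) (x : Ell2) (i : ℕ) :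
    psi i₀ g x i = if i = 0 then g x else if i = i₀ then x 0 else x i := by
  have key : psi i₀ g x i = x i + (g x - x 0) * (e 0 : Ell2) i +
      (if i₀ = 0 then 0 else (x 0 - x i₀) * (e i₀ : Ell2) i) := by
    unfold psi
    split_ifs <;> rfl
  rw [key]
  simp only [e_apply]
  split_ifs <;> subst_vars <;> simp_all

theorem tau_apply (i₀ : ℕ) (h : Ell2 → ℝ) (y : Ell2) (i : ℕ) :
    tau i₀ h y i = if i = i₀ then h y else if i = 0 then y i₀ else y i := by
  have key : tau i₀ h y i = y i + (h y - y i₀) * (e i₀ : Ell2) i +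
      (if i₀ = 0 then 0 else (y i₀ - y 0) * (e 0 : Ell2) i) := by
    unfold tau
    split_ifs <;> rfl
  rw [key]
  simp only [e_apply]
  split_ifs <;> subst_vars <;> simp_all

/-- `g` is a smooth defining function of `O` in the open neighbourhood `U` of `x₀`. -/
structure IsDefiningFunction (O : Set Ell2) (x₀ : Ell2) (U : Set Ell2) (g : Ell2 → ℝ) : Prop where
  isOpen : IsOpen U
  mem : x₀ ∈ U
  smooth : IsCFInfty U g
  inter_eq : U ∩ O = {y ∈ U | 0 < g y}
  inter_frontier_eq : U ∩ frontier O = {y ∈ U | g y = 0}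
  grad_ne_zero : ∀ y ∈ U, ∃ i : ℕ, lineDeriv ℝ g y (e i) ≠ 0

/-- On the ball `U₁` of centre `x₀` and radius `r₀`, contained in the domain `U` of the defining
function `g`, the map `ψ = psi i₀ g` straightens the boundary of `O`, and its inverse is
`τ = tau i₀ h`, where `h (ψ x)` is the coordinate `i₀` of `x`. -/
structure IsStraightening (O : Set Ell2) (x₀ : Ell2) (U : Set Ell2) (g : Ell2 → ℝ)
    (i₀ : ℕ) (r₀ : ℝ) (h : Ell2 → ℝ) : Prop where
  radius_pos : 0 < r₀
  ball_subset : Metric.ball x₀ r₀ ⊆ U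
  /- `ψ` is a homeomorphism of `U₁` onto an open set -/
  isOpenEmbedding : Topology.IsOpenEmbedding (fun x : Metric.ball x₀ r₀ => psi i₀ g x)
  image_inter : psi i₀ g '' (Metric.ball x₀ r₀ ∩ O) = psi i₀ g '' Metric.ball x₀ r₀ ∩ halfSpace
  h_psi : ∀ x ∈ Metric.ball x₀ r₀, h (psi i₀ g x) = x i₀
  h_smooth : IsCFInfty (psi i₀ g '' Metric.ball x₀ r₀) h
  psi_unifIncl : ∀ E : Set Ell2, UnifIncl E (Metric.ball x₀ r₀ ∩ O) →
    UnifIncl (psi i₀ g '' E) (psi i₀ g '' Metric.ball x₀ r₀ ∩ halfSpace)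
  tau_unifIncl : ∀ E : Set Ell2, UnifIncl E (psi i₀ g '' Metric.ball x₀ r₀ ∩ halfSpace) →
    UnifIncl (tau i₀ h '' E) (Metric.ball x₀ r₀ ∩ O)

/-- The quantitative bounds of order `n` with constant `δ` on a ball `U₀`. -/
structure IsControlled (a : ℕ → ℝ) (n : ℕ) (O : Set Ell2) (g : Ell2 → ℝ) (i₀ : ℕ) (h : Ell2 → ℝ)
    (U₀ : Set Ell2) (δ : ℝ) : Prop where
  delta_pos : 0 < δ
  coord_lt : ∀ x ∈ U₀, |x i₀| < δ
  hat_coord_lt : ∀ y ∈ psi i₀ g '' U₀, |y 0| < δ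
  deriv_g : ∀ x ∈ U₀, 1 / δ < |lineDeriv ℝ g x (e i₀)| ∧ |lineDeriv ℝ g x (e i₀)| < δ
  deriv_h : ∀ y ∈ psi i₀ g '' U₀, 1 / δ < |lineDeriv ℝ h y (e 0)| ∧ |lineDeriv ℝ h y (e 0)| < δ
  norm_g : wInftyNorm a n (O ∩ U₀) g < ENNReal.ofReal δ
  norm_h : wInftyNorm a n (psi i₀ g '' U₀ ∩ halfSpace) h < ENNReal.ofReal δ

end GaussSobolev

end

noncomputable section

namespace GaussSobolev

open Filter Topology

/-! ### The space of square summable sequences -/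

/-! Both `psi` and `tau` are instances of one map, `chartMap`, and the notion of mutually inverse
charts (`ChartPair`) is symmetric. It is therefore enough to show that composition with the inverse
chart sends the Sobolev space on `V` boundedly into that on `W`. The lower bounds follow because
composing back returns the original function on its domain.

Along `e l` a chart moves only in the plane of two basis vectors, so formally, with σ the
transposition of `A` and `B`, D_j(f∘τ) = (D_{σ j} f)∘τ + ((D_B f)∘τ)·D_j h, the first term being
absent for j = A. To prove this weakly, a test function on `W` is pulled back to `V` and multiplied
by the density of the change of variables. That density comes from resampling one Gaussian
coordinate and using the one-dimensional substitution rule (`lintegral_chartMap`). Removing one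
factor D_B g from it leaves `transport`, whose adjoint derivatives reproduce those of the original
test function. For j ≠ A two integrations by parts are combined, and the mixed second derivatives of
g cancel by symmetry (`dual_transport_self`, `dual_transport_ne`, `extWeak_comp`).

The transported function is only known to belong to a larger class than the test functions of the
definition: one F-continuous bounded derivative in one direction, and room to move in that
direction. The analytic core is `extWeak_of_specialTest`: an identity known for globally smooth
tests of temperate growth extends to this class. Bumps times sines and cosines determine finite
measures locally, which allows arbitrary bounded Borel dependence on the other coordinates.
Mollification along the single direction and dominated convergence then give the extension.
Conversely, iterated adjoints of an honest test function belong to the larger class, so one-step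
weak derivatives can be composed (`HasW.exists_family`).

Higher orders are handled by the recursive predicate `HasW`. The chain rule multiplies one
derivative of f by the whole family D_j h. `HasW.mul_family` bounds all these products
simultaneously, using the weighted sums of derivatives of h and the inclusion of ℓ¹ in ℓ^p.
Induction on the order then gives `hasW_comp`. -/

instance instSecondCountableEll2 : SecondCountableTopology Ell2 := by
  have hs : TopologicalSpace.IsSeparable
      (closure (Submodule.span ℝ (Set.range e) : Set Ell2)) :=
    ((Set.countable_range e).isSeparable.span).closure
  have huniv : closure (Submodule.span ℝ (Set.range e) : Set Ell2) = Set.univ := by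
    refine Set.eq_univ_of_forall fun x => ?_
    have hx := lp.hasSum_single (p := 2) (by norm_num) x
    refine mem_closure_of_tendsto hx (Eventually.of_forall fun s => ?_)
    refine Submodule.sum_mem _ fun i _ => ?_
    have : lp.single 2 i (x i) = x i • e i := by
      rw [e, ← lp.single_smul]; simp
    rw [this]
    exact Submodule.smul_mem _ _ (Submodule.subset_span ⟨i, rfl⟩)
  rw [huniv] at hs
  have : TopologicalSpace.SeparableSpace Ell2 := TopologicalSpace.isSeparable_univ_iff.1 hs
  exact UniformSpace.secondCountable_of_separable Ell2

@[simp] theorem add_coord (x y : Ell2) (i : ℕ) : (x + y) i = x i + y i := rfl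

@[simp] theorem sub_coord (x y : Ell2) (i : ℕ) : (x - y) i = x i - y i := rfl

@[simp] theorem smul_coord (c : ℝ) (x : Ell2) (i : ℕ) : (c • x) i = c * x i := rfl

@[simp] theorem zero_coord (i : ℕ) : (0 : Ell2) i = 0 := rfl

@[simp] theorem e_self (i : ℕ) : (e i : Ell2) i = 1 := by simp [e_apply]

theorem e_ne {i j : ℕ} (h : j ≠ i) : (e i : Ell2) j = 0 := by simp [e_apply, h]

@[simp] theorem norm_e (i : ℕ) : ‖(e i : Ell2)‖ = 1 := by
  rw [e, lp.norm_single (by norm_num)]; simp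

theorem inner_e (i : ℕ) (x : Ell2) : inner ℝ (e i) x = x i := by
  rw [e, lp.inner_single_left]; simp

theorem abs_coord_le (x : Ell2) (i : ℕ) : |x i| ≤ ‖x‖ := lp.norm_apply_le_norm (by norm_num) x i

/-- The `i`-th coordinate as a continuous linear functional. -/
def coordL (i : ℕ) : Ell2 →L[ℝ] ℝ := innerSL ℝ (e i)

@[simp] theorem coordL_apply (i : ℕ) (x : Ell2) : coordL i x = x i := inner_e i x

theorem continuous_coord (i : ℕ) : Continuous (fun x : Ell2 => x i) := by
  simp_rw [← coordL_apply]
  exact (coordL i).continuous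

theorem measurable_coord (i : ℕ) : Measurable (fun x : Ell2 => x i) :=
  (continuous_coord i).measurable

/-- The projection killing the `i`-th coordinate. -/
def dropL (i : ℕ) : Ell2 →L[ℝ] Ell2 :=
  ContinuousLinearMap.id ℝ Ell2 - (coordL i).smulRight (e i)

theorem dropL_apply (i : ℕ) (x : Ell2) : dropL i x = x - x i • e i := by simp [dropL]

theorem dropL_add_smul (i : ℕ) (x : Ell2) (s : ℝ) : dropL i (x + s • e i) = dropL i x := by
  simp only [dropL_apply, add_coord, smul_coord, e_self, mul_one, add_smul]; abel

theorem dropL_add_coord (i : ℕ) (x : Ell2) : dropL i x + x i • e i = x := by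
  simp [dropL_apply]

/-! ### Sums over multi-indices -/

theorem tsum_fin_snoc {k : ℕ} (F : (Fin (k + 1) → ℕ) → ℝ≥0∞) :
    ∑' I, F I = ∑' j : ℕ, ∑' I : Fin k → ℕ, F (Fin.snoc I j) := by
  rw [← (Fin.snocEquiv (fun _ : Fin (k + 1) => ℕ)).tsum_eq F, ENNReal.tsum_prod']
  rfl

theorem ofFn_snoc {k : ℕ} (I : Fin k → ℕ) (j : ℕ) :
    List.ofFn (Fin.snoc I j : Fin (k + 1) → ℕ) = List.ofFn I ++ [j] := by
  rw [List.ofFn_succ']; simp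

theorem prod_snoc {M : Type*} [CommMonoid M] {k : ℕ} (w : ℕ → M) (I : Fin k → ℕ) (j : ℕ) :
    ∏ l, w ((Fin.snoc I j : Fin (k + 1) → ℕ) l) = (∏ l, w (I l)) * w j := by
  rw [Fin.prod_univ_castSucc]; simp

theorem tsum_prod_weights (w : ℕ → ℝ≥0∞) (k : ℕ) :
    ∑' I : Fin k → ℕ, ∏ l, w (I l) = (∑' i, w i) ^ k := by
  induction k with
  | zero => simp
  | succ k ih =>
    rw [tsum_fin_snoc]
    simp_rw [prod_snoc, ENNReal.tsum_mul_right, ih, ENNReal.tsum_mul_left]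
    rw [pow_succ]

/-! ### Smooth test functions of temperate growth -/

/-- Globally smooth functions with temperate growth whose support is uniformly included in `V`. -/
structure SpecialTest (V : Set Ell2) (φ : Ell2 → ℝ) : Prop where
  growth : φ.HasTemperateGrowth
  support : UnifIncl {x | φ x ≠ 0} V

theorem hasLineDerivAt_of_contDiff {φ : Ell2 → ℝ} (h : ContDiff ℝ (⊤ : ℕ∞) φ) (x v : Ell2) :
    HasLineDerivAt ℝ φ (fderiv ℝ φ x v) x v :=
  ((h.differentiable (by simp)) x).hasFDerivAt.hasLineDerivAt v

theorem partialD_eq_iteratedFDeriv {φ : Ell2 → ℝ} (h : ContDiff ℝ (⊤ : ℕ∞) φ) (I : List ℕ) (x : Ell2) :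
    partialD I φ x = iteratedFDeriv ℝ I.length φ x (fun k => e (I.get k)) := by
  induction I generalizing x with
  | nil => simp [partialD]
  | cons i I ih =>
    have hfun : partialD I φ = fun x => iteratedFDeriv ℝ I.length φ x (fun k => e (I.get k)) :=
      funext ih
    have hd : DifferentiableAt ℝ (iteratedFDeriv ℝ I.length φ) x :=
      (h.differentiable_iteratedFDeriv (m := I.length) (by exact_mod_cast ENat.natCast_lt_top _)) x
    simp only [partialD]
    rw [hfun]
    have h1 := (hd.hasFDerivAt.continuousMultilinear_apply_const (fun k => e (I.get k)))
    rw [(h1.hasLineDerivAt (e i)).lineDeriv]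
    exact (iteratedFDeriv_succ_apply_left (n := I.length) (f := φ) (x := x)
      (fun k => e ((i :: I).get k))).symm

theorem contDiff_partialD {φ : Ell2 → ℝ} (h : ContDiff ℝ (⊤ : ℕ∞) φ) (I : List ℕ) :
    ContDiff ℝ (⊤ : ℕ∞) (partialD I φ) := by
  induction I with
  | nil => exact h
  | cons i I ih =>
    have : partialD (i :: I) φ = fun x => fderiv ℝ (partialD I φ) x (e i) := by
      funext x
      exact (hasLineDerivAt_of_contDiff ih x (e i)).lineDeriv
    rw [this]
    exact (ih.fderiv_right (m := (⊤ : ℕ∞)) (by simp)).clm_apply contDiff_const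

theorem UnifIncl.closure {E V : Set Ell2} (h : UnifIncl E V) : UnifIncl (closure E) V := by
  obtain ⟨r, R, hr, hR, hE, hB⟩ := h
  refine ⟨r / 2, R + 1, by positivity, by positivity, fun x hx y hy => ?_, fun x hx => ?_⟩
  · obtain ⟨z, hz, hxz⟩ := Metric.mem_closure_iff.1 hx (r / 2) (by positivity)
    refine hE z hz ?_
    rw [Metric.mem_ball] at hy ⊢
    linarith [dist_triangle y x z]
  · obtain ⟨z, hz, hxz⟩ := Metric.mem_closure_iff.1 hx 1 one_pos
    have := hB hz
    rw [Metric.mem_ball] at this ⊢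
    linarith [dist_triangle x z 0]

theorem UnifIncl.mono {E E' V V' : Set Ell2} (h : UnifIncl E V) (hE : E' ⊆ E) (hV : V ⊆ V') :
    UnifIncl E' V' := by
  obtain ⟨r, R, hr, hR, h1, h2⟩ := h
  exact ⟨r, R, hr, hR, fun x hx => (h1 x (hE hx)).trans hV, hE.trans h2⟩

theorem UnifIncl.subset {E V : Set Ell2} (h : UnifIncl E V) : E ⊆ V := by
  obtain ⟨r, R, hr, hR, h1, h2⟩ := h
  exact fun x hx => h1 x hx (Metric.mem_ball_self hr)

theorem SpecialTest.contDiff {V : Set Ell2} {φ : Ell2 → ℝ} (h : SpecialTest V φ) :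
    ContDiff ℝ (⊤ : ℕ∞) φ := h.growth.1

/-- On the bounded support, polynomial growth is boundedness. The norm of the iterated Fréchet
derivative controls its values on unit vectors, so one bound serves all multi-indices of the given
length. -/
theorem SpecialTest.exists_bound {V : Set Ell2} {φ : Ell2 → ℝ} (h : SpecialTest V φ) (n : ℕ) :
    ∃ M : ℝ, 0 ≤ M ∧ ∀ I : List ℕ, I.length = n → ∀ x, |partialD I φ x| ≤ M := by
  obtain ⟨k, C, hC, hb⟩ := h.growth.norm_iteratedFDeriv_le_uniform n
  obtain ⟨r, R, hr, hR, -, hB⟩ := h.support.closure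
  refine ⟨C * (1 + R) ^ k, by positivity, fun I hI x => ?_⟩
  rw [partialD_eq_iteratedFDeriv h.contDiff]
  have h1 := (iteratedFDeriv ℝ I.length φ x).le_opNorm (fun k => e (I.get k))
  simp only [norm_e, Finset.prod_const_one, mul_one, Real.norm_eq_abs] at h1
  subst hI
  refine h1.trans ?_
  by_cases hx : x ∈ tsupport φ
  · refine (hb _ le_rfl x).trans ?_
    have : ‖x‖ ≤ R := by
      have := hB hx
      rw [mem_ball_zero_iff] at this
      exact this.le
    gcongr
  · have : iteratedFDeriv ℝ I.length φ x = 0 := by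
      by_contra hne
      exact hx (support_iteratedFDeriv_subset I.length hne)
    rw [this]; simp; positivity

theorem FContinuousOn.of_continuous {V : Set Ell2} {f : Ell2 → ℝ} (hf : Continuous f) :
    FContinuousOn V f := by
  intro x _ l
  apply Continuous.continuousOn
  fun_prop

theorem summable_sq_weights {a : ℕ → ℝ} (ha_pos : ∀ i, 0 < a i) (ha_sum : Summable a) :
    ∑' i, ENNReal.ofReal (a i ^ 2) < ⊤ := by
  have : Summable fun i => a i ^ 2 := by
    refine Summable.of_norm_bounded_eventually_nat ha_sum ?_
    filter_upwards [ha_sum.tendsto_atTop_zero.eventually (gt_mem_nhds one_pos)] with i hi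
    have := ha_pos i
    rw [Real.norm_of_nonneg (by positivity)]
    nlinarith
  rw [← ENNReal.ofReal_tsum_of_nonneg (fun i => by positivity) this]
  exact ENNReal.ofReal_lt_top

/-- A bound `M` uniform in the multi-index makes the weighted sum of order `k` at most `(∑ a i ^ 2)
^ k * M ^ 2`. -/
theorem SpecialTest.isTest {a : ℕ → ℝ} (ha_pos : ∀ i, 0 < a i) (ha_sum : Summable a)
    {V : Set Ell2} {φ : Ell2 → ℝ} (h : SpecialTest V φ) : IsTest a V φ := by
  refine ⟨⟨fun I i x _ => ?_, fun I => ?_, fun I => ?_, fun I _ => ?_⟩, fun k _ => ?_, ?_⟩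
  · exact (hasLineDerivAt_of_contDiff (contDiff_partialD h.contDiff I) x (e i)).lineDifferentiableAt
  · exact FContinuousOn.of_continuous (contDiff_partialD h.contDiff I).continuous
  · exact ((contDiff_partialD h.contDiff I).continuous.comp continuous_subtype_val).measurable
  · obtain ⟨M, _, hM⟩ := h.exists_bound I.length
    exact ⟨M, fun x _ => hM I rfl x⟩
  · obtain ⟨M, hM0, hM⟩ := h.exists_bound k
    refine lt_of_le_of_lt (b := (∑' i, ENNReal.ofReal (a i ^ 2)) ^ k * ENNReal.ofReal (M ^ 2)) ?_
      (ENNReal.mul_lt_top (ENNReal.pow_lt_top (summable_sq_weights ha_pos ha_sum))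
        ENNReal.ofReal_lt_top)
    refine iSup₂_le fun x _ => ?_
    rw [← tsum_prod_weights, ← ENNReal.tsum_mul_right]
    refine ENNReal.tsum_le_tsum fun I => ?_
    rw [← ENNReal.ofReal_prod_of_nonneg (fun _ _ => by positivity),
      ← ENNReal.ofReal_mul (Finset.prod_nonneg fun _ _ => by positivity)]
    have h1 := hM (List.ofFn I) (by simp) x
    exact ENNReal.ofReal_le_ofReal (by gcongr)
  · exact h.support.mono (fun x hx => hx.2) subset_rfl

theorem support_partialD_cons_subset (φ : Ell2 → ℝ) (x v : Ell2) (hx : lineDeriv ℝ φ x v ≠ 0) :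
    x ∈ closure {x | φ x ≠ 0} := by
  by_contra hc
  apply hx
  have h0 : φ =ᶠ[𝓝 x] fun _ => (0 : ℝ) := by
    filter_upwards [isClosed_closure.isOpen_compl.mem_nhds hc] with y hy
    by_contra hne
    exact hy (subset_closure hne)
  rw [h0.lineDeriv_eq]
  simp [lineDeriv]

theorem growth_lineDeriv {φ : Ell2 → ℝ} (h : φ.HasTemperateGrowth) (i : ℕ) :
    (fun x => lineDeriv ℝ φ x (e i)).HasTemperateGrowth := by
  have h1 : (fun x => lineDeriv ℝ φ x (e i)) = fun x => fderiv ℝ φ x (e i) := by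
    funext x; exact (hasLineDerivAt_of_contDiff h.1 x (e i)).lineDeriv
  have h2 : (fderiv ℝ φ).HasTemperateGrowth := by
    refine ⟨h.1.fderiv_right (m := (⊤ : ℕ∞)) (by simp), fun n => ?_⟩
    obtain ⟨k, C, hb⟩ := h.2 (n + 1)
    refine ⟨k, C, fun x => ?_⟩
    rw [norm_iteratedFDeriv_fderiv]
    exact hb x
  rw [h1]
  exact (ContinuousLinearMap.apply ℝ ℝ (e i)).hasTemperateGrowth.comp h2

/-- Stability under the adjoint derivatives allows a weak derivative of order `k + 1` to be compared
with one of order `k` by means of special tests alone. -/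
theorem SpecialTest.dualD {V : Set Ell2} {φ : Ell2 → ℝ} (h : SpecialTest V φ) (a : ℕ → ℝ) (i : ℕ) :
    SpecialTest V (dualD a i φ) := by
  refine ⟨?_, h.support.closure.mono (fun x hx => ?_) subset_rfl⟩
  · have h1 := growth_lineDeriv h.growth i
    have h2 : (fun x : Ell2 => x i / a i ^ 2).HasTemperateGrowth := by
      have : (fun x : Ell2 => x i / a i ^ 2) = ((a i ^ 2)⁻¹ • coordL i : Ell2 →L[ℝ] ℝ) := by
        funext x; simp [div_eq_inv_mul]
      rw [this]; exact ContinuousLinearMap.hasTemperateGrowth _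
    have h3 := h.growth
    unfold GaussSobolev.dualD
    fun_prop
  · by_contra hc
    apply hx
    have h0 : φ x = 0 := by
      by_contra hne; exact hc (subset_closure hne)
    have h1 : lineDeriv ℝ φ x (e i) = 0 := by
      by_contra hne; exact hc (support_partialD_cons_subset φ x _ hne)
    simp [GaussSobolev.dualD, h0, h1]

/-! ### The Gaussian measure -/

/-- The Gaussian law of the `i`-th coordinate. -/
abbrev coordLaw (a : ℕ → ℝ) (i : ℕ) : Measure ℝ := gaussianReal 0 ((a i) ^ 2).toNNReal

theorem measurableEmbedding_coe : MeasurableEmbedding (fun (x : Ell2) (i : ℕ) => x i) := by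
  refine Continuous.measurableEmbedding (continuous_pi continuous_coord) fun x y h => ?_
  ext i
  exact congrFun h i

instance instIsFiniteMeasureGaussP (a : ℕ → ℝ) : IsFiniteMeasure (gaussP a) := by
  refine ⟨?_⟩
  rw [gaussP, measurableEmbedding_coe.comap_apply]
  exact measure_lt_top _ _

/-- Independence of the coordinates: drawing one of them afresh does not change the product law. It
suffices to check finite-dimensional boxes. -/
theorem map_update_infinitePi (a : ℕ → ℝ) (i : ℕ) :
    ((Measure.infinitePi (coordLaw a)).prod (coordLaw a i)).map
      (fun z : (ℕ → ℝ) × ℝ => Function.update z.1 i z.2) = Measure.infinitePi (coordLaw a) := by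
  have hm : Measurable (fun z : (ℕ → ℝ) × ℝ => Function.update z.1 i z.2) := by
    refine measurable_pi_iff.2 fun j => ?_
    by_cases h : j = i
    · subst h; simpa using measurable_snd
    · simp only [Function.update_of_ne h]
      exact (measurable_pi_apply j).comp measurable_fst
  refine Measure.eq_infinitePi _ fun s t ht => ?_
  rw [Measure.map_apply hm (MeasurableSet.pi s.countable_toSet fun j _ => ht j)]
  have hpre : (fun z : (ℕ → ℝ) × ℝ => Function.update z.1 i z.2) ⁻¹' ((s : Set ℕ).pi t) =
      (((s.erase i : Finset ℕ) : Set ℕ).pi t) ×ˢ (if i ∈ s then t i else Set.univ) := by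
    ext z
    simp only [Set.mem_preimage, Set.mem_pi, Set.mem_prod, Finset.mem_coe, Finset.mem_erase]
    constructor
    · intro h
      refine ⟨fun j hj => by simpa [Function.update_of_ne hj.1] using h j hj.2, ?_⟩
      split_ifs with hi
      · simpa using h i hi
      · trivial
    · rintro ⟨h1, h2⟩ j hj
      by_cases hji : j = i
      · subst hji; simpa [hj] using h2
      · rw [Function.update_of_ne hji]; exact h1 j ⟨hji, hj⟩
  rw [hpre, Measure.prod_prod, Measure.infinitePi_pi _ (fun j _ => ht j)]
  by_cases hi : i ∈ s
  · rw [if_pos hi, Finset.prod_erase_mul _ _ hi]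
  · rw [if_neg hi, Finset.erase_eq_of_notMem hi]; simp

theorem map_coe_gaussP (a : ℕ → ℝ) :
    (gaussP a).map (fun (x : Ell2) (i : ℕ) => x i) =
      (Measure.infinitePi (coordLaw a)).restrict (Set.range fun (x : Ell2) (i : ℕ) => x i) :=
  measurableEmbedding_coe.map_comap _

theorem continuous_resample (i : ℕ) :
    Continuous (fun z : Ell2 × ℝ => dropL i z.1 + z.2 • e i) := by fun_prop

theorem resample_coord (i : ℕ) (x : Ell2) (t : ℝ) (j : ℕ) :
    (dropL i x + t • e i) j = Function.update (fun j => x j) i t j := by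
  by_cases h : j = i
  · subst h; simp [dropL_apply]
  · simp [dropL_apply, e_ne h, Function.update_of_ne h]

/-- This plays the role of Fubini's theorem for splitting off one coordinate, without decomposing
the sequence space as a product. -/
theorem map_resample_gaussP (a : ℕ → ℝ) (i : ℕ) :
    ((gaussP a).prod (coordLaw a i)).map (fun z : Ell2 × ℝ => dropL i z.1 + z.2 • e i) =
      gaussP a := by
  set ι : Ell2 → ℕ → ℝ := fun x i => x i with hι
  have hem : MeasurableEmbedding ι := measurableEmbedding_coe
  have hup : Measurable (fun z : (ℕ → ℝ) × ℝ => Function.update z.1 i z.2) := by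
    refine measurable_pi_iff.2 fun j => ?_
    by_cases h : j = i
    · subst h; simpa using measurable_snd
    · simp only [Function.update_of_ne h]
      exact (measurable_pi_apply j).comp measurable_fst
  have hinj : ∀ μ ν : Measure Ell2, μ.map ι = ν.map ι → μ = ν := by
    intro μ ν h
    rw [← hem.comap_map μ, ← hem.comap_map ν, h]
  apply hinj
  rw [Measure.map_map hem.measurable (continuous_resample i).measurable]
  have h1 : ι ∘ (fun z : Ell2 × ℝ => dropL i z.1 + z.2 • e i) =
      (fun z : (ℕ → ℝ) × ℝ => Function.update z.1 i z.2) ∘ Prod.map ι id := by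
    funext z
    funext j
    exact resample_coord i z.1 z.2 j
  rw [h1, ← Measure.map_map hup (hem.measurable.prodMap measurable_id),
    ← Measure.map_prod_map _ _ hem.measurable measurable_id, Measure.map_id, hι, map_coe_gaussP]
  conv_rhs => rw [← map_update_infinitePi a i]
  rw [Measure.restrict_map hup hem.measurableSet_range]
  -- Square summability is insensitive to one coordinate, so updating neither creates nor destroys
  -- membership in the range.
  have h2 : ((fun z : (ℕ → ℝ) × ℝ => Function.update z.1 i z.2) ⁻¹' (Set.range ι)) =
      (Set.range ι) ×ˢ Set.univ := by
    ext z
    simp only [Set.mem_preimage, Set.mem_prod, Set.mem_univ, and_true]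
    constructor
    · rintro ⟨x, hx⟩
      refine ⟨dropL i x + z.1 i • e i, ?_⟩
      funext j
      rw [hι]
      simp only [resample_coord]
      have hxj : ∀ j, x j = Function.update z.1 i z.2 j := fun j => congrFun hx j
      by_cases h : j = i
      · subst h; simp
      · rw [Function.update_of_ne h, hxj, Function.update_of_ne h]
    · rintro ⟨x, hx⟩
      refine ⟨dropL i x + z.2 • e i, ?_⟩
      funext j
      rw [hι]
      simp only [resample_coord]
      rw [← hx]
  rw [h2, ← Measure.prod_restrict, Measure.restrict_univ]

theorem lintegral_resample (a : ℕ → ℝ) (i : ℕ) {F : Ell2 → ℝ≥0∞} (hF : Measurable F) :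
    ∫⁻ x, F x ∂(gaussP a) =
      ∫⁻ x, ∫⁻ t, F (dropL i x + t • e i) ∂(coordLaw a i) ∂(gaussP a) := by
  conv_lhs => rw [← map_resample_gaussP a i]
  rw [lintegral_map hF (continuous_resample i).measurable, lintegral_prod]
  exact (hF.comp (continuous_resample i).measurable).aemeasurable

/-- The density of the `i`-th coordinate. -/
def rho (a : ℕ → ℝ) (i : ℕ) (t : ℝ) : ℝ := gaussianPDFReal 0 ((a i) ^ 2).toNNReal t

theorem rho_pos {a : ℕ → ℝ} (ha : ∀ i, 0 < a i) (i : ℕ) (t : ℝ) : 0 < rho a i t :=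
  gaussianPDFReal_pos _ _ _ (by have := ha i; simp; positivity)

theorem coordLaw_eq {a : ℕ → ℝ} (ha : ∀ i, 0 < a i) (i : ℕ) :
    coordLaw a i = volume.withDensity (fun t => ENNReal.ofReal (rho a i t)) :=
  gaussianReal_of_var_ne_zero _ (by have := ha i; simp; positivity)

theorem hasDerivAt_rho {a : ℕ → ℝ} (ha : ∀ i, 0 < a i) (i : ℕ) (t : ℝ) :
    HasDerivAt (rho a i) (-(t / a i ^ 2) * rho a i t) t := by
  have h0 : ((a i ^ 2).toNNReal : ℝ) = a i ^ 2 := by simp; positivity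
  have hai := ha i
  have h1 : HasDerivAt (fun t : ℝ => -(t - 0) ^ 2 / (2 * a i ^ 2)) (-(t / a i ^ 2)) t := by
    have := ((((hasDerivAt_id t).sub_const 0).pow 2).neg).div_const (2 * a i ^ 2)
    refine this.congr_deriv ?_
    simp only [id, sub_zero, Nat.cast_ofNat, mul_one]
    field_simp
    norm_num
  have h2 := (h1.exp).const_mul (Real.sqrt (2 * Real.pi * a i ^ 2))⁻¹
  have hf : rho a i = fun t => (Real.sqrt (2 * Real.pi * a i ^ 2))⁻¹ *
      Real.exp (-(t - 0) ^ 2 / (2 * a i ^ 2)) := by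
    funext t; simp [rho, gaussianPDFReal, h0]
  rw [hf]
  refine h2.congr_deriv ?_
  ring

theorem measurable_rho (a : ℕ → ℝ) (i : ℕ) : Measurable (rho a i) :=
  measurable_gaussianPDFReal _ _

theorem lintegral_resample_rho {a : ℕ → ℝ} (ha : ∀ i, 0 < a i) (i : ℕ) {F : Ell2 → ℝ≥0∞}
    (hF : Measurable F) :
    ∫⁻ x, F x ∂(gaussP a) =
      ∫⁻ x, (∫⁻ t : ℝ, F (dropL i x + t • e i) * ENNReal.ofReal (rho a i t)) ∂(gaussP a) := by
  rw [lintegral_resample a i hF]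
  refine lintegral_congr fun x => ?_
  rw [coordLaw_eq ha, lintegral_withDensity_eq_lintegral_mul _ (measurable_rho a i).ennreal_ofReal]
  · refine lintegral_congr fun t => ?_
    simp [mul_comm]
  · exact hF.comp ((continuous_resample i).measurable.comp (measurable_const.prodMk measurable_id))

/-! ### Change of variables -/

/-- The map preserves every line parallel to `e i`, and on each line the slice of `V` is carried by
`g` bijectively onto the slice of `W`. The one-dimensional substitution rule applies slice by slice,
and the quotient of the two values of `rho` converts Lebesgue measure back to the Gaussian law. -/
theorem lintegral_replace_coord {a : ℕ → ℝ} (ha : ∀ i, 0 < a i) (i : ℕ) {V W : Set Ell2}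
    (hV : MeasurableSet V) (hW : MeasurableSet W) {g g' : Ell2 → ℝ} (hg : Measurable g)
    (hg' : Measurable g') (hd : ∀ x ∈ V, HasLineDerivAt ℝ g (g' x) x (e i))
    (hinj : Set.InjOn (fun x => dropL i x + g x • e i) V)
    (himg : (fun x => dropL i x + g x • e i) '' V = W) {F : Ell2 → ℝ≥0∞} (hF : Measurable F) :
    ∫⁻ y in W, F y ∂(gaussP a) = ∫⁻ x in V, F (dropL i x + g x • e i) *
      ENNReal.ofReal (|g' x| * (rho a i (g x) / rho a i (x i))) ∂(gaussP a) := by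
  have hR : Measurable (fun x => dropL i x + g x • e i) :=
    (dropL i).continuous.measurable.add (hg.smul_const _)
  have hH : Measurable fun x => F (dropL i x + g x • e i) *
      ENNReal.ofReal (|g' x| * (rho a i (g x) / rho a i (x i))) := by
    refine (hF.comp hR).mul (Measurable.ennreal_ofReal ?_)
    exact (hg'.abs).mul (((measurable_rho a i).comp hg).div
      ((measurable_rho a i).comp (measurable_coord i)))
  rw [← lintegral_indicator hW, ← lintegral_indicator hV,
    lintegral_resample_rho ha i (hF.indicator hW), lintegral_resample_rho ha i (hH.indicator hV)]
  refine lintegral_congr fun x => ?_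
  set c : ℝ → Ell2 := fun t => dropL i x + t • e i with hc
  have hcc : Continuous c := by fun_prop
  have hdc : ∀ t, dropL i (c t) = dropL i x := fun t => by
    rw [hc]
    simp only [dropL_add_smul]
    simp [dropL_apply]
  have hci : ∀ t, (c t) i = t := fun t => by simp [hc, dropL_apply]
  set s : Set ℝ := c ⁻¹' V with hs
  have hsm : MeasurableSet s := hcc.measurable hV
  have hmem : ∀ t, t ∈ (fun t => g (c t)) '' s ↔ c t ∈ W := by
    intro t
    rw [← himg]
    constructor
    · rintro ⟨u, hu, rfl⟩
      exact ⟨c u, hu, by simp only [hdc]; rfl⟩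
    · rintro ⟨z, hz, hzt⟩
      have h1 : dropL i z = dropL i x := by
        have := congrArg (dropL i) hzt
        simp only [hdc, dropL_add_smul] at this
        rw [← this]
        simp [dropL_apply]
      have h2 : c (z i) = z := by rw [hc]; simp only [← h1, dropL_add_coord]
      refine ⟨z i, by rw [hs, Set.mem_preimage, h2]; exact hz, ?_⟩
      simp only [h2]
      have := congrArg (fun y : Ell2 => y i) hzt
      simpa [hci, dropL_apply] using this
  have hderiv : ∀ t ∈ s, HasDerivWithinAt (fun t => g (c t)) (g' (c t)) s t := by
    intro t ht
    have h1 : HasDerivAt (fun u : ℝ => g (c t + u • e i)) (g' (c t)) 0 := hd _ ht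
    have h2 : HasDerivAt (fun u : ℝ => g (c t + (u - t) • e i)) (g' (c t)) t := by
      have h1' : HasDerivAt (fun u : ℝ => g (c t + u • e i)) (g' (c t)) (t - t) := by simpa using h1
      exact h1'.comp_sub_const t t
    refine HasDerivAt.hasDerivWithinAt ?_
    convert! h2 using 3 with u
    simp only [hc, sub_smul]; abel
  have hinj' : Set.InjOn (fun t => g (c t)) s := by
    intro t ht u hu htu
    have := hinj ht hu (by simp only [hdc] at htu ⊢; rw [htu])
    have := congrArg (fun y : Ell2 => y i) this
    simpa [hci] using this
  have key := lintegral_image_eq_lintegral_abs_deriv_mul hsm hderiv hinj'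
    (fun t => F (c t) * ENNReal.ofReal (rho a i t))
  have himgm : MeasurableSet ((fun t => g (c t)) '' s) := by
    have : ((fun t => g (c t)) '' s) = c ⁻¹' W := by ext t; exact hmem t
    rw [this]; exact hcc.measurable hW
  rw [← lintegral_indicator hsm, ← lintegral_indicator himgm] at key
  calc ∫⁻ t : ℝ, W.indicator F (c t) * ENNReal.ofReal (rho a i t)
      = _ := ?_
    _ = _ := key
    _ = _ := ?_
  · refine lintegral_congr fun t => ?_
    by_cases h : c t ∈ W
    · rw [Set.indicator_of_mem h, Set.indicator_of_mem ((hmem t).2 h)]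
    · rw [Set.indicator_of_notMem h, Set.indicator_of_notMem (fun h' => h ((hmem t).1 h')),
        zero_mul]
  · refine lintegral_congr fun t => ?_
    by_cases h : c t ∈ V
    · rw [Set.indicator_of_mem (show t ∈ s from h)]
      change _ = V.indicator _ (c t) * _
      rw [Set.indicator_of_mem h, hdc, hci]
      change ENNReal.ofReal |g' (c t)| * (F (c (g (c t))) * _) =
        F (c (g (c t))) * _ * _
      rw [mul_assoc, ← ENNReal.ofReal_mul (by have := rho_pos ha i; have := this t
                                              have := rho_pos ha i (g (c t)); positivity),
        mul_left_comm, ← ENNReal.ofReal_mul (abs_nonneg _)]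
      have := (rho_pos ha i t).ne'
      congr 2
      field_simp
    · rw [Set.indicator_of_notMem (show t ∉ s from h)]
      change _ = V.indicator _ (c t) * _
      rw [Set.indicator_of_notMem h, zero_mul]

/-- Exchange of two coordinates. -/
def swapC (A B : ℕ) (y : Ell2) : Ell2 := y + (y B - y A) • e A + (y A - y B) • e B

theorem swapC_self (A : ℕ) (y : Ell2) : swapC A A y = y := by simp [swapC]

theorem continuous_swapC (A B : ℕ) : Continuous (swapC A B) := by
  have h1 := continuous_coord A
  have h2 := continuous_coord B
  exact (continuous_id.add ((h2.sub h1).smul continuous_const)).add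
    ((h1.sub h2).smul continuous_const)

theorem swapC_coord (A B : ℕ) (y : Ell2) (j : ℕ) : swapC A B y j = y (Equiv.swap A B j) := by
  simp only [swapC, add_coord, smul_coord, e_apply, Equiv.swap_apply_def]
  split_ifs <;> subst_vars <;> simp_all

theorem swapC_swapC (A B : ℕ) (y : Ell2) : swapC A B (swapC A B y) = y := by
  ext j
  rw [swapC_coord, swapC_coord, Equiv.swap_apply_self]

theorem measurable_swap_ratio (a : ℕ → ℝ) (A B : ℕ) : Measurable fun y : Ell2 =>
    rho a B (y A) * rho a A (y B) / (rho a A (y A) * rho a B (y B)) := by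
  have h : ∀ i j, Measurable fun y : Ell2 => rho a i (y j) := fun i j =>
    (measurable_rho a i).comp (measurable_coord j)
  exact ((h B A).mul (h A B)).div ((h A A).mul (h B B))

theorem lintegral_resample_two {a : ℕ → ℝ} (ha : ∀ i, 0 < a i) (A B : ℕ) {H : Ell2 → ℝ≥0∞}
    (hH : Measurable H) : ∫⁻ y, H y ∂(gaussP a) =
      ∫⁻ x, (∫⁻ s : ℝ, ∫⁻ t : ℝ, H (dropL B (dropL A x + s • e A) + t • e B) *
        ENNReal.ofReal (rho a B t) * ENNReal.ofReal (rho a A s)) ∂(gaussP a) := by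
  set Q : Ell2 × ℝ → ℝ≥0∞ := fun z => H (dropL B z.1 + z.2 • e B) *
      ENNReal.ofReal (rho a B z.2) with hQ
  have hm : Measurable Q :=
    (hH.comp (continuous_resample B).measurable).mul
      ((measurable_rho a B).comp measurable_snd).ennreal_ofReal
  have hm' : Measurable fun x => ∫⁻ t : ℝ, Q (x, t) := hm.lintegral_prod_right'
  calc ∫⁻ y, H y ∂(gaussP a) = ∫⁻ x, (∫⁻ t : ℝ, Q (x, t)) ∂(gaussP a) :=
        lintegral_resample_rho ha B hH
    _ = ∫⁻ x, (∫⁻ s : ℝ, (∫⁻ t : ℝ, Q (dropL A x + s • e A, t)) *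
          ENNReal.ofReal (rho a A s)) ∂(gaussP a) := lintegral_resample_rho ha A hm'
    _ = _ := by
      refine lintegral_congr fun x => lintegral_congr fun s => ?_
      have : Measurable fun t : ℝ => Q (dropL A x + s • e A, t) := hm.comp measurable_prodMk_left
      rw [← lintegral_mul_const _ this]

/-- The two coordinates may have different variances, so exchanging them need not preserve the
measure. The weight is the quotient of the two product densities, obtained from Tonelli's theorem
after both coordinates are resampled. -/
theorem lintegral_swapC {a : ℕ → ℝ} (ha : ∀ i, 0 < a i) (A B : ℕ) {F : Ell2 → ℝ≥0∞}
    (hF : Measurable F) :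
    ∫⁻ y, F y ∂(gaussP a) = ∫⁻ y, F (swapC A B y) * ENNReal.ofReal
      (rho a B (y A) * rho a A (y B) / (rho a A (y A) * rho a B (y B))) ∂(gaussP a) := by
  have hr := rho_pos ha
  by_cases hAB : A = B
  · subst hAB
    refine lintegral_congr fun y => ?_
    have := (hr A (y A)).ne'
    rw [swapC_self, div_self (by positivity)]; simp
  have hcoA : ∀ (x : Ell2) (s t : ℝ), (dropL B (dropL A x + s • e A) + t • e B) A = s := by
    intro x s t
    simp [dropL_apply, e_ne hAB]
  have hcoB : ∀ (x : Ell2) (s t : ℝ), (dropL B (dropL A x + s • e A) + t • e B) B = t := by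
    intro x s t
    simp [dropL_apply]
  have hsw : ∀ (x : Ell2) (s t : ℝ), swapC A B (dropL B (dropL A x + s • e A) + t • e B) =
      dropL B (dropL A x + t • e A) + s • e B := by
    intro x s t
    ext j
    have hBA : B ≠ A := fun h => hAB h.symm
    simp only [swapC, dropL_apply, add_coord, sub_coord, smul_coord, e_apply]
    split_ifs <;> subst_vars <;> simp_all
  have hK : Measurable fun y : Ell2 => F (swapC A B y) * ENNReal.ofReal
      (rho a B (y A) * rho a A (y B) / (rho a A (y A) * rho a B (y B))) := by
    exact (hF.comp (continuous_swapC A B).measurable).mul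
      (measurable_swap_ratio a A B).ennreal_ofReal
  rw [lintegral_resample_two ha A B hF, lintegral_resample_two ha A B hK]
  refine lintegral_congr fun x => ?_
  rw [lintegral_lintegral_swap]
  · refine lintegral_congr fun s => lintegral_congr fun t => ?_
    simp only [hcoA, hcoB, hsw]
    have h1 := hr A s
    have h2 := hr B s
    have h3 := hr A t
    have h4 := hr B t
    rw [mul_assoc, mul_assoc, mul_assoc, ← ENNReal.ofReal_mul h2.le, ← ENNReal.ofReal_mul h4.le,
      ← ENNReal.ofReal_mul (by positivity)]
    congr 2
    field_simp
  · refine Measurable.aemeasurable ?_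
    have h1 : Measurable fun z : ℝ × ℝ => dropL B (dropL A x + z.1 • e A) + z.2 • e B :=
      Continuous.measurable (by fun_prop)
    exact ((hF.comp h1).mul ((measurable_rho a B).comp measurable_snd).ennreal_ofReal).mul
      ((measurable_rho a A).comp measurable_fst).ennreal_ofReal

/-- Coordinate `A` is replaced by `g x`, and, if `B ≠ A`, the old coordinate `A` is moved to
position `B`. -/
def chartMap (A B : ℕ) (g : Ell2 → ℝ) (x : Ell2) : Ell2 :=
  x + (g x - x A) • e A + (if B = A then 0 else (x A - x B) • e B)

theorem chartMap_apply (A B : ℕ) (g : Ell2 → ℝ) (x : Ell2) (i : ℕ) :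
    chartMap A B g x i = if i = A then g x else if i = B then x A else x i := by
  unfold chartMap
  by_cases h : B = A
  · simp only [h, if_true, add_coord, smul_coord, zero_coord, e_apply]
    split_ifs <;> subst_vars <;> simp_all
  · simp only [h, if_false, add_coord, smul_coord, e_apply]
    split_ifs <;> subst_vars <;> simp_all

theorem psi_eq_chartMap (i₀ : ℕ) (g : Ell2 → ℝ) : psi i₀ g = chartMap 0 i₀ g := rfl

theorem tau_eq_chartMap (i₀ : ℕ) (h : Ell2 → ℝ) : tau i₀ h = chartMap i₀ 0 h := by
  funext y
  simp only [tau, chartMap, eq_comm]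

theorem chartMap_eq_swapC (A B : ℕ) (g : Ell2 → ℝ) (x : Ell2) :
    chartMap A B g x = swapC A B (dropL B x + g x • e B) := by
  ext j
  rw [chartMap_apply, swapC_coord, Equiv.swap_apply_def]
  simp only [dropL_apply, add_coord, sub_coord, smul_coord, e_apply]
  have hne : j ≠ A → A ≠ j := Ne.symm
  split_ifs <;> subst_vars <;> simp_all

/-- The density of the image of the Gaussian measure under the inverse of `chartMap A B g`;
here `w` stands for the derivative of `g` along `e B`. -/
def chartDensity (a : ℕ → ℝ) (A B : ℕ) (g w : Ell2 → ℝ) (x : Ell2) : ℝ :=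
  |w x| * (rho a A (g x) * (rho a B (x A) / (rho a A (x A) * rho a B (x B))))

/-- A chart is a replacement of coordinate `B` followed by the exchange of `A` and `B`. In the
product of the two densities the factor `rho a B (g x)` cancels, and the resulting formula also
covers `A = B`. -/
theorem lintegral_chartMap {a : ℕ → ℝ} (ha : ∀ i, 0 < a i) (A B : ℕ) {V W : Set Ell2}
    (hV : MeasurableSet V) (hW : MeasurableSet W) {g g' : Ell2 → ℝ} (hg : Measurable g)
    (hg' : Measurable g') (hd : ∀ x ∈ V, HasLineDerivAt ℝ g (g' x) x (e B))
    (hinj : Set.InjOn (chartMap A B g) V) (himg : chartMap A B g '' V = W)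
    {F : Ell2 → ℝ≥0∞} (hF : Measurable F) :
    ∫⁻ y in W, F y ∂(gaussP a) =
      ∫⁻ x in V, F (chartMap A B g x) * ENNReal.ofReal (chartDensity a A B g g' x)
        ∂(gaussP a) := by
  have hr := rho_pos ha
  set R : Ell2 → Ell2 := fun x => dropL B x + g x • e B with hR
  have hT : ∀ x, chartMap A B g x = swapC A B (R x) := chartMap_eq_swapC A B g
  have hW' : MeasurableSet (swapC A B ⁻¹' W) := (continuous_swapC A B).measurable hW
  set K : Ell2 → ℝ≥0∞ := fun y => ENNReal.ofReal
      (rho a B (y A) * rho a A (y B) / (rho a A (y A) * rho a B (y B))) with hKdef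
  have hK : Measurable K := by
    exact (measurable_swap_ratio a A B).ennreal_ofReal
  have h1 : ∫⁻ y in W, F y ∂(gaussP a) =
      ∫⁻ y in swapC A B ⁻¹' W, F (swapC A B y) * K y ∂(gaussP a) := by
    rw [← lintegral_indicator hW, lintegral_swapC ha A B (hF.indicator hW),
      ← lintegral_indicator hW']
    refine lintegral_congr fun y => ?_
    by_cases h : swapC A B y ∈ W
    · rw [Set.indicator_of_mem h, Set.indicator_of_mem (show y ∈ swapC A B ⁻¹' W from h)]
    · rw [Set.indicator_of_notMem h, Set.indicator_of_notMem (show y ∉ swapC A B ⁻¹' W from h),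
        zero_mul]
  rw [h1, lintegral_replace_coord ha B hV hW' hg hg' hd]
  · refine lintegral_congr fun x => ?_
    change F (swapC A B (R x)) * K (R x) * _ = _
    rw [hT, mul_assoc, hKdef]
    simp only
    have hRB : (R x) B = g x := by simp [hR, dropL_apply]
    rw [← ENNReal.ofReal_mul (by have := hr B ((R x) A); have := hr A ((R x) B)
                                 have := hr A ((R x) A); have := hr B ((R x) B); positivity), hRB]
    congr 2
    rw [chartDensity]
    have p1 := hr A (g x)
    have p2 := hr B (g x)
    have p3 := hr A (x A)
    have p4 := hr B (x B)
    have p5 := hr B (x A)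
    by_cases hAB : A = B
    · subst hAB
      rw [hRB]
      field_simp
    · have hRA : (R x) A = x A := by simp [hR, dropL_apply, e_ne hAB]
      rw [hRA]
      field_simp
  · intro x hx y hy hxy
    exact hinj hx hy (by rw [hT, hT]; exact congrArg _ hxy)
  · ext y
    constructor
    · rintro ⟨x, hx, rfl⟩
      rw [Set.mem_preimage, ← hT, ← himg]
      exact ⟨x, hx, rfl⟩
    · intro hy
      rw [Set.mem_preimage, ← himg] at hy
      obtain ⟨x, hx, hxy⟩ := hy
      refine ⟨x, hx, ?_⟩
      rw [hT] at hxy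
      have := congrArg (swapC A B) hxy
      rwa [swapC_swapC, swapC_swapC] at this
  · exact (hF.comp (continuous_swapC A B).measurable).mul hK

/-! ### A vanishing criterion -/

/-- The image of the signed measure of density `w` is represented as a difference of two positive
measures, so that uniqueness theorems for finite positive measures become available. -/
theorem integral_map_withDensity_sub {P : Measure Ell2} {w : Ell2 → ℝ}
    (hw : Integrable w P) {q : Ell2 → Ell2} (hq : Measurable q) {k : Ell2 → ℝ}
    (hk : Measurable k) {M : ℝ} (hM : ∀ y, |k y| ≤ M) :
    ∫ y, k y ∂((P.withDensity fun y => ENNReal.ofReal (w y)).map q) -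
      ∫ y, k y ∂((P.withDensity fun y => ENNReal.ofReal (-w y)).map q) =
      ∫ y, w y * k (q y) ∂P := by
  have key : ∀ v : Ell2 → ℝ, Integrable v P →
      ∫ y, k y ∂((P.withDensity fun y => ENNReal.ofReal (v y)).map q) =
        ∫ y, max (v y) 0 * k (q y) ∂P := by
    intro v hv
    rw [integral_map hq.aemeasurable hk.aestronglyMeasurable,
      integral_withDensity_eq_integral_toReal_smul₀ hv.aemeasurable.ennreal_ofReal
        (Eventually.of_forall fun _ => ENNReal.ofReal_lt_top)]
    simp only [ENNReal.toReal_ofReal', smul_eq_mul]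
  have hint : ∀ v : Ell2 → ℝ, Integrable v P → Integrable (fun y => max (v y) 0 * k (q y)) P := by
    intro v hv
    refine hv.pos_part.mul_bdd (c := M) (hk.comp hq).aestronglyMeasurable
      (Eventually.of_forall fun y => hM _)
  rw [key w hw, key (fun y => -w y) hw.neg, ← integral_sub (hint w hw) (hint (fun y => -w y) hw.neg)]
  refine integral_congr_ae (Eventually.of_forall fun y => ?_)
  simp only
  rw [← sub_mul]
  congr 1
  rcases le_total (w y) 0 with h | h
  · rw [max_eq_right h, max_eq_left (by linarith)]; ring
  · rw [max_eq_left h, max_eq_right (by linarith)]; ring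

theorem isFiniteMeasure_map_withDensity {P : Measure Ell2} {w : Ell2 → ℝ}
    (hw : Integrable w P) (q : Ell2 → Ell2) :
    IsFiniteMeasure ((P.withDensity fun y => ENNReal.ofReal (w y)).map q) := by
  have : IsFiniteMeasure (P.withDensity fun y => ENNReal.ofReal (w y)) :=
    isFiniteMeasure_withDensity_ofReal hw.2
  infer_instance

/-- The hypotheses say that the measures weighted by `χ` have the same characteristic function. They
coincide, and on `b` the weight is `1`. -/
theorem restrict_eq_of_trig {μ ν : Measure Ell2} [IsFiniteMeasure μ] [IsFiniteMeasure ν]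
    {χ : Ell2 → ℝ} (hχ : Measurable χ) {M : ℝ} (hM : ∀ y, |χ y| ≤ M) (h0 : ∀ y, 0 ≤ χ y)
    {b : Set Ell2} (hb : MeasurableSet b) (h1 : ∀ y ∈ b, χ y = 1)
    (hcos : ∀ ξ, ∫ y, χ y * Real.cos (inner ℝ y ξ) ∂μ = ∫ y, χ y * Real.cos (inner ℝ y ξ) ∂ν)
    (hsin : ∀ ξ, ∫ y, χ y * Real.sin (inner ℝ y ξ) ∂μ = ∫ y, χ y * Real.sin (inner ℝ y ξ) ∂ν) :
    μ.restrict b = ν.restrict b := by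
  have hfin : ∀ (m : Measure Ell2) [IsFiniteMeasure m], Integrable χ m := fun m _ =>
    Integrable.of_bound hχ.aestronglyMeasurable M (Eventually.of_forall hM)
  have hfin' : ∀ (m : Measure Ell2) [IsFiniteMeasure m],
      IsFiniteMeasure (m.withDensity fun y => ENNReal.ofReal (χ y)) := fun m _ =>
    isFiniteMeasure_withDensity_ofReal (hfin m).2
  have hchar : ∀ (m : Measure Ell2) [IsFiniteMeasure m] (ξ : Ell2),
      charFun (m.withDensity fun y => ENNReal.ofReal (χ y)) ξ =
        ⟨∫ y, χ y * Real.cos (inner ℝ y ξ) ∂m, ∫ y, χ y * Real.sin (inner ℝ y ξ) ∂m⟩ := by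
    intro m _ ξ
    have hmeas : Measurable fun y : Ell2 => Complex.exp ((inner ℝ y ξ : ℝ) * Complex.I) :=
      Continuous.measurable (by fun_prop)
    have hi : Integrable (fun y => (χ y : ℂ) * Complex.exp ((inner ℝ y ξ : ℝ) * Complex.I)) m :=
      (hfin m).ofReal.mul_bdd (c := 1) hmeas.aestronglyMeasurable
        (Eventually.of_forall fun y => by rw [Complex.norm_exp_ofReal_mul_I])
    rw [charFun_apply, integral_withDensity_eq_integral_toReal_smul₀
      hχ.ennreal_ofReal.aemeasurable (Eventually.of_forall fun _ => ENNReal.ofReal_lt_top)]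
    have h2 : ∀ y, (ENNReal.ofReal (χ y)).toReal • Complex.exp ((inner ℝ y ξ : ℝ) * Complex.I) =
        (χ y : ℂ) * Complex.exp ((inner ℝ y ξ : ℝ) * Complex.I) := fun y => by
      rw [ENNReal.toReal_ofReal (h0 y), Complex.real_smul]
    simp_rw [h2]
    refine Complex.ext ?_ ?_
    · have := integral_re hi
      simp only [RCLike.re_to_complex] at this
      rw [← this]
      simp [Complex.exp_ofReal_mul_I_re]
    · have := integral_im hi
      simp only [RCLike.im_to_complex] at this
      rw [← this]
      simp [Complex.exp_ofReal_mul_I_im]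
  have heq : (μ.withDensity fun y => ENNReal.ofReal (χ y)) =
      ν.withDensity fun y => ENNReal.ofReal (χ y) := by
    have := hfin' μ
    have := hfin' ν
    refine Measure.ext_of_charFun (funext fun ξ => ?_)
    rw [hchar μ, hchar ν, hcos, hsin]
  have hres : ∀ m : Measure Ell2,
      (m.withDensity fun y => ENNReal.ofReal (χ y)).restrict b = m.restrict b := by
    intro m
    rw [restrict_withDensity hb]
    have : (fun y => ENNReal.ofReal (χ y)) =ᵐ[m.restrict b] 1 := by
      filter_upwards [ae_restrict_mem hb] with y hy
      simp [h1 y hy]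
    rw [withDensity_congr_ae this, withDensity_one]
  rw [← hres μ, ← hres ν, heq]

/-- Localized sines and cosines show that the positive and negative parts of the image measure agree
near each point of `A`, hence on a neighbourhood of `A`. The gain is that `κ` is merely bounded and
Borel, whereas only smooth functions were tested. The map `q` allows testing in all coordinates but
one. -/
theorem integral_mul_comp_eq_zero_of_local {P : Measure Ell2} {w : Ell2 → ℝ}
    (hw : Integrable w P) {q : Ell2 → Ell2} (hq : Measurable q) {A : Set Ell2}
    (hloc : ∀ z ∈ A, ∃ r > 0, ∃ χ : Ell2 → ℝ, Continuous χ ∧ (∃ M, ∀ y, |χ y| ≤ M) ∧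
      (∀ y, 0 ≤ χ y) ∧ (∀ y ∈ Metric.ball z r, χ y = 1) ∧
      ∀ ξ : Ell2, ∫ y, w y * (χ (q y) * Real.cos (inner ℝ (q y) ξ)) ∂P = 0 ∧
        ∫ y, w y * (χ (q y) * Real.sin (inner ℝ (q y) ξ)) ∂P = 0)
    {κ : Ell2 → ℝ} (hκ : Measurable κ) {M : ℝ} (hM : ∀ y, |κ y| ≤ M) (h0 : ∀ y ∉ A, κ y = 0) :
    ∫ y, w y * κ (q y) ∂P = 0 := by
  rw [← integral_map_withDensity_sub hw hq hκ hM, sub_eq_zero]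
  set μ := (P.withDensity fun y => ENNReal.ofReal (w y)).map q
  set ν := (P.withDensity fun y => ENNReal.ofReal (-w y)).map q
  have : IsFiniteMeasure μ := isFiniteMeasure_map_withDensity hw q
  have : IsFiniteMeasure ν := isFiniteMeasure_map_withDensity hw.neg q
  choose! r hr χ hχ hχM hχ0 hχ1 hχt using hloc
  -- Second countability gives the Lindelöf property, so countably many of the local equalities
  -- suffice.
  obtain ⟨t, htA, htc, hcov⟩ := TopologicalSpace.countable_cover_nhdsWithin
    (f := fun z => Metric.ball z (r z)) (s := A)
    (fun z hz => mem_nhdsWithin_of_mem_nhds (Metric.ball_mem_nhds z (hr z hz)))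
  have : Countable t := htc
  have hres : μ.restrict (⋃ z : t, Metric.ball (z : Ell2) (r z)) =
      ν.restrict (⋃ z : t, Metric.ball (z : Ell2) (r z)) := by
    rw [Measure.restrict_iUnion_congr]
    rintro ⟨z, hz⟩
    have hzA := htA hz
    obtain ⟨K, hK⟩ := hχM z hzA
    have trig : ∀ F : Ell2 → ℝ, Continuous F → (∀ y, |F y| ≤ 1) →
        ∫ y, w y * (χ z (q y) * F (q y)) ∂P = 0 →
        ∫ y, χ z y * F y ∂μ = ∫ y, χ z y * F y ∂ν := by
      intro F hF hF1 hz0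
      rw [← sub_eq_zero, integral_map_withDensity_sub hw hq
        (k := fun y => χ z y * F y) (M := K) ((hχ z hzA).mul hF).measurable]
      · exact hz0
      · intro y
        rw [abs_mul]
        have h1 := hF1 y
        have h2 := hK y
        have h3 := abs_nonneg (χ z y)
        nlinarith
    refine restrict_eq_of_trig (hχ z hzA).measurable hK (hχ0 z hzA) Metric.isOpen_ball.measurableSet
      (hχ1 z hzA) (fun ξ => ?_) (fun ξ => ?_)
    · exact trig (fun y => Real.cos (inner ℝ y ξ)) (by fun_prop)
        (fun y => Real.abs_cos_le_one _) ((hχt z hzA ξ).1)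
    · exact trig (fun y => Real.sin (inner ℝ y ξ)) (by fun_prop)
        (fun y => Real.abs_sin_le_one _) ((hχt z hzA ξ).2)
  have hout : ∀ y ∉ (⋃ z : t, Metric.ball (z : Ell2) (r z)), κ y = 0 := by
    intro y hy
    refine h0 y fun hyA => hy ?_
    obtain ⟨z, hz, hyz⟩ := Set.mem_iUnion₂.1 (hcov hyA)
    exact Set.mem_iUnion.2 ⟨⟨z, hz⟩, hyz⟩
  rw [← setIntegral_eq_integral_of_forall_compl_eq_zero hout, hres,
    setIntegral_eq_integral_of_forall_compl_eq_zero hout]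

/-! ### Bumps -/

theorem growth_cos : Real.cos.HasTemperateGrowth := by
  refine ⟨Real.contDiff_cos, fun n => ⟨0, 1, fun x => ?_⟩⟩
  rw [norm_iteratedFDeriv_eq_norm_iteratedDeriv]
  simpa using Real.abs_iteratedDeriv_cos_le_one n x

theorem growth_sin : Real.sin.HasTemperateGrowth := by
  refine ⟨Real.contDiff_sin, fun n => ⟨0, 1, fun x => ?_⟩⟩
  rw [norm_iteratedFDeriv_eq_norm_iteratedDeriv]
  simpa using Real.abs_iteratedDeriv_sin_le_one n x

/-- A smooth radial bump, equal to `1` on the ball of radius `r / 2` and supported in the ball of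
radius `r`. -/
theorem exists_radial_bump (z : Ell2) {r : ℝ} (hr : 0 < r) :
    ∃ χ : Ell2 → ℝ, χ.HasTemperateGrowth ∧ (∀ y, |χ y| ≤ 1) ∧ (∀ y, 0 ≤ χ y) ∧
      (∀ y ∈ Metric.ball z (r / 2), χ y = 1) ∧ ∀ y, χ y ≠ 0 → y ∈ Metric.ball z r := by
  let β : ContDiffBump (0 : ℝ) := ⟨(r / 2) ^ 2, r ^ 2, by positivity, by nlinarith⟩
  have hβ : (β : ℝ → ℝ).HasTemperateGrowth :=
    β.hasCompactSupport.hasTemperateGrowth β.contDiff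
  have hn : (fun y : Ell2 => ‖y - z‖ ^ 2).HasTemperateGrowth :=
    (Function.hasTemperateGrowth_norm_sq Ell2).comp (f := fun y : Ell2 => y - z) (by fun_prop)
  refine ⟨fun y => β (‖y - z‖ ^ 2), hβ.comp hn, fun y => ?_, fun y => β.nonneg, fun y hy => ?_,
    fun y hy => ?_⟩
  · rw [abs_of_nonneg β.nonneg]; exact β.le_one
  · apply β.one_of_mem_closedBall
    rw [Metric.mem_ball, dist_eq_norm] at hy
    rw [mem_closedBall_zero_iff, Real.norm_of_nonneg (by positivity)]
    exact pow_le_pow_left₀ (norm_nonneg _) hy.le 2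
  · have : ‖y - z‖ ^ 2 ∈ Function.support β := hy
    rw [β.support_eq, mem_ball_zero_iff, Real.norm_of_nonneg (by positivity)] at this
    rw [Metric.mem_ball, dist_eq_norm]
    exact lt_of_pow_lt_pow_left₀ 2 hr.le this

/-! ### Uniqueness -/

/-- A radial bump times a cosine or sine is a special test, so the local criterion applies with the
identity map and yields vanishing against indicators. -/
theorem ae_eq_zero_of_specialTest {P : Measure Ell2} [IsFiniteMeasure P] {V : Set Ell2}
    (hV : IsOpen V) {w : Ell2 → ℝ} (hw : Integrable w (P.restrict V))
    (h : ∀ φ, SpecialTest V φ → ∫ y in V, w y * φ y ∂P = 0) : w =ᵐ[P.restrict V] 0 := by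
  have key : ∀ κ : Ell2 → ℝ, Measurable κ → (∀ y, |κ y| ≤ 1) → (∀ y ∉ V, κ y = 0) →
      ∫ y in V, w y * κ y ∂P = 0 := by
    intro κ hκ hM h0
    refine integral_mul_comp_eq_zero_of_local (q := id) hw measurable_id (A := V) (fun z hz => ?_)
      hκ hM h0
    obtain ⟨r, hr, hrV⟩ := Metric.isOpen_iff.1 hV z hz
    obtain ⟨χ, hχg, hχ1, hχ0, hχb, hχs⟩ := exists_radial_bump z (r := r / 2) (by positivity)
    have hsp : ∀ F : Ell2 → ℝ, F.HasTemperateGrowth → SpecialTest V fun y => χ y * F y := by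
      intro F hF
      refine ⟨by fun_prop, r / 2, ‖z‖ + r, by positivity, by positivity, fun y hy => ?_,
        fun y hy => ?_⟩
      · refine (Metric.ball_subset_ball' ?_).trans hrV
        have := hχs y (left_ne_zero_of_mul hy)
        rw [Metric.mem_ball] at this
        linarith
      · have := hχs y (left_ne_zero_of_mul hy)
        rw [Metric.mem_ball, dist_eq_norm] at this
        rw [mem_ball_zero_iff]
        have := norm_le_norm_add_norm_sub' y z
        linarith
    refine ⟨r / 2 / 2, by positivity, χ, hχg.1.continuous, ⟨1, hχ1⟩, hχ0, hχb, fun ξ => ⟨?_, ?_⟩⟩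
    · exact h _ (hsp _ (growth_cos.comp (f := fun y => inner ℝ y ξ) (by fun_prop)))
    · exact h _ (hsp _ (growth_sin.comp (f := fun y => inner ℝ y ξ) (by fun_prop)))
  refine hw.ae_eq_zero_of_forall_setIntegral_eq_zero fun s hs _ => ?_
  have := key ((s ∩ V).indicator fun _ => 1) (measurable_const.indicator (hs.inter hV.measurableSet))
    (fun y => by by_cases hy : y ∈ s ∩ V <;> simp [hy])
    (fun y hy => Set.indicator_of_notMem (fun h => hy h.2) _)
  rw [← this, ← integral_indicator hs]
  refine setIntegral_congr_fun hV.measurableSet fun y hy => ?_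
  by_cases hys : y ∈ s <;> simp [hys, hy]

section

/-! ### Bounded `F`-continuous functions and directional derivatives -/

theorem FContinuousOn.continuousAt_comp {X : Type*} [TopologicalSpace X] {V : Set Ell2}
    (hV : IsOpen V) {u : Ell2 → ℝ} (hu : FContinuousOn V u) {x : Ell2} (hx : x ∈ V) {l : ℕ}
    {c : X → Fin l → ℝ} {ξ : X} (hc : ContinuousAt c ξ)
    (hmem : x + ∑ k : Fin l, c ξ k • e (k : ℕ) ∈ V) :
    ContinuousAt (fun ξ => u (x + ∑ k : Fin l, c ξ k • e (k : ℕ))) ξ := by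
  have hopen : IsOpen {s : Fin l → ℝ | x + ∑ i : Fin l, s i • e (i : ℕ) ∈ V} :=
    hV.preimage (by fun_prop)
  have h := (hu x hx l).continuousAt (hopen.mem_nhds hmem)
  exact ContinuousAt.comp (f := c) (g := fun s : Fin l → ℝ => u (x + ∑ i, s i • e (i : ℕ))) h hc

theorem sum_ite_smul_e {l i : ℕ} (hi : i < l) (s : ℝ) :
    ∑ k : Fin l, (if (k : ℕ) = i then s else 0) • e (k : ℕ) = s • e i := by
  rw [Finset.sum_eq_single ⟨i, hi⟩]
  · simp
  · intro b _ hb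
    have : (b : ℕ) ≠ i := fun h => hb (Fin.ext h)
    simp [this]
  · simp

theorem FContinuousOn.continuousAt_line {V : Set Ell2} (hV : IsOpen V) {u : Ell2 → ℝ}
    (hu : FContinuousOn V u) {x : Ell2} (hx : x ∈ V) (i : ℕ) :
    ContinuousAt (fun s : ℝ => u (x + s • e i)) 0 := by
  have hc : ContinuousAt (fun (s : ℝ) (k : Fin (i + 1)) => if (k : ℕ) = i then s else 0) 0 := by
    refine Continuous.continuousAt (continuous_pi fun k => ?_)
    split_ifs
    exacts [continuous_id, continuous_const]
  have := hu.continuousAt_comp hV hx hc (by simpa using hx)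
  simpa only [sum_ite_smul_e (Nat.lt_succ_self i)] using this

theorem FContinuousOn.congr {V : Set Ell2} {u v : Ell2 → ℝ} (hu : FContinuousOn V u)
    (h : ∀ x ∈ V, u x = v x) : FContinuousOn V v := fun x hx l =>
  (hu x hx l).congr fun _ hs => (h _ hs).symm

theorem FContinuousOn.mono {V W : Set Ell2} {u : Ell2 → ℝ} (hu : FContinuousOn V u)
    (h : W ⊆ V) : FContinuousOn W u := fun x hx l =>
  (hu x (h hx) l).mono fun _ hs => h hs

/-- `F`-continuous, Borel and bounded functions on `V`. -/
structure Nice (V : Set Ell2) (u : Ell2 → ℝ) : Prop where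
  fcontinuous : FContinuousOn V u
  measurable : Measurable fun x : V => u x
  bounded : ∃ M : ℝ, ∀ x ∈ V, |u x| ≤ M

namespace Nice

variable {V W : Set Ell2} {u v : Ell2 → ℝ}

theorem congr (hu : Nice V u) (h : ∀ x ∈ V, u x = v x) : Nice V v where
  fcontinuous := hu.fcontinuous.congr h
  measurable := by
    have : (fun x : V => v x) = fun x : V => u x := funext fun x => (h x x.2).symm
    rw [this]; exact hu.measurable
  bounded := by
    obtain ⟨M, hM⟩ := hu.bounded
    exact ⟨M, fun x hx => by rw [← h x hx]; exact hM x hx⟩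

theorem const (c : ℝ) : Nice V fun _ => c :=
  ⟨fun _ _ _ => continuousOn_const, measurable_const, ⟨|c|, fun _ _ => le_rfl⟩⟩

theorem add (hu : Nice V u) (hv : Nice V v) : Nice V fun x => u x + v x where
  fcontinuous x hx l := (hu.fcontinuous x hx l).add (hv.fcontinuous x hx l)
  measurable := hu.measurable.add hv.measurable
  bounded := by
    obtain ⟨M, hM⟩ := hu.bounded
    obtain ⟨N, hN⟩ := hv.bounded
    exact ⟨M + N, fun x hx => (abs_add_le _ _).trans (add_le_add (hM x hx) (hN x hx))⟩

theorem mul (hu : Nice V u) (hv : Nice V v) : Nice V fun x => u x * v x where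
  fcontinuous x hx l := (hu.fcontinuous x hx l).mul (hv.fcontinuous x hx l)
  measurable := hu.measurable.mul hv.measurable
  bounded := by
    obtain ⟨M, hM⟩ := hu.bounded
    obtain ⟨N, hN⟩ := hv.bounded
    refine ⟨M * N, fun x hx => ?_⟩
    rw [abs_mul]
    exact mul_le_mul (hM x hx) (hN x hx) (abs_nonneg _) ((abs_nonneg _).trans (hM x hx))

theorem neg (hu : Nice V u) : Nice V fun x => -u x := by
  simpa using (Nice.const (-1)).mul hu

theorem comp_continuous (hu : Nice V u) {F : ℝ → ℝ} (hF : Continuous F) :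
    Nice V fun x => F (u x) where
  fcontinuous x hx l := hF.comp_continuousOn (hu.fcontinuous x hx l)
  measurable := hF.measurable.comp hu.measurable
  bounded := by
    obtain ⟨M, hM⟩ := hu.bounded
    obtain ⟨N, hN⟩ := (isCompact_Icc (a := -M) (b := M)).exists_bound_of_continuousOn
      hF.continuousOn
    exact ⟨N, fun x hx => hN _ (abs_le.1 (hM x hx))⟩

theorem inv (hu : Nice V u) {c : ℝ} (hc : 0 < c) (h : ∀ x ∈ V, c ≤ |u x|) :
    Nice V fun x => (u x)⁻¹ where
  fcontinuous x hx l := (hu.fcontinuous x hx l).inv₀ fun s hs h0 => by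
    have := h _ hs
    rw [h0, abs_zero] at this
    linarith
  measurable := hu.measurable.inv
  bounded := ⟨c⁻¹, fun x hx => by rw [abs_inv]; exact inv_anti₀ hc (h x hx)⟩

theorem of_continuous (hu : Continuous u) (hb : ∃ M : ℝ, ∀ x ∈ V, |u x| ≤ M) : Nice V u :=
  ⟨.of_continuous hu, (hu.comp continuous_subtype_val).measurable, hb⟩

theorem coord (hV : Bornology.IsBounded V) (i : ℕ) : Nice V fun x => x i := by
  obtain ⟨R, hR⟩ := hV.exists_norm_le
  exact .of_continuous (continuous_coord i) ⟨R, fun x hx => (abs_coord_le x i).trans (hR x hx)⟩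

theorem measurable_indicator (hu : Nice V u) (hV : MeasurableSet V) :
    Measurable (V.indicator u) := by
  refine measurable_of_restrict_of_restrict_compl hV ?_ ?_
  · have : V.domRestrict (V.indicator u) = fun x : V => u x := by
      funext x; exact Set.indicator_of_mem x.2 u
    rw [this]; exact hu.measurable
  · have : Vᶜ.domRestrict (V.indicator u) = fun _ => 0 := by
      funext x; exact Set.indicator_of_notMem x.2 u
    rw [this]; exact measurable_const

theorem bounded_indicator (hu : Nice V u) : ∃ M : ℝ, 0 ≤ M ∧ ∀ x, |V.indicator u x| ≤ M := by
  obtain ⟨M, hM⟩ := hu.bounded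
  refine ⟨max M 0, le_max_right _ _, fun x => ?_⟩
  by_cases hx : x ∈ V
  · rw [Set.indicator_of_mem hx]; exact (hM x hx).trans (le_max_left _ _)
  · rw [Set.indicator_of_notMem hx, abs_zero]; exact le_max_right _ _

theorem aestronglyMeasurable (hu : Nice V u) (hV : MeasurableSet V) (P : Measure Ell2) :
    AEStronglyMeasurable u (P.restrict V) := by
  refine (hu.measurable_indicator hV).aestronglyMeasurable.congr ?_
  filter_upwards [ae_restrict_mem hV] with x hx
  rw [Set.indicator_of_mem hx]

theorem integrable_mul (hu : Nice V u) (hV : MeasurableSet V) {P : Measure Ell2} {f : Ell2 → ℝ}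
    (hf : Integrable f (P.restrict V)) : Integrable (fun x => f x * u x) (P.restrict V) := by
  obtain ⟨M, hM⟩ := hu.bounded
  refine hf.mul_bdd (c := M) (hu.aestronglyMeasurable hV P) ?_
  filter_upwards [ae_restrict_mem hV] with x hx
  exact hM x hx

end Nice

/-- `u` has the directional derivative `u'` along `e i` on `V`, both being `F`-continuous, Borel
and bounded. -/
structure NiceDeriv (V : Set Ell2) (i : ℕ) (u u' : Ell2 → ℝ) : Prop where
  nice : Nice V u
  nice' : Nice V u'
  hasDeriv : ∀ x ∈ V, HasLineDerivAt ℝ u (u' x) x (e i)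

namespace NiceDeriv

variable {V W : Set Ell2} {i : ℕ} {u v u' v' : Ell2 → ℝ}

theorem mul (hu : NiceDeriv V i u u') (hv : NiceDeriv V i v v') :
    NiceDeriv V i (fun x => u x * v x) (fun x => u' x * v x + u x * v' x) where
  nice := hu.nice.mul hv.nice
  nice' := (hu.nice'.mul hv.nice).add (hu.nice.mul hv.nice')
  hasDeriv x hx := by
    have := HasDerivAt.mul (hu.hasDeriv x hx) (hv.hasDeriv x hx)
    simpa [HasLineDerivAt] using! this

theorem add (hu : NiceDeriv V i u u') (hv : NiceDeriv V i v v') :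
    NiceDeriv V i (fun x => u x + v x) (fun x => u' x + v' x) where
  nice := hu.nice.add hv.nice
  nice' := hu.nice'.add hv.nice'
  hasDeriv x hx := HasDerivAt.add (hu.hasDeriv x hx) (hv.hasDeriv x hx)

theorem const (c : ℝ) : NiceDeriv V i (fun _ => c) (fun _ => 0) where
  nice := .const c
  nice' := .const 0
  hasDeriv _ _ := hasDerivAt_const _ _

theorem neg (hu : NiceDeriv V i u u') : NiceDeriv V i (fun x => -u x) (fun x => -u' x) where
  nice := hu.nice.neg
  nice' := hu.nice'.neg
  hasDeriv x hx := HasDerivAt.neg (hu.hasDeriv x hx)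

theorem congr_deriv (hu : NiceDeriv V i u u') (h : ∀ x ∈ V, u' x = v' x) : NiceDeriv V i u v' where
  nice := hu.nice
  nice' := hu.nice'.congr h
  hasDeriv x hx := by rw [← h x hx]; exact hu.hasDeriv x hx

theorem congr (hV : IsOpen V) (hu : NiceDeriv V i u u') (h : ∀ x ∈ V, u x = v x)
    (h' : ∀ x ∈ V, u' x = v' x) : NiceDeriv V i v v' where
  nice := hu.nice.congr h
  nice' := hu.nice'.congr h'
  hasDeriv x hx := by
    rw [← h' x hx]
    refine (hu.hasDeriv x hx).congr_of_eventuallyEq ?_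
    filter_upwards [hV.mem_nhds hx] with y hy using (h y hy).symm

theorem comp_real (hu : NiceDeriv V i u u') {F F' : ℝ → ℝ} (hF : ∀ t, HasDerivAt F (F' t) t)
    (hF' : Continuous F') : NiceDeriv V i (fun x => F (u x)) (fun x => F' (u x) * u' x) where
  nice := hu.nice.comp_continuous (continuous_iff_continuousAt.2 fun t => (hF t).continuousAt)
  nice' := (hu.nice.comp_continuous hF').mul hu.nice'
  hasDeriv x hx := by
    have h1 : HasDerivAt F (F' (u x)) (u (x + (0 : ℝ) • e i)) := by simpa using hF (u x)
    exact h1.comp (0 : ℝ) (hu.hasDeriv x hx)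

theorem coord (hV : Bornology.IsBounded V) (i j : ℕ) :
    NiceDeriv V i (fun x => x j) (fun _ => if j = i then 1 else 0) where
  nice := .coord hV j
  nice' := .const _
  hasDeriv x _ := by
    have h := ((coordL j).hasFDerivAt (x := x)).hasLineDerivAt (e i)
    have hfun : (coordL j : Ell2 → ℝ) = fun x => x j := funext (coordL_apply j)
    rw [hfun] at h
    simpa [e_apply] using h

end NiceDeriv

/-- Test functions for differentiation along `e i` only. -/
structure DirTest (V : Set Ell2) (i : ℕ) (φ φ' : Ell2 → ℝ) : Prop where
  deriv : NiceDeriv V i φ φ'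
  support : ∃ c > 0, ∀ x ∈ V, φ x ≠ 0 → ∀ s : ℝ, |s| ≤ c → x + s • e i ∈ V

/-- The function `g` is the weak derivative of `f` along `e i`, tested against all functions
which are differentiable in this direction. -/
def ExtWeak (a : ℕ → ℝ) (V : Set Ell2) (i : ℕ) (f g : Ell2 → ℝ) : Prop :=
  ∀ φ φ' : Ell2 → ℝ, DirTest V i φ φ' →
    ∫ x in V, g x * φ x ∂(gaussP a) =
      ∫ x in V, f x * (-φ' x + x i / a i ^ 2 * φ x) ∂(gaussP a)

theorem DirTest.smul_nice {V : Set Ell2} {i : ℕ} {φ φ' w w' : Ell2 → ℝ} (h : DirTest V i φ φ')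
    (hw : NiceDeriv V i w w') :
    DirTest V i (fun x => w x * φ x) (fun x => w' x * φ x + w x * φ' x) where
  deriv := hw.mul h.deriv
  support := by
    obtain ⟨c, hc, hs⟩ := h.support
    exact ⟨c, hc, fun x hx h0 => hs x hx (right_ne_zero_of_mul h0)⟩

/-- The product rule is obtained by testing against `w * φ`. The directional test class is stable
under this multiplication, and only one derivative of `w` is needed. -/
theorem ExtWeak.mul {a : ℕ → ℝ} {V : Set Ell2} (hV : IsOpen V) (hb : Bornology.IsBounded V)
    {i : ℕ} {f g w w' : Ell2 → ℝ} (hf : Integrable f ((gaussP a).restrict V))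
    (hg : Integrable g ((gaussP a).restrict V)) (h : ExtWeak a V i f g)
    (hw : NiceDeriv V i w w') :
    ExtWeak a V i (fun x => f x * w x) (fun x => g x * w x + f x * w' x) := by
  intro φ φ' hφ
  have h1 := h _ _ (hφ.smul_nice hw)
  have n1 : Nice V fun x => w x * φ x := hw.nice.mul hφ.deriv.nice
  have n2 : Nice V fun x => w' x * φ x := hw.nice'.mul hφ.deriv.nice
  have n3 : Nice V fun x => w x * (-φ' x + x i / a i ^ 2 * φ x) := by
    have hx : Nice V fun x => x i / a i ^ 2 := by
      simpa [div_eq_mul_inv] using (Nice.coord hb i).mul (.const (a i ^ 2)⁻¹)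
    exact hw.nice.mul (hφ.deriv.nice'.neg.add (hx.mul hφ.deriv.nice))
  have e1 : ∫ x in V, (g x * w x + f x * w' x) * φ x ∂(gaussP a) =
      ∫ x in V, g x * (w x * φ x) ∂(gaussP a) + ∫ x in V, f x * (w' x * φ x) ∂(gaussP a) := by
    rw [← integral_add (n1.integrable_mul hV.measurableSet hg)
      (n2.integrable_mul hV.measurableSet hf)]
    exact integral_congr_ae (Eventually.of_forall fun x => by simp only; ring)
  rw [e1, h1, ← integral_add _ (n2.integrable_mul hV.measurableSet hf)]
  · exact integral_congr_ae (Eventually.of_forall fun x => by simp only; ring)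
  · refine ((n3.integrable_mul hV.measurableSet hf).sub
      (n2.integrable_mul hV.measurableSet hf)).congr (Eventually.of_forall fun x => ?_)
    simp only [Pi.sub_apply]; ring

theorem ExtWeak.add {a : ℕ → ℝ} {V : Set Ell2} (hV : IsOpen V) (hb : Bornology.IsBounded V)
    {i : ℕ} {f g f₂ g₂ : Ell2 → ℝ} (hf : Integrable f ((gaussP a).restrict V))
    (hg : Integrable g ((gaussP a).restrict V)) (hf₂ : Integrable f₂ ((gaussP a).restrict V))
    (hg₂ : Integrable g₂ ((gaussP a).restrict V)) (h : ExtWeak a V i f g)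
    (h₂ : ExtWeak a V i f₂ g₂) :
    ExtWeak a V i (fun x => f x + f₂ x) (fun x => g x + g₂ x) := by
  intro φ φ' hφ
  have n1 := hφ.deriv.nice
  have n3 : Nice V fun x => -φ' x + x i / a i ^ 2 * φ x := by
    have hx : Nice V fun x => x i / a i ^ 2 := by
      simpa [div_eq_mul_inv] using (Nice.coord hb i).mul (.const (a i ^ 2)⁻¹)
    exact hφ.deriv.nice'.neg.add (hx.mul hφ.deriv.nice)
  have hm := hV.measurableSet
  simp_rw [add_mul]
  rw [integral_add (n1.integrable_mul hm hg) (n1.integrable_mul hm hg₂),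
    integral_add (n3.integrable_mul hm hf) (n3.integrable_mul hm hf₂), h φ φ' hφ, h₂ φ φ' hφ]

end

section

/-! ### From smooth to directional test functions -/

theorem norm_dropL_le (i : ℕ) (x : Ell2) : ‖dropL i x‖ ≤ 2 * ‖x‖ := by
  rw [dropL_apply]
  refine (norm_sub_le _ _).trans ?_
  rw [norm_smul, norm_e, Real.norm_eq_abs]
  linarith [abs_coord_le x i]

theorem dropL_dropL (i : ℕ) (x : Ell2) : dropL i (dropL i x) = dropL i x := by
  simp [dropL_apply]

/-- A tube around a segment contained in an open set. -/
theorem exists_tube {V : Set Ell2} (hV : IsOpen V) (i : ℕ) {z : Ell2} {α β : ℝ}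
    (h : ∀ s ∈ Set.Icc α β, dropL i z + s • e i ∈ V) :
    ∃ r > 0, ∀ x : Ell2, x i ∈ Set.Icc α β → ‖dropL i x - dropL i z‖ < r → x ∈ V := by
  have hK : IsCompact ((fun s : ℝ => dropL i z + s • e i) '' Set.Icc α β) :=
    isCompact_Icc.image (by fun_prop)
  obtain ⟨r, hr, hsub⟩ := hK.exists_thickening_subset_open hV (by rintro _ ⟨s, hs, rfl⟩; exact h s hs)
  refine ⟨r, hr, fun x hx hxz => hsub ?_⟩
  rw [Metric.mem_thickening_iff]
  refine ⟨_, ⟨x i, hx, rfl⟩, ?_⟩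
  have e1 : x - (dropL i z + x i • e i) = dropL i x - dropL i z := by
    rw [dropL_apply i x]; abel
  rw [dist_eq_norm, e1]
  exact hxz

/-- The tube is larger than the support so that the inclusion is uniform. A point at distance less
than `min r ε` from the support has coordinate `i` within `2 * ε` of `t`. Its other coordinates move
by less than `2 * r + 2 * r`, since `dropL` has norm at most `2`. -/
theorem specialTest_tube {V : Set Ell2} (i : ℕ) {z : Ell2} {t ε r : ℝ} (hε : 0 < ε) (hr : 0 < r)
    (htube : ∀ x : Ell2, x i ∈ Set.Icc (t - 2 * ε) (t + 2 * ε) →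
      ‖dropL i x - dropL i z‖ < 4 * r → x ∈ V)
    {η : ℝ → ℝ} (hη : ContDiff ℝ (⊤ : ℕ∞) η) (hηs : ∀ s, η s ≠ 0 → |s| ≤ ε)
    {χ : Ell2 → ℝ} (hχ : χ.HasTemperateGrowth) (hχs : ∀ y, χ y ≠ 0 → y ∈ Metric.ball z r) :
    SpecialTest V fun y => η (y i - t) * χ (dropL i y) := by
  have hcs : HasCompactSupport η :=
    HasCompactSupport.intro (isCompact_Icc (a := -ε) (b := ε)) fun s hs => by
      by_contra h0
      exact hs (abs_le.1 (hηs s h0))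
  have hηg := hcs.hasTemperateGrowth hη
  have h1 : (fun y : Ell2 => η (y i - t)).HasTemperateGrowth := by
    have : (fun y : Ell2 => η (y i - t)) = fun y => η (coordL i y - t) := by simp
    rw [this]
    exact hηg.comp (f := fun y => coordL i y - t) (by fun_prop)
  have h2 : (fun y : Ell2 => χ (dropL i y)).HasTemperateGrowth :=
    hχ.comp (f := fun y => dropL i y) (by fun_prop)
  refine ⟨h1.mul h2, min r ε, ‖z‖ + r + |t| + ε + 1, by positivity, by positivity,
    fun y hy x hx => ?_, fun y hy => ?_⟩
  · have hy1 := abs_le.1 (hηs _ (left_ne_zero_of_mul hy))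
    have hy2 := hχs _ (right_ne_zero_of_mul hy)
    rw [Metric.mem_ball, dist_eq_norm] at hx hy2
    have hx1 : ‖x - y‖ < r := hx.trans_le (min_le_left _ _)
    have hx2 : ‖x - y‖ < ε := hx.trans_le (min_le_right _ _)
    have hx3 := abs_le.1 (abs_coord_le (x - y) i)
    rw [sub_coord] at hx3
    refine htube x ⟨by linarith, by linarith⟩ ?_
    have e1 : dropL i x - dropL i z = dropL i (x - y) + dropL i (dropL i y - z) := by
      simp only [map_sub, dropL_dropL]; abel
    rw [e1]
    have n1 := norm_dropL_le i (x - y)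
    have n2 := norm_dropL_le i (dropL i y - z)
    have n3 := norm_add_le (dropL i (x - y)) (dropL i (dropL i y - z))
    linarith
  · have hy1 := hηs _ (left_ne_zero_of_mul hy)
    have hy2 := hχs _ (right_ne_zero_of_mul hy)
    rw [Metric.mem_ball, dist_eq_norm] at hy2
    rw [mem_ball_zero_iff]
    have n1 : ‖y‖ ≤ ‖dropL i y‖ + |y i| := by
      conv_lhs => rw [← dropL_add_coord i y]
      refine (norm_add_le _ _).trans ?_
      rw [norm_smul, norm_e, Real.norm_eq_abs, mul_one]
    have n2 := norm_le_norm_add_norm_sub' (dropL i y) z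
    have n3 : |y i| ≤ |y i - t| + |t| := by
      have := abs_add_le (y i - t) t
      simpa using this
    linarith

theorem lineDeriv_tube {i : ℕ} {t : ℝ} {η : ℝ → ℝ} (hη : Differentiable ℝ η) (χ : Ell2 → ℝ)
    (y : Ell2) : lineDeriv ℝ (fun y : Ell2 => η (y i - t) * χ (dropL i y)) y (e i) =
      deriv η (y i - t) * χ (dropL i y) := by
  apply HasLineDerivAt.lineDeriv
  unfold HasLineDerivAt
  simp only [dropL_add_smul, add_coord, smul_coord, e_self, mul_one]
  refine HasDerivAt.mul_const ?_ _
  have h1 : HasDerivAt η (deriv η (y i - t)) (y i + 0 - t) := by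
    simpa using (hη (y i - t)).hasDerivAt
  have h2 : HasDerivAt (fun s : ℝ => y i + s - t) 1 0 := by
    simpa using ((hasDerivAt_id (0 : ℝ)).const_add (y i)).sub_const t
  exact (h1.comp (0 : ℝ) h2).congr_deriv (mul_one _)

variable {a : ℕ → ℝ} {V : Set Ell2} {i : ℕ} {f g : Ell2 → ℝ}

/-- With the profile `η` in coordinate `i` fixed, the tested identity says that a signed measure in
the other coordinates annihilates localized sines and cosines. By the local criterion it annihilates
every bounded Borel `κ` supported where the segment stays in `V`. -/
theorem integral_slice_eq_zero (hV : IsOpen V)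
    (hf : Integrable f ((gaussP a).restrict V)) (hg : Integrable g ((gaussP a).restrict V))
    (h : ∀ φ, SpecialTest V φ →
      ∫ x in V, g x * φ x ∂(gaussP a) = ∫ x in V, f x * dualD a i φ x ∂(gaussP a))
    {t ε : ℝ} (hε : 0 < ε) {η : ℝ → ℝ} (hη : ContDiff ℝ (⊤ : ℕ∞) η)
    (hηs : ∀ s, η s ≠ 0 → |s| ≤ ε) {κ : Ell2 → ℝ} (hκ : Measurable κ) {M : ℝ}
    (hM : ∀ y, |κ y| ≤ M)
    (hκV : ∀ z, κ z ≠ 0 → ∀ s ∈ Set.Icc (t - 2 * ε) (t + 2 * ε), dropL i z + s • e i ∈ V) :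
    ∫ y in V, (g y * η (y i - t) -
      f y * (-deriv η (y i - t) + y i / a i ^ 2 * η (y i - t))) * κ (dropL i y) ∂(gaussP a) = 0 := by
  have hcs : HasCompactSupport η :=
    HasCompactSupport.intro (isCompact_Icc (a := -ε) (b := ε)) fun s hs => by
      by_contra h0
      exact hs (abs_le.1 (hηs s h0))
  have hηc : Continuous η := hη.continuous
  have hη'c : Continuous (deriv η) := hη.continuous_deriv (by simp)
  have hk2c : Continuous fun s => -deriv η s + (s + t) / a i ^ 2 * η s := by fun_prop
  have hk2s : HasCompactSupport fun s => -deriv η s + (s + t) / a i ^ 2 * η s :=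
    (hcs.deriv.neg).add hcs.mul_left
  obtain ⟨C1, hC1⟩ := hcs.exists_bound_of_continuous hηc
  obtain ⟨C2, hC2⟩ := hk2s.exists_bound_of_continuous hk2c
  have hI : ∀ (u : Ell2 → ℝ) (k : ℝ → ℝ), Integrable u ((gaussP a).restrict V) → Continuous k →
      ∀ C, (∀ s, ‖k s‖ ≤ C) → Integrable (fun y => u y * k (y i - t)) ((gaussP a).restrict V) := by
    intro u k hu hk C hC
    refine hu.mul_bdd (c := C) ?_ (Eventually.of_forall fun y => hC _)
    exact (hk.measurable.comp ((measurable_coord i).sub_const t)).aestronglyMeasurable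
  have hI1 := hI g η hg hηc C1 hC1
  have hI2 : Integrable (fun y => f y * (-deriv η (y i - t) + y i / a i ^ 2 * η (y i - t)))
      ((gaussP a).restrict V) := by
    simpa using hI f _ hf hk2c C2 hC2
  refine integral_mul_comp_eq_zero_of_local (hI1.sub hI2) (dropL i).continuous.measurable
    (A := {z | ∀ s ∈ Set.Icc (t - 2 * ε) (t + 2 * ε), dropL i z + s • e i ∈ V})
    (fun z hz => ?_) hκ hM (fun y hy => by_contra fun h0 => hy (hκV y h0))
  obtain ⟨r, hr, htube⟩ := exists_tube hV i hz
  obtain ⟨χ, hχg, hχ1, hχ0, hχb, hχs⟩ := exists_radial_bump z (r := r / 4) (by positivity)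
  refine ⟨r / 4 / 2, by positivity, χ, hχg.1.continuous, ⟨1, hχ1⟩, hχ0, hχb, ?_⟩
  have main : ∀ F : Ell2 → ℝ, F.HasTemperateGrowth → (∀ y, |F y| ≤ 1) →
      ∫ y in V, (g y * η (y i - t) -
        f y * (-deriv η (y i - t) + y i / a i ^ 2 * η (y i - t))) *
          (χ (dropL i y) * F (dropL i y)) ∂(gaussP a) = 0 := by
    intro F hF hF1
    have hsp := specialTest_tube (V := V) i (t := t) hε (r := r / 4) (by positivity)
      (fun x hx hxz => htube x hx (by linarith)) hη hηs (χ := fun y => χ y * F y) (hχg.mul hF)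
      (fun y hy => hχs y (left_ne_zero_of_mul hy))
    have h1 := h _ hsp
    have hb : ∀ u : Ell2 → ℝ, Integrable u ((gaussP a).restrict V) →
        Integrable (fun y => u y * (χ (dropL i y) * F (dropL i y))) ((gaussP a).restrict V) := by
      intro u hu
      refine hu.mul_bdd (c := 1) ?_ (Eventually.of_forall fun y => ?_)
      · exact ((hχg.1.continuous.comp (dropL i).continuous).mul
          (hF.1.continuous.comp (dropL i).continuous)).aestronglyMeasurable
      · rw [Real.norm_eq_abs, abs_mul]
        exact mul_le_one₀ (hχ1 _) (abs_nonneg _) (hF1 _)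
    simp_rw [sub_mul]
    rw [integral_sub (hb _ hI1) (hb _ hI2), sub_eq_zero]
    refine Eq.trans ?_ (h1.trans ?_)
    · exact integral_congr_ae (Eventually.of_forall fun y => by simp only; ring)
    · refine integral_congr_ae (Eventually.of_forall fun y => ?_)
      simp only [dualD]
      rw [lineDeriv_tube (hη.differentiable (by simp)) (fun y => χ y * F y)]
      ring
  intro ξ
  exact ⟨main _ (growth_cos.comp (f := fun y => inner ℝ y ξ) (by fun_prop))
      (fun y => Real.abs_cos_le_one _),
    main _ (growth_sin.comp (f := fun y => inner ℝ y ξ) (by fun_prop))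
      (fun y => Real.abs_sin_le_one _)⟩

/-- Along lines, the extension by zero of a function with support away from the boundary is
differentiable. -/
theorem hasDerivAt_indicator_line (hV : IsOpen V) {φ φ' : Ell2 → ℝ}
    (hd : ∀ x ∈ V, HasLineDerivAt ℝ φ (φ' x) x (e i)) {c : ℝ} (hc : 0 < c)
    (hs : ∀ x ∈ V, φ x ≠ 0 → ∀ s : ℝ, |s| ≤ c → x + s • e i ∈ V) (z : Ell2) :
    HasDerivAt (fun s : ℝ => V.indicator φ (z + s • e i)) (V.indicator φ' z) 0 ∧
      (z ∉ V → ∀ s : ℝ, |s| ≤ c → V.indicator φ (z + s • e i) = 0) := by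
  have hline : ContinuousAt (fun s : ℝ => z + s • e i) 0 := by fun_prop
  by_cases hz : z ∈ V
  · have hev : ∀ᶠ s : ℝ in 𝓝 0, z + s • e i ∈ V :=
      hline.eventually (by simpa using hV.mem_nhds hz)
    refine ⟨?_, fun h => absurd hz h⟩
    rw [Set.indicator_of_mem hz]
    refine HasDerivAt.congr_of_eventuallyEq (hd z hz) ?_
    filter_upwards [hev] with s hs using Set.indicator_of_mem hs _
  · have hzero : ∀ s : ℝ, |s| ≤ c → V.indicator φ (z + s • e i) = 0 := by
      intro s hsc
      by_contra h0
      have hm : z + s • e i ∈ V := Set.mem_of_indicator_ne_zero h0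
      rw [Set.indicator_of_mem hm] at h0
      -- If `φ` were nonzero at the displaced point, going back by `-s` would put `z` inside `V`.
      have := hs _ hm h0 (-s) (by rwa [abs_neg])
      rw [neg_smul, add_neg_cancel_right] at this
      exact hz this
    have hev : ∀ᶠ s : ℝ in 𝓝 0, |s| < c := by
      have : ContinuousAt (fun s : ℝ => |s|) 0 := by fun_prop
      exact this.eventually (gt_mem_nhds (by simpa using hc))
    refine ⟨?_, fun _ => hzero⟩
    rw [Set.indicator_of_notMem hz]
    refine HasDerivAt.congr_of_eventuallyEq (hasDerivAt_const (0 : ℝ) (0 : ℝ)) ?_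
    filter_upwards [hev] with s hsc using hzero s hsc.le

/-- Along lines, the derivative of the extension by zero of a directional test function is
continuous. -/
theorem DirTest.continuousAt_line (hV : IsOpen V) {φ φ' : Ell2 → ℝ} (h : DirTest V i φ φ')
    (z : Ell2) : ContinuousAt (fun s : ℝ => V.indicator φ' (z + s • e i)) 0 := by
  obtain ⟨c, hc, hs⟩ := h.support
  have hline : ContinuousAt (fun s : ℝ => z + s • e i) 0 := by fun_prop
  by_cases hz : z ∈ V
  · have hev : ∀ᶠ s : ℝ in 𝓝 0, z + s • e i ∈ V :=
      hline.eventually (by simpa using hV.mem_nhds hz)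
    refine (h.deriv.nice'.fcontinuous.continuousAt_line hV hz i).congr ?_
    filter_upwards [hev] with s hs using (Set.indicator_of_mem hs _).symm
  · have hzero := (hasDerivAt_indicator_line hV h.deriv.hasDeriv hc hs z).2 hz
    have hev : ∀ᶠ s : ℝ in 𝓝 0, |s| < c := by
      have : ContinuousAt (fun s : ℝ => |s|) 0 := by fun_prop
      exact this.eventually (gt_mem_nhds (by simpa using hc))
    refine (continuousAt_const (y := (0 : ℝ))).congr ?_
    filter_upwards [hev] with s hsc
    by_cases hm : z + s • e i ∈ V
    · rw [Set.indicator_of_mem hm]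
      -- At points of the line that lie in `V`, `φ` vanishes on a neighbourhood within the line, so
      -- its derivative there must be zero.
      refine HasLineDerivAt.unique (𝕜 := ℝ) ?_ (h.deriv.hasDeriv _ hm)
      refine HasDerivAt.congr_of_eventuallyEq (hasDerivAt_const (0 : ℝ) (0 : ℝ)) ?_
      have h1 : ∀ᶠ u : ℝ in 𝓝 0, (z + s • e i) + u • e i ∈ V := by
        have : ContinuousAt (fun u : ℝ => (z + s • e i) + u • e i) 0 := by fun_prop
        exact this.eventually (by simpa using hV.mem_nhds hm)
      have h2 : ∀ᶠ u : ℝ in 𝓝 0, |s + u| < c := by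
        have : ContinuousAt (fun u : ℝ => |s + u|) 0 := by fun_prop
        exact this.eventually (gt_mem_nhds (by simpa using hsc))
      filter_upwards [h1, h2] with u hu1 hu2
      have := hzero (s + u) hu2.le
      rw [add_smul, ← add_assoc, Set.indicator_of_mem hu1] at this
      exact this
    · rw [Set.indicator_of_notMem hm]

theorem hasDerivAt_indicator_line' (hV : IsOpen V) {φ φ' : Ell2 → ℝ}
    (hd : ∀ x ∈ V, HasLineDerivAt ℝ φ (φ' x) x (e i)) {c : ℝ} (hc : 0 < c)
    (hs : ∀ x ∈ V, φ x ≠ 0 → ∀ s : ℝ, |s| ≤ c → x + s • e i ∈ V) (z : Ell2) (t : ℝ) :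
    HasDerivAt (fun s : ℝ => V.indicator φ (z + s • e i)) (V.indicator φ' (z + t • e i)) t := by
  have h1 := (hasDerivAt_indicator_line hV hd hc hs (z + t • e i)).1
  have h2 : HasDerivAt (fun s : ℝ => V.indicator φ (z + t • e i + (s - t) • e i))
      (V.indicator φ' (z + t • e i)) t := by
    have h1' : HasDerivAt (fun s : ℝ => V.indicator φ (z + t • e i + s • e i))
      (V.indicator φ' (z + t • e i)) (t - t) := by simpa using h1
    exact h1'.comp_sub_const t t
  convert! h2 using 3 with s
  simp only [sub_smul]; abel

end

section

variable {a : ℕ → ℝ} {V : Set Ell2} {i : ℕ} {f g : Ell2 → ℝ}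

theorem DirTest.hasDerivAt_line' (hV : IsOpen V) {φ φ' : Ell2 → ℝ} (h : DirTest V i φ φ')
    (z : Ell2) (t : ℝ) :
    HasDerivAt (fun s : ℝ => V.indicator φ (z + s • e i)) (V.indicator φ' (z + t • e i)) t := by
  obtain ⟨c, hc, hs⟩ := h.support
  exact hasDerivAt_indicator_line' hV h.deriv.hasDeriv hc hs z t

theorem DirTest.continuous_line' (hV : IsOpen V) {φ φ' : Ell2 → ℝ} (h : DirTest V i φ φ')
    (z : Ell2) : Continuous (fun s : ℝ => V.indicator φ' (z + s • e i)) := by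
  refine continuous_iff_continuousAt.2 fun t => ?_
  have h1 := h.continuousAt_line hV (z + t • e i)
  have h2 : ContinuousAt (fun s : ℝ => V.indicator φ' (z + t • e i + (s - t) • e i)) t := by
    have hs : ContinuousAt (fun s : ℝ => s - t) t := by fun_prop
    exact ContinuousAt.comp_of_eq (g := fun s : ℝ => V.indicator φ' (z + t • e i + s • e i))
      h1 hs (sub_self t)
  convert! h2 using 3 with s
  simp only [sub_smul]; abel

theorem abs_integral_bump_le (β : ContDiffBump (0 : ℝ)) (b : ℝ) {ψ : ℝ → ℝ} {M : ℝ}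
    (hM : ∀ t, |ψ t| ≤ M) : |∫ t, β.normed volume (b - t) * ψ t| ≤ M := by
  have hi : Integrable (fun t => β.normed volume (b - t)) :=
    (β.continuous_normed.integrable_of_hasCompactSupport
      β.hasCompactSupport_normed).comp_sub_left b
  calc |∫ t, β.normed volume (b - t) * ψ t|
      ≤ ∫ t, β.normed volume (b - t) * M := by
        rw [← Real.norm_eq_abs]
        refine norm_integral_le_of_norm_le (hi.mul_const M) (Eventually.of_forall fun t => ?_)
        rw [Real.norm_eq_abs, abs_mul, abs_of_nonneg (β.nonneg_normed _)]
        exact mul_le_mul_of_nonneg_left (hM t) (β.nonneg_normed _)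
    _ = M := by
        rw [integral_mul_const, integral_sub_left_eq_self (fun t => β.normed volume t) volume b,
          β.integral_normed, one_mul]

theorem tendsto_integral_bump {β : ℕ → ContDiffBump (0 : ℝ)}
    (hβ : Tendsto (fun n => (β n).rOut) atTop (𝓝 0)) (b : ℝ) {ψ : ℝ → ℝ} (hψ : Continuous ψ) :
    Tendsto (fun n => ∫ t, (β n).normed volume (b - t) * ψ t) atTop (𝓝 (ψ b)) := by
  have h := ContDiffBump.convolution_tendsto_right_of_continuous (μ := volume) hβ hψ b
  simpa only [convolution_eq_swap, ContinuousLinearMap.lsmul_apply, smul_eq_mul] using h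

theorem bump_ne_zero (β : ContDiffBump (0 : ℝ)) {s : ℝ} (h : β.normed volume s ≠ 0) :
    |s| ≤ β.rOut := by
  have : s ∈ Function.support (β.normed volume) := h
  rw [β.support_normed_eq, mem_ball_zero_iff, Real.norm_eq_abs] at this
  exact this.le

theorem integrable_slice (hV : IsOpen V) {φ φ' : Ell2 → ℝ} (h : DirTest V i φ φ') {u : Ell2 → ℝ}
    (hu : Integrable u ((gaussP a).restrict V)) {k : ℝ → ℝ} (hk : Continuous k) {C : ℝ}
    (hC : ∀ s, ‖k s‖ ≤ C) (R : ℝ) :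
    Integrable (fun z : Ell2 × ℝ => u z.1 * (k (z.1 i - z.2) *
      V.indicator φ (dropL i z.1 + z.2 • e i)))
      (((gaussP a).restrict V).prod (volume.restrict (Set.Icc (-R) R))) := by
  obtain ⟨M, hM0, hM⟩ := h.deriv.nice.bounded_indicator
  refine (hu.comp_fst _).mul_bdd (c := C * M) (Measurable.aestronglyMeasurable ?_)
    (Eventually.of_forall fun z => ?_)
  · exact (hk.measurable.comp (((measurable_coord i).comp measurable_fst).sub measurable_snd)).mul
      ((h.deriv.nice.measurable_indicator hV.measurableSet).comp (continuous_resample i).measurable)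
  · rw [norm_mul]
    exact mul_le_mul (hC _) (hM _) (norm_nonneg _) ((norm_nonneg _).trans (hC 0))

theorem setIntegral_slice {k : ℝ → ℝ} {ε R : ℝ} (hk : ∀ s, k s ≠ 0 → |s| ≤ ε) {b : ℝ}
    (hb : |b| + ε ≤ R) (ψ : ℝ → ℝ) :
    ∫ t in Set.Icc (-R) R, k (b - t) * ψ t = ∫ t, k (b - t) * ψ t := by
  refine setIntegral_eq_integral_of_forall_compl_eq_zero fun t ht => ?_
  by_contra h0
  have h1 := hk _ (left_ne_zero_of_mul h0)
  apply ht
  have h2 := abs_le.1 h1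
  have h3 := abs_le.1 (le_refl |b|)
  constructor <;> linarith

/-- The slice identity at height `t` is used with `κ` equal to the zero extension of `φ` at that
height, and then integrated over `t`. The outcome is the desired identity with `φ` and `φ'` replaced
by their mollifications along `e i`. -/
theorem integral_convolution_slice (hV : IsOpen V) (hb : Bornology.IsBounded V)
    (hf : Integrable f ((gaussP a).restrict V)) (hg : Integrable g ((gaussP a).restrict V))
    (h : ∀ φ, SpecialTest V φ →
      ∫ x in V, g x * φ x ∂(gaussP a) = ∫ x in V, f x * dualD a i φ x ∂(gaussP a))
    {φ φ' : Ell2 → ℝ} (hφ : DirTest V i φ φ') {c : ℝ}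
    (hs : ∀ x ∈ V, φ x ≠ 0 → ∀ s : ℝ, |s| ≤ c → x + s • e i ∈ V) (β : ContDiffBump (0 : ℝ))
    (hβ : 2 * β.rOut ≤ c) :
    ∫ y in V, (g y - f y * (y i / a i ^ 2)) *
        (∫ t, β.normed volume (y i - t) * V.indicator φ (dropL i y + t • e i)) +
      f y * (∫ t, β.normed volume (y i - t) * V.indicator φ' (dropL i y + t • e i))
        ∂(gaussP a) = 0 := by
  set η := β.normed volume with hη
  set Φ := V.indicator φ with hΦ
  set Φ' := V.indicator φ' with hΦ'
  obtain ⟨M, hM0, hM⟩ := hφ.deriv.nice.bounded_indicator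
  obtain ⟨M', hM0', hM'⟩ := hφ.deriv.nice'.bounded_indicator
  obtain ⟨R₀, hR₀⟩ := hb.exists_norm_le
  have hηd : ContDiff ℝ (⊤ : ℕ∞) η := β.contDiff_normed
  have hηs : ∀ s, η s ≠ 0 → |s| ≤ β.rOut := fun s => bump_ne_zero β
  have hcs : HasCompactSupport η := β.hasCompactSupport_normed
  have hηc : Continuous η := hηd.continuous
  have hη'c : Continuous (deriv η) := hηd.continuous_deriv (by simp)
  have hη's : ∀ s, deriv η s ≠ 0 → |s| ≤ β.rOut := by
    intro s h0
    have h1 : s ∈ tsupport η := support_deriv_subset h0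
    rw [β.tsupport_normed_eq, mem_closedBall_zero_iff] at h1
    exact h1
  obtain ⟨C1, hC1⟩ := hcs.exists_bound_of_continuous hηc
  obtain ⟨C2, hC2⟩ := hcs.deriv.exists_bound_of_continuous hη'c
  -- For `y` in the bounded set `V` the kernel vanishes when `|t| > R`. Restricting `t` to this
  -- interval makes the double integral absolutely convergent.
  set R := R₀ + β.rOut with hR
  have hx : Nice V fun x => x i / a i ^ 2 := by
    simpa [div_eq_mul_inv] using (Nice.coord hb i).mul (.const (a i ^ 2)⁻¹)
  have hw : Integrable (fun y => g y - f y * (y i / a i ^ 2)) ((gaussP a).restrict V) :=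
    hg.sub (hx.integrable_mul hV.measurableSet hf)
  have hslice : ∀ t : ℝ, ∫ y in V, ((g y - f y * (y i / a i ^ 2)) * (η (y i - t) *
      Φ (dropL i y + t • e i)) + f y * (deriv η (y i - t) * Φ (dropL i y + t • e i)))
        ∂(gaussP a) = 0 := by
    intro t
    have hκ : Measurable fun z : Ell2 => Φ (dropL i z + t • e i) :=
      (hφ.deriv.nice.measurable_indicator hV.measurableSet).comp
        (Continuous.measurable (by fun_prop))
    have := integral_slice_eq_zero hV hf hg h (t := t) β.rOut_pos hηd hηs hκ (fun y => hM _)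
      (fun z hz s hst => by
        have hm : dropL i z + t • e i ∈ V := Set.mem_of_indicator_ne_zero hz
        rw [hΦ, Set.indicator_of_mem hm] at hz
        -- The slice lemma asks for room `2 * β.rOut` on both sides of `t`, which is at most the
        -- displacement `c` allowed by the support of `φ`.
        have := hs _ hm hz (s - t) (abs_le.2 ⟨by linarith [hst.1], by linarith [hst.2]⟩)
        rwa [add_assoc, ← add_smul, add_sub_cancel] at this)
    rw [← this]
    refine integral_congr_ae (Eventually.of_forall fun y => ?_)
    simp only [dropL_dropL]
    ring
  have hint : Integrable (fun z : Ell2 × ℝ => (g z.1 - f z.1 * (z.1 i / a i ^ 2)) *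
      (η (z.1 i - z.2) * Φ (dropL i z.1 + z.2 • e i)) +
      f z.1 * (deriv η (z.1 i - z.2) * Φ (dropL i z.1 + z.2 • e i)))
      (((gaussP a).restrict V).prod (volume.restrict (Set.Icc (-R) R))) :=
    (integrable_slice hV hφ hw hηc hC1 R).add (integrable_slice hV hφ hf hη'c hC2 R)
  have hswap := integral_integral_swap (f := fun (y : Ell2) (t : ℝ) =>
    (g y - f y * (y i / a i ^ 2)) * (η (y i - t) * Φ (dropL i y + t • e i)) +
      f y * (deriv η (y i - t) * Φ (dropL i y + t • e i))) hint
  simp only [hslice, integral_zero] at hswap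
  rw [← hswap]
  refine setIntegral_congr_fun hV.measurableSet fun y hy => ?_
  have hyR : |y i| + β.rOut ≤ R := by
    have := (abs_coord_le y i).trans (hR₀ y hy)
    linarith
  have hψc : Continuous fun t : ℝ => Φ (dropL i y + t • e i) :=
    continuous_iff_continuousAt.2 fun t => (hφ.hasDerivAt_line' hV (dropL i y) t).continuousAt
  have hψ'c : Continuous fun t : ℝ => Φ' (dropL i y + t • e i) := hφ.continuous_line' hV _
  have hbump : ∀ (k ψ : ℝ → ℝ), Continuous k → HasCompactSupport k → Continuous ψ →
      Integrable fun t => k (y i - t) * ψ t := by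
    intro k ψ hk hkc hψ
    refine Continuous.integrable_of_hasCompactSupport (by fun_prop) ?_
    have : HasCompactSupport fun t => k (y i - t) :=
      hkc.comp_homeomorph (Homeomorph.subLeft (y i))
    exact this.mul_right
  have i1 := hbump η _ hηc hcs hψc
  have i2 := hbump (deriv η) _ hη'c hcs.deriv hψc
  have i3 := hbump η _ hηc hcs hψ'c
  -- Integration by parts in `t` moves the derivative from the kernel onto the extended function.
  -- The signs cancel because the kernel depends on `y i - t`.
  have hparts : ∫ t, η (y i - t) * Φ' (dropL i y + t • e i) =
      ∫ t, deriv η (y i - t) * Φ (dropL i y + t • e i) := by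
    have hd : ∀ t, HasDerivAt (fun t => η (y i - t)) (-deriv η (y i - t)) t := by
      intro t
      have h1 := ((hηd.differentiable (by simp)) (y i - t)).hasDerivAt
      have h2 : HasDerivAt (fun t : ℝ => y i - t) (-1) t := (hasDerivAt_id t).const_sub (y i)
      exact (h1.comp t h2).congr_deriv (by ring)
    have := integral_mul_deriv_eq_deriv_mul_of_integrable (fun t _ => hd t)
      (fun t _ => hφ.hasDerivAt_line' hV (dropL i y) t) i3
      (by refine i2.neg.congr (Eventually.of_forall fun t => ?_); simp [hΦ]) i1
    rw [this, ← integral_neg]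
    refine integral_congr_ae (Eventually.of_forall fun t => ?_)
    simp [hΦ]
  simp only
  rw [integral_add (i1.integrableOn.const_mul _) (i2.integrableOn.const_mul _),
    integral_const_mul, integral_const_mul,
    setIntegral_slice hηs hyR, setIntegral_slice hη's hyR, hparts]

/-- A directional test is continuously differentiable along each line after extension by zero, so
its mollifications and those of its derivative converge pointwise and boundedly. Dominated
convergence passes to the limit in the mollified identity. -/
theorem extWeak_of_specialTest (hV : IsOpen V) (hb : Bornology.IsBounded V)
    (hf : Integrable f ((gaussP a).restrict V)) (hg : Integrable g ((gaussP a).restrict V))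
    (h : ∀ φ, SpecialTest V φ →
      ∫ x in V, g x * φ x ∂(gaussP a) = ∫ x in V, f x * dualD a i φ x ∂(gaussP a)) :
    ExtWeak a V i f g := by
  intro φ φ' hφ
  obtain ⟨c, hc, hs⟩ := hφ.support
  obtain ⟨M, hM0, hM⟩ := hφ.deriv.nice.bounded_indicator
  obtain ⟨M', hM0', hM'⟩ := hφ.deriv.nice'.bounded_indicator
  -- The outer radii are at most `c / 2`, as the mollified identity requires, and tend to zero.
  let β : ℕ → ContDiffBump (0 : ℝ) := fun n =>
    ⟨c / 4 * (1 / ((n : ℝ) + 1)), c / 2 * (1 / ((n : ℝ) + 1)), by positivity, by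
      have : 0 < 1 / ((n : ℝ) + 1) := by positivity
      nlinarith⟩
  have hβ0 : Tendsto (fun n => (β n).rOut) atTop (𝓝 0) := by
    change Tendsto (fun n : ℕ => c / 2 * (1 / ((n : ℝ) + 1))) atTop (𝓝 0)
    simpa using (tendsto_one_div_add_atTop_nhds_zero_nat (𝕜 := ℝ)).const_mul (c / 2)
  have hβc : ∀ n, 2 * (β n).rOut ≤ c := by
    intro n
    change 2 * (c / 2 * (1 / ((n : ℝ) + 1))) ≤ c
    have : 1 / ((n : ℝ) + 1) ≤ 1 := by
      rw [div_le_one (by positivity)]; linarith [n.cast_nonneg (α := ℝ)]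
    nlinarith
  have hx : Nice V fun x => x i / a i ^ 2 := by
    simpa [div_eq_mul_inv] using (Nice.coord hb i).mul (.const (a i ^ 2)⁻¹)
  have hw : Integrable (fun y => g y - f y * (y i / a i ^ 2)) ((gaussP a).restrict V) :=
    hg.sub (hx.integrable_mul hV.measurableSet hf)
  have hmeas : ∀ (n : ℕ) (ψ : Ell2 → ℝ), Measurable ψ → Measurable fun y : Ell2 =>
      ∫ t, (β n).normed volume (y i - t) * ψ (dropL i y + t • e i) := by
    intro n ψ hψ
    have hη : Continuous ((β n).normed volume) := (β n).continuous_normed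
    have : Measurable fun z : Ell2 × ℝ => (β n).normed volume (z.1 i - z.2) *
        ψ (dropL i z.1 + z.2 • e i) :=
      (hη.measurable.comp (((measurable_coord i).comp measurable_fst).sub measurable_snd)).mul
        (hψ.comp (continuous_resample i).measurable)
    exact (this.stronglyMeasurable.integral_prod_right' (ν := volume)).measurable
  have hm1 := hφ.deriv.nice.measurable_indicator hV.measurableSet
  have hm2 := hφ.deriv.nice'.measurable_indicator hV.measurableSet
  have hdom : Integrable (fun y => |g y - f y * (y i / a i ^ 2)| * M + |f y| * M')
      ((gaussP a).restrict V) := (hw.abs.mul_const M).add (hf.abs.mul_const M')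
  have hlim := tendsto_integral_of_dominated_convergence (μ := (gaussP a).restrict V)
    (F := fun n y => (g y - f y * (y i / a i ^ 2)) *
        (∫ t, (β n).normed volume (y i - t) * V.indicator φ (dropL i y + t • e i)) +
      f y * ∫ t, (β n).normed volume (y i - t) * V.indicator φ' (dropL i y + t • e i))
    (f := fun y => (g y - f y * (y i / a i ^ 2)) * V.indicator φ y + f y * V.indicator φ' y)
    (fun y => |g y - f y * (y i / a i ^ 2)| * M + |f y| * M')
    (fun n => (hw.aestronglyMeasurable.mul (hmeas n _ hm1).aestronglyMeasurable).add
      (hf.aestronglyMeasurable.mul (hmeas n _ hm2).aestronglyMeasurable)) hdom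
    (fun n => Eventually.of_forall fun y => by
      refine (norm_add_le _ _).trans (add_le_add ?_ ?_)
      · rw [norm_mul]
        exact mul_le_mul_of_nonneg_left (abs_integral_bump_le _ _ fun t => hM _) (norm_nonneg _)
      · rw [norm_mul]
        exact mul_le_mul_of_nonneg_left (abs_integral_bump_le _ _ fun t => hM' _) (norm_nonneg _))
    (Eventually.of_forall fun y => by
      have hψc : Continuous fun t : ℝ => V.indicator φ (dropL i y + t • e i) :=
        continuous_iff_continuousAt.2 fun t =>
          (hφ.hasDerivAt_line' hV (dropL i y) t).continuousAt
      have hψ'c := hφ.continuous_line' hV (dropL i y)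
      have t1 := tendsto_integral_bump hβ0 (y i) hψc
      have t2 := tendsto_integral_bump hβ0 (y i) hψ'c
      rw [dropL_add_coord] at t1 t2
      exact (t1.const_mul _).add (t2.const_mul _))
  have hzero : ∀ n, ∫ y in V, (g y - f y * (y i / a i ^ 2)) *
        (∫ t, (β n).normed volume (y i - t) * V.indicator φ (dropL i y + t • e i)) +
      f y * (∫ t, (β n).normed volume (y i - t) * V.indicator φ' (dropL i y + t • e i))
        ∂(gaussP a) = 0 := fun n =>
    integral_convolution_slice hV hb hf hg h hφ hs (β n) (hβc n)
  simp only [hzero] at hlim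
  have hfin := tendsto_nhds_unique hlim tendsto_const_nhds
  have n3 : Nice V fun x => -φ' x + x i / a i ^ 2 * φ x :=
    hφ.deriv.nice'.neg.add (hx.mul hφ.deriv.nice)
  rw [← sub_eq_zero, ← integral_sub (hφ.deriv.nice.integrable_mul hV.measurableSet hg)
    (n3.integrable_mul hV.measurableSet hf), ← hfin]
  refine setIntegral_congr_fun hV.measurableSet fun y hy => ?_
  simp only [Set.indicator_of_mem hy]
  ring

end

section

/-! ### Smooth bounded functions -/

theorem partialD_append (I J : List ℕ) (f : Ell2 → ℝ) :
    partialD (I ++ J) f = partialD I (partialD J f) := by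
  induction I with
  | nil => rfl
  | cons i I ih => simp only [List.cons_append, partialD, ih]

/-- Bounded functions of class `IsCFInfty`. -/
structure CFB (V : Set Ell2) (w : Ell2 → ℝ) : Prop where
  smooth : IsCFInfty V w
  bounded : ∃ M : ℝ, ∀ x ∈ V, |w x| ≤ M

theorem CFB.nice {V : Set Ell2} {w : Ell2 → ℝ} (h : CFB V w) : Nice V w :=
  ⟨h.smooth.fcontinuous [], h.smooth.measurable [], h.bounded⟩

theorem CFB.lineDeriv {V : Set Ell2} {w : Ell2 → ℝ} (h : CFB V w) (j : ℕ) :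
    CFB V fun x => lineDeriv ℝ w x (e j) := by
  have hp : ∀ I, partialD I (fun x => _root_.lineDeriv ℝ w x (e j)) = partialD (I ++ [j]) w := by
    intro I; rw [partialD_append]; rfl
  refine ⟨⟨fun I i => ?_, fun I => ?_, fun I => ?_, fun I _ => ?_⟩, h.smooth.bounded [j] (by simp)⟩
  · rw [hp]; exact h.smooth.differentiable _ _
  · rw [hp]; exact h.smooth.fcontinuous _
  · rw [hp]; exact h.smooth.measurable _
  · rw [hp]; exact h.smooth.bounded _ (by simp)

theorem CFB.niceDeriv {V : Set Ell2} {w : Ell2 → ℝ} (h : CFB V w) (j : ℕ) :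
    NiceDeriv V j w fun x => _root_.lineDeriv ℝ w x (e j) :=
  ⟨h.nice, (h.lineDeriv j).nice, fun x hx => (h.smooth.differentiable [] j x hx).hasLineDerivAt⟩

/-! ### Recursive Sobolev classes -/

/-- Weighted sum of the absolute values of the derivatives of order `k`. -/
def wsum (a : ℕ → ℝ) : ℕ → (Ell2 → ℝ) → Ell2 → ℝ≥0∞
  | 0, w, x => ‖w x‖ₑ
  | k + 1, w, x => ∑' j, ENNReal.ofReal (a j) * wsum a k (fun y => lineDeriv ℝ w y (e j)) x

/-- The function `f` has weak derivatives up to order `n` on `V`, and the `p`-th power of its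
Sobolev norm of order `n` is at most `E`. -/
def HasW (a : ℕ → ℝ) (p : ℝ) (V : Set Ell2) : ℕ → (Ell2 → ℝ) → ℝ≥0∞ → Prop
  | 0, f, E => MemLp f (ENNReal.ofReal p) ((gaussP a).restrict V) ∧
      ∫⁻ x in V, ‖f x‖ₑ ^ p ∂(gaussP a) ≤ E
  | n + 1, f, E => MemLp f (ENNReal.ofReal p) ((gaussP a).restrict V) ∧
      ∃ (D : ℕ → Ell2 → ℝ) (ε : ℕ → ℝ≥0∞),
        (∀ j, ExtWeak a V j f (D j) ∧ HasW a p V n (D j) (ε j)) ∧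
        ∫⁻ x in V, ‖f x‖ₑ ^ p ∂(gaussP a) + ∑' j, ENNReal.ofReal (a j) ^ p * ε j ≤ E

namespace HasW

variable {a : ℕ → ℝ} {p : ℝ} {V : Set Ell2} {n : ℕ} {f g : Ell2 → ℝ} {E E' : ℝ≥0∞}

theorem memLp (h : HasW a p V n f E) : MemLp f (ENNReal.ofReal p) ((gaussP a).restrict V) := by
  cases n <;> exact h.1

theorem lintegral_le (h : HasW a p V n f E) : ∫⁻ x in V, ‖f x‖ₑ ^ p ∂(gaussP a) ≤ E := by
  cases n with
  | zero => exact h.2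
  | succ n =>
    obtain ⟨-, D, ε, -, hE⟩ := h
    exact le_self_add.trans hE

theorem integrable (hp : 1 ≤ p) (h : HasW a p V n f E) :
    Integrable f ((gaussP a).restrict V) :=
  h.memLp.integrable (by simpa using ENNReal.ofReal_le_ofReal hp)

theorem mono (h : HasW a p V n f E) (hE : E ≤ E') : HasW a p V n f E' := by
  cases n with
  | zero => exact ⟨h.1, h.2.trans hE⟩
  | succ n =>
    obtain ⟨h1, D, ε, h2, h3⟩ := h
    exact ⟨h1, D, ε, h2, h3.trans hE⟩

theorem pred (h : HasW a p V (n + 1) f E) : HasW a p V n f E := by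
  induction n generalizing f E with
  | zero => exact ⟨h.memLp, h.lintegral_le⟩
  | succ n ih =>
    obtain ⟨h1, D, ε, h2, h3⟩ := h
    exact ⟨h1, D, ε, fun j => ⟨(h2 j).1, ih (h2 j).2⟩, h3⟩

/-- The convexity constant `2 ^ (p - 1)` is incurred at each order separately, so it does not
accumulate with `n`. -/
theorem add (hV : IsOpen V) (hb : Bornology.IsBounded V) (hp : 1 ≤ p)
    (hf : HasW a p V n f E) (hg : HasW a p V n g E') :
    HasW a p V n (fun x => f x + g x) (2 ^ (p - 1) * (E + E')) := by
  have hlp : ∀ {f g : Ell2 → ℝ}, MemLp f (ENNReal.ofReal p) ((gaussP a).restrict V) →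
      ∫⁻ x in V, ‖f x + g x‖ₑ ^ p ∂(gaussP a) ≤ 2 ^ (p - 1) *
        (∫⁻ x in V, ‖f x‖ₑ ^ p ∂(gaussP a) + ∫⁻ x in V, ‖g x‖ₑ ^ p ∂(gaussP a)) := by
    intro f g hf
    rw [← lintegral_add_left' (hf.1.enorm.pow_const p),
      ← lintegral_const_mul' _ _ (by finiteness)]
    refine lintegral_mono fun x => ?_
    refine (ENNReal.rpow_le_rpow (enorm_add_le _ _) (by linarith)).trans ?_
    exact ENNReal.rpow_add_le_mul_rpow_add_rpow _ _ hp
  induction n generalizing f g E E' with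
  | zero =>
    refine ⟨hf.memLp.add hg.memLp, (hlp hf.memLp).trans ?_⟩
    exact mul_le_mul_right (add_le_add hf.2 hg.2) _
  | succ n ih =>
    have hfi := hf.integrable hp
    have hgi := hg.integrable hp
    obtain ⟨hf1, D, ε, hf2, hf3⟩ := hf
    obtain ⟨hg1, D', ε', hg2, hg3⟩ := hg
    refine ⟨hf1.add hg1, fun j x => D j x + D' j x, fun j => 2 ^ (p - 1) * (ε j + ε' j),
      fun j => ⟨?_, ih (hf2 j).2 (hg2 j).2⟩, ?_⟩
    · exact ExtWeak.add hV hb hfi ((hf2 j).2.integrable hp) hgi ((hg2 j).2.integrable hp)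
        (hf2 j).1 (hg2 j).1
    · have hsum : ∑' j, ENNReal.ofReal (a j) ^ p * (2 ^ (p - 1) * (ε j + ε' j)) =
          2 ^ (p - 1) * (∑' j, ENNReal.ofReal (a j) ^ p * ε j +
            ∑' j, ENNReal.ofReal (a j) ^ p * ε' j) := by
        rw [← ENNReal.tsum_add, ← ENNReal.tsum_mul_left]
        exact tsum_congr fun j => by ring
      rw [hsum]
      refine (add_le_add (hlp hf1) le_rfl).trans ?_
      rw [← mul_add]
      refine mul_le_mul_right ?_ _
      refine le_trans (le_of_eq ?_) (add_le_add hf3 hg3)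
      ring

end HasW

/-- The inclusion of ℓ¹ in ℓ^p: this is how the first-power weights of the uniform norms control the
weights `a j ^ p` of the Sobolev energy. -/
theorem tsum_rpow_le {ι : Type*} (x : ι → ℝ≥0∞) {p : ℝ} (hp : 1 ≤ p) :
    ∑' i, x i ^ p ≤ (∑' i, x i) ^ p := by
  have hsplit : ∀ y : ℝ≥0∞, y ^ p = y * y ^ (p - 1) := fun y => by
    have := ENNReal.rpow_add_of_nonneg (x := y) 1 (p - 1) zero_le_one (by linarith)
    rwa [ENNReal.rpow_one, add_sub_cancel] at this
  rw [hsplit (∑' i, x i), ← ENNReal.tsum_mul_right]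
  refine ENNReal.tsum_le_tsum fun i => ?_
  rw [hsplit]
  exact mul_le_mul_right (ENNReal.rpow_le_rpow (ENNReal.le_tsum i) (by linarith)) _

theorem CFB.memLp_mul {a : ℕ → ℝ} {q : ℝ≥0∞} {V : Set Ell2} (hV : IsOpen V) {u w : Ell2 → ℝ}
    (hu : MemLp u q ((gaussP a).restrict V)) (hw : Nice V w) :
    MemLp (fun x => u x * w x) q ((gaussP a).restrict V) := by
  obtain ⟨M, hM⟩ := hw.bounded
  refine (hu.const_mul M).of_le (hu.1.mul (hw.aestronglyMeasurable hV.measurableSet _)) ?_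
  filter_upwards [ae_restrict_mem hV.measurableSet] with x hx
  rw [norm_mul, norm_mul, mul_comm]
  refine mul_le_mul_of_nonneg_right ?_ (norm_nonneg _)
  exact (hM x hx).trans (le_abs_self _)

/-- The constant is independent of the index type and of the weights. Differentiating the family
once enlarges the index type by a factor `ℕ`, so a statement about single multipliers, or with a
constant depending on the family, would not carry the induction. -/
theorem HasW.mul_family {a : ℕ → ℝ} {p : ℝ} (hp : 1 ≤ p) {V : Set Ell2} (hV : IsOpen V)
    (hb : Bornology.IsBounded V) (n : ℕ) : ∃ C : ℝ≥0∞, C ≠ ⊤ ∧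
      ∀ (ι : Type) [Countable ι] (w : ι → Ell2 → ℝ) (ω : ι → ℝ≥0∞) (M : ℝ≥0∞),
        (∀ θ, CFB V (w θ)) → (∀ k ≤ n, ∀ x ∈ V, ∑' θ, ω θ * wsum a k (w θ) x ≤ M) →
        ∀ (u : Ell2 → ℝ) (E : ℝ≥0∞), HasW a p V n u E →
          ∃ ε : ι → ℝ≥0∞, (∀ θ, HasW a p V n (fun x => u x * w θ x) (ε θ)) ∧
            ∑' θ, ω θ ^ p * ε θ ≤ C * M ^ p * E := by
  have hp0 : 0 ≤ p := by linarith
  have base : ∀ (ι : Type) [Countable ι] (w : ι → Ell2 → ℝ) (ω : ι → ℝ≥0∞) (M : ℝ≥0∞),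
      (∀ θ, CFB V (w θ)) → (∀ x ∈ V, ∑' θ, ω θ * wsum a 0 (w θ) x ≤ M) →
      ∀ u : Ell2 → ℝ, MemLp u (ENNReal.ofReal p) ((gaussP a).restrict V) →
        ∑' θ, ω θ ^ p * ∫⁻ x in V, ‖u x * w θ x‖ₑ ^ p ∂(gaussP a) ≤
          M ^ p * ∫⁻ x in V, ‖u x‖ₑ ^ p ∂(gaussP a) := by
    intro ι _ w ω M hw hM u hu
    have hm : ∀ θ, AEMeasurable (fun x => ‖u x * w θ x‖ₑ ^ p) ((gaussP a).restrict V) := fun θ =>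
      (CFB.memLp_mul hV hu (hw θ).nice).1.enorm.pow_const p
    simp_rw [← lintegral_const_mul'' _ (hm _)]
    rw [← lintegral_tsum (fun θ => (hm θ).const_mul _),
      ← lintegral_const_mul'' _ (hu.1.enorm.pow_const p)]
    refine setLIntegral_mono' hV.measurableSet fun x hx => ?_
    have h1 : ∀ θ, ω θ ^ p * ‖u x * w θ x‖ₑ ^ p = (ω θ * ‖w θ x‖ₑ) ^ p * ‖u x‖ₑ ^ p := by
      intro θ
      rw [enorm_mul, ENNReal.mul_rpow_of_nonneg _ _ hp0, ENNReal.mul_rpow_of_nonneg _ _ hp0]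
      ring
    simp_rw [h1]
    rw [ENNReal.tsum_mul_right]
    refine mul_le_mul_left ((tsum_rpow_le _ hp).trans ?_) _
    exact ENNReal.rpow_le_rpow (hM x hx) hp0
  induction n with
  | zero =>
    refine ⟨1, ENNReal.one_ne_top, fun ι _ w ω M hw hM u E hu => ?_⟩
    refine ⟨_, fun θ => ⟨CFB.memLp_mul hV hu.memLp (hw θ).nice, le_rfl⟩, ?_⟩
    rw [one_mul]
    exact (base ι w ω M hw (hM 0 le_rfl) u hu.memLp).trans (mul_le_mul_right hu.2 _)
  | succ n ih =>
    obtain ⟨C, hC, ih⟩ := ih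
    refine ⟨1 + 2 ^ (p - 1) * (C + C), by finiteness, fun ι _ w ω M hw hM u E hu => ?_⟩
    have hui := hu.integrable hp
    have hu' := hu.pred
    obtain ⟨hu1, D, ε', hD, hE⟩ := hu
    have first : ∀ j, ∃ ε : ι → ℝ≥0∞, (∀ θ, HasW a p V n (fun x => D j x * w θ x) (ε θ)) ∧
        ∑' θ, ω θ ^ p * ε θ ≤ C * M ^ p * ε' j := fun j =>
      ih ι w ω M hw (fun k hk => hM k (hk.trans n.le_succ)) _ _ (hD j).2
    choose ε1 hε1 hε1s using first
    -- In the product rule, the terms in which the multiplier is differentiated form a family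
    -- indexed by `ι × ℕ`. Its weighted sum of order `k` is the original one of order `k + 1`, with
    -- the same bound `M`.
    obtain ⟨ε2, hε2, hε2s⟩ := ih (ι × ℕ) (fun z x => lineDeriv ℝ (w z.1) x (e z.2))
      (fun z => ω z.1 * ENNReal.ofReal (a z.2)) M (fun z => (hw z.1).lineDeriv z.2)
      (fun k hk x hx => by
        rw [ENNReal.tsum_prod']
        refine le_trans (le_of_eq ?_) (hM (k + 1) (by omega) x hx)
        refine tsum_congr fun θ => ?_
        simp only [wsum]
        rw [← ENNReal.tsum_mul_left]
        exact tsum_congr fun j => by ring) u E hu'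
    refine ⟨fun θ => ∫⁻ x in V, ‖u x * w θ x‖ₑ ^ p ∂(gaussP a) +
      ∑' j, ENNReal.ofReal (a j) ^ p * (2 ^ (p - 1) * (ε1 j θ + ε2 (θ, j))), fun θ => ?_, ?_⟩
    · refine ⟨CFB.memLp_mul hV hu1 (hw θ).nice,
        fun j x => D j x * w θ x + u x * lineDeriv ℝ (w θ) x (e j), _, fun j => ⟨?_, ?_⟩, le_rfl⟩
      · exact ExtWeak.mul hV hb hui ((hD j).2.integrable hp) (hD j).1 ((hw θ).niceDeriv j)
      · exact HasW.add hV hb hp (hε1 j θ) (hε2 (θ, j))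
    · set A : ℝ≥0∞ := ∫⁻ x in V, ‖u x‖ₑ ^ p ∂(gaussP a) with hA
      have hAE : A ≤ E := le_self_add.trans hE
      have hSE : ∑' j, ENNReal.ofReal (a j) ^ p * ε' j ≤ E := le_add_self.trans hE
      have t0 := base ι w ω M hw (hM 0 (Nat.zero_le _)) u hu1
      have t1 : ∑' θ, ∑' j, ω θ ^ p * (ENNReal.ofReal (a j) ^ p * ε1 j θ) ≤ C * M ^ p * E := by
        rw [ENNReal.tsum_comm]
        calc ∑' j, ∑' θ, ω θ ^ p * (ENNReal.ofReal (a j) ^ p * ε1 j θ)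
            = ∑' j, ENNReal.ofReal (a j) ^ p * ∑' θ, ω θ ^ p * ε1 j θ := by
              refine tsum_congr fun j => ?_
              rw [← ENNReal.tsum_mul_left]
              exact tsum_congr fun θ => by ring
          _ ≤ ∑' j, ENNReal.ofReal (a j) ^ p * (C * M ^ p * ε' j) :=
              ENNReal.tsum_le_tsum fun j => mul_le_mul_right (hε1s j) _
          _ = C * M ^ p * ∑' j, ENNReal.ofReal (a j) ^ p * ε' j := by
              rw [← ENNReal.tsum_mul_left]
              exact tsum_congr fun j => by ring
          _ ≤ _ := mul_le_mul_right hSE _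
      have t2 : ∑' θ, ∑' j, ω θ ^ p * (ENNReal.ofReal (a j) ^ p * ε2 (θ, j)) ≤ C * M ^ p * E := by
        rw [ENNReal.tsum_prod'] at hε2s
        refine le_trans (le_of_eq ?_) hε2s
        refine tsum_congr fun θ => tsum_congr fun j => ?_
        rw [ENNReal.mul_rpow_of_nonneg _ _ hp0]; ring
      calc ∑' θ, ω θ ^ p * (∫⁻ x in V, ‖u x * w θ x‖ₑ ^ p ∂(gaussP a) +
            ∑' j, ENNReal.ofReal (a j) ^ p * (2 ^ (p - 1) * (ε1 j θ + ε2 (θ, j))))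
          = ∑' θ, ω θ ^ p * ∫⁻ x in V, ‖u x * w θ x‖ₑ ^ p ∂(gaussP a) +
            2 ^ (p - 1) * (∑' θ, ∑' j, ω θ ^ p * (ENNReal.ofReal (a j) ^ p * ε1 j θ) +
              ∑' θ, ∑' j, ω θ ^ p * (ENNReal.ofReal (a j) ^ p * ε2 (θ, j))) := by
            rw [← ENNReal.tsum_add, ← ENNReal.tsum_mul_left, ← ENNReal.tsum_add]
            refine tsum_congr fun θ => ?_
            rw [mul_add, ← ENNReal.tsum_add, ← ENNReal.tsum_mul_left, ← ENNReal.tsum_mul_left]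
            congr 1
            exact tsum_congr fun j => by ring
        _ ≤ M ^ p * E + 2 ^ (p - 1) * (C * M ^ p * E + C * M ^ p * E) :=
            add_le_add (t0.trans (mul_le_mul_right hAE _))
              (mul_le_mul_right (add_le_add t1 t2) _)
        _ = _ := by ring

end

section

/-! ### Iterated formal adjoints of test functions -/

/-- `IsCFInfty` bounds derivatives of positive order only. A function with support in a ball is then
bounded as well: travel along `e 0` until the support is left and apply the mean value inequality to
the extension by zero. -/
theorem IsCFInfty.bounded_of_unifIncl {V : Set Ell2} (hV : IsOpen V) {φ : Ell2 → ℝ}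
    (h : IsCFInfty V φ) (hs : UnifIncl {x ∈ V | φ x ≠ 0} V) : ∃ M : ℝ, ∀ x ∈ V, |φ x| ≤ M := by
  obtain ⟨r, R, hr, hR, hball, hbdd⟩ := hs
  obtain ⟨K, hK⟩ := h.bounded [0] (by simp)
  refine ⟨max K 0 * (2 * R), fun x hx => ?_⟩
  have hd : ∀ x ∈ V, HasLineDerivAt ℝ φ (partialD [0] φ x) x (e 0) := fun x hx =>
    (h.differentiable [] 0 x hx).hasLineDerivAt
  have hline : ∀ x ∈ V, φ x ≠ 0 → ∀ s : ℝ, |s| ≤ r / 2 → x + s • e 0 ∈ V := by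
    intro x hx h0 s hs
    refine hball x ⟨hx, h0⟩ ?_
    rw [Metric.mem_ball, dist_eq_norm, add_sub_cancel_left, norm_smul, norm_e, mul_one,
      Real.norm_eq_abs]
    linarith
  by_cases h0 : φ x = 0
  · rw [h0, abs_zero]; positivity
  -- Two points at distance `2 * R` cannot both lie in the open ball of radius `R`.
  have hx2 : V.indicator φ (x + (2 * R) • e 0) = 0 := by
    by_contra hne
    have hm : x + (2 * R) • e 0 ∈ V := Set.mem_of_indicator_ne_zero hne
    rw [Set.indicator_of_mem hm] at hne
    have h1 := hbdd ⟨hx, h0⟩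
    have h2 := hbdd ⟨hm, hne⟩
    rw [mem_ball_zero_iff] at h1 h2
    have h3 := norm_sub_le (x + (2 * R) • e 0) x
    rw [add_sub_cancel_left, norm_smul, norm_e, mul_one, Real.norm_of_nonneg (by positivity)] at h3
    linarith
  have key := Convex.norm_image_sub_le_of_norm_hasDerivWithin_le (s := Set.univ) (C := max K 0)
    (f := fun s : ℝ => V.indicator φ (x + s • e 0))
    (f' := fun s : ℝ => V.indicator (partialD [0] φ) (x + s • e 0))
    (fun s _ => (hasDerivAt_indicator_line' hV hd (half_pos hr) hline x s).hasDerivWithinAt)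
    (fun s _ => by
      by_cases hm : x + s • e 0 ∈ V
      · rw [Set.indicator_of_mem hm]
        exact (hK _ hm).trans (le_max_left _ _)
      · rw [Set.indicator_of_notMem hm, norm_zero]; exact le_max_right _ _)
    convex_univ (Set.mem_univ 0) (Set.mem_univ (2 * R))
  simp only [hx2, zero_smul, add_zero, Set.indicator_of_mem hx, zero_sub, norm_neg, sub_zero,
    Real.norm_eq_abs] at key
  rwa [abs_of_nonneg (by positivity : (0 : ℝ) ≤ 2 * R)] at key

/-- The functions obtained from the derivatives of `φ` on `V` by linear combinations and products
with coordinates. -/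
inductive DiffSpan (V : Set Ell2) (φ : Ell2 → ℝ) : (Ell2 → ℝ) → Prop
  | base (I : List ℕ) : DiffSpan V φ (partialD I φ)
  | coord (k : ℕ) (v : Ell2 → ℝ) : DiffSpan V φ v → DiffSpan V φ fun x => x k * v x
  | smul (c : ℝ) (v : Ell2 → ℝ) : DiffSpan V φ v → DiffSpan V φ fun x => c * v x
  | add (v w : Ell2 → ℝ) : DiffSpan V φ v → DiffSpan V φ w → DiffSpan V φ fun x => v x + w x
  | congr (v w : Ell2 → ℝ) : DiffSpan V φ v → (∀ x ∈ V, v x = w x) → DiffSpan V φ w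

namespace DiffSpan

variable {a : ℕ → ℝ} {V : Set Ell2} {φ v : Ell2 → ℝ}

/-- Differentiating a coordinate factor gives a constant, so the span is closed under partial
derivatives. Boundedness of `V` keeps the coordinate factors bounded. -/
theorem exists_niceDeriv (hV : IsOpen V) (hb : Bornology.IsBounded V) (hφ : CFB V φ)
    (h : DiffSpan V φ v) (i : ℕ) : ∃ v', DiffSpan V φ v' ∧ NiceDeriv V i v v' := by
  induction h with
  | base I =>
    have hn : ∀ J : List ℕ, Nice V (partialD J φ) := by
      intro J
      refine ⟨hφ.smooth.fcontinuous J, hφ.smooth.measurable J, ?_⟩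
      by_cases hJ : J = []
      · subst hJ; exact hφ.bounded
      · exact hφ.smooth.bounded J hJ
    exact ⟨_, base (i :: I), hn I, hn (i :: I),
      fun x hx => (hφ.smooth.differentiable I i x hx).hasLineDerivAt⟩
  | coord k v hv ih =>
    obtain ⟨v', hv', hd⟩ := ih
    exact ⟨_, add _ _ (smul (if k = i then 1 else 0) _ hv) (coord k _ hv'),
      (NiceDeriv.coord hb i k).mul hd⟩
  | smul c v hv ih =>
    obtain ⟨v', hv', hd⟩ := ih
    refine ⟨_, smul c _ hv', ?_⟩
    exact ((NiceDeriv.const c).mul hd).congr_deriv fun x _ => by simp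
  | add v w hv hw ihv ihw =>
    obtain ⟨v', hv', hdv⟩ := ihv
    obtain ⟨w', hw', hdw⟩ := ihw
    exact ⟨_, add _ _ hv' hw', hdv.add hdw⟩
  | congr v w hv hvw ih =>
    obtain ⟨v', hv', hd⟩ := ih
    exact ⟨v', hv', hd.congr hV hvw fun _ _ => rfl⟩

theorem mem_closure (hV : IsOpen V) (h : DiffSpan V φ v) :
    ∀ x ∈ V, v x ≠ 0 → x ∈ closure {x ∈ V | φ x ≠ 0} := by
  induction h with
  | base I =>
    induction I with
    | nil => exact fun x hx h0 => subset_closure ⟨hx, h0⟩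
    | cons i I ih =>
      intro x hx h0
      by_contra hc
      apply h0
      have hev : partialD I φ =ᶠ[𝓝 x] fun _ => 0 := by
        filter_upwards [hV.mem_nhds hx, isClosed_closure.isOpen_compl.mem_nhds hc] with y hy hyc
        by_contra hne
        exact hyc (ih y hy hne)
      simp only [partialD]
      rw [hev.lineDeriv_eq]
      simp [lineDeriv]
  | coord k v hv ih => exact fun x hx h0 => ih x hx (right_ne_zero_of_mul h0)
  | smul c v hv ih => exact fun x hx h0 => ih x hx (right_ne_zero_of_mul h0)
  | add v w hv hw ihv ihw =>
    intro x hx h0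
    by_cases h1 : v x = 0
    · exact ihw x hx fun h2 => h0 (by simp only [h1, h2, add_zero])
    · exact ihv x hx h1
  | congr v w hv hvw ih => exact fun x hx h0 => ih x hx (by rwa [hvw x hx])

theorem dualD (hV : IsOpen V) (hb : Bornology.IsBounded V) (hφ : CFB V φ)
    (h : DiffSpan V φ v) (i : ℕ) : DiffSpan V φ (dualD a i v) := by
  obtain ⟨v', hv', hd⟩ := h.exists_niceDeriv hV hb hφ i
  refine congr _ _ (add _ _ (smul (-1) _ hv') (smul (a i ^ 2)⁻¹ _ (coord i _ h))) fun x hx => ?_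
  rw [GaussSobolev.dualD, (hd.hasDeriv x hx).lineDeriv]
  ring

theorem iterDualD (hV : IsOpen V) (hb : Bornology.IsBounded V) (hφ : CFB V φ)
    (h : DiffSpan V φ v) (I : List ℕ) : DiffSpan V φ (iterDualD a I v) := by
  induction I generalizing v with
  | nil => exact h
  | cons i I ih => exact ih (h.dualD hV hb hφ i)

theorem dirTest (hV : IsOpen V) (hb : Bornology.IsBounded V) (hφ : CFB V φ)
    (hs : UnifIncl {x ∈ V | φ x ≠ 0} V) (h : DiffSpan V φ v) (i : ℕ) :
    DirTest V i v fun x => lineDeriv ℝ v x (e i) := by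
  obtain ⟨v', hv', hd⟩ := h.exists_niceDeriv hV hb hφ i
  refine ⟨hd.congr_deriv fun x hx => (hd.hasDeriv x hx).lineDeriv.symm, ?_⟩
  obtain ⟨r, R, hr, hR, hball, -⟩ := hs.closure
  refine ⟨r / 2, by positivity, fun x hx h0 s hsr => ?_⟩
  refine hball x (h.mem_closure hV x hx h0) ?_
  rw [Metric.mem_ball, dist_eq_norm, add_sub_cancel_left, norm_smul, norm_e, mul_one,
    Real.norm_eq_abs]
  linarith

end DiffSpan

/-- This is what allows a one-step identity to be applied after several adjoints have already fallen
on a test function. No weighted square sums need to be re-established for the iterated adjoint. -/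
theorem IsTest.dirTest_iterDualD {a : ℕ → ℝ} {V : Set Ell2} (hV : IsOpen V)
    (hb : Bornology.IsBounded V) {φ : Ell2 → ℝ} (h : IsTest a V φ) (I : List ℕ) (i : ℕ) :
    DirTest V i (iterDualD a I φ) fun x => lineDeriv ℝ (iterDualD a I φ) x (e i) := by
  have hφ : CFB V φ := ⟨h.smooth, h.smooth.bounded_of_unifIncl hV h.support⟩
  exact ((DiffSpan.base []).iterDualD hV hb hφ I).dirTest hV hb hφ h.support i

theorem iterDualD_append (a : ℕ → ℝ) (I J : List ℕ) (φ : Ell2 → ℝ) :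
    iterDualD a (I ++ J) φ = iterDualD a J (iterDualD a I φ) := by
  induction I generalizing φ with
  | nil => rfl
  | cons i I ih => simp only [List.cons_append, iterDualD, ih]

/-! ### Comparison with the Sobolev spaces -/

/-- The energy of order `n` of a family of quantities indexed by multi-indices. -/
def een (a : ℕ → ℝ) (p : ℝ) (N : List ℕ → ℝ≥0∞) : ℕ → List ℕ → ℝ≥0∞
  | 0, J => N J
  | n + 1, J => N J + ∑' j, ENNReal.ofReal (a j) ^ p * een a p N n (j :: J)

theorem een_append (a : ℕ → ℝ) (p : ℝ) (N : List ℕ → ℝ≥0∞) (n : ℕ) (J K : List ℕ) :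
    een a p N n (J ++ K) = een a p (fun I => N (I ++ K)) n J := by
  induction n generalizing J with
  | zero => rfl
  | succ n ih => simp only [een, ← List.cons_append, ih]

/-- Splitting off the last entry of each multi-index, which is the derivative applied first, matches
the recursion with the sum over orders. -/
theorem een_eq_sum {a : ℕ → ℝ} (ha : ∀ i, 0 < a i) {p : ℝ} (hp : 0 ≤ p) (N : List ℕ → ℝ≥0∞)
    (n : ℕ) (J : List ℕ) : een a p N n J = N J + ∑ k ∈ Finset.Icc 1 n, ∑' I : Fin k → ℕ,
      ENNReal.ofReal (∏ j, a (I j) ^ p) * N (List.ofFn I ++ J) := by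
  induction n generalizing J with
  | zero => simp [een]
  | succ n ih =>
    have hw : ∀ {k : ℕ} (I : Fin k → ℕ) (j : ℕ),
        ENNReal.ofReal (∏ l, a ((Fin.snoc I j : Fin (k + 1) → ℕ) l) ^ p) =
          ENNReal.ofReal (a j) ^ p * ENNReal.ofReal (∏ l, a (I l) ^ p) := by
      intro k I j
      rw [prod_snoc (fun l => a l ^ p), mul_comm, ENNReal.ofReal_mul (by have := ha j; positivity),
        ENNReal.ofReal_rpow_of_nonneg (ha j).le hp]
    have hstep : ∀ k : ℕ, ∑' I : Fin (k + 1) → ℕ,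
        ENNReal.ofReal (∏ j, a (I j) ^ p) * N (List.ofFn I ++ J) =
          ∑' j, ENNReal.ofReal (a j) ^ p * ∑' I : Fin k → ℕ,
            ENNReal.ofReal (∏ l, a (I l) ^ p) * N (List.ofFn I ++ j :: J) := by
      intro k
      rw [tsum_fin_snoc]
      refine tsum_congr fun j => ?_
      rw [← ENNReal.tsum_mul_left]
      refine tsum_congr fun I => ?_
      rw [hw, ofFn_snoc, List.append_assoc, List.singleton_append, mul_assoc]
    have hIcc : ∀ (m : ℕ) (F : ℕ → ℝ≥0∞),
        ∑ k ∈ Finset.Icc 1 m, F k = ∑ k ∈ Finset.range m, F (k + 1) := by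
      intro m F
      rw [Finset.range_eq_Ico, Finset.sum_Ico_add' F 0 m 1]
      rfl
    rw [een, hIcc, Finset.sum_range_succ', hstep 0]
    simp only [hstep]
    congr 1
    rw [← Summable.tsum_finsetSum (fun _ _ => ENNReal.summable), ← ENNReal.tsum_add]
    refine tsum_congr fun j => ?_
    rw [ih, hIcc, ← Finset.mul_sum, ← mul_add, add_comm]
    simp

variable {a : ℕ → ℝ} {p : ℝ} {V : Set Ell2} {m : ℕ} {f : Ell2 → ℝ} {E : ℝ≥0∞}

theorem integrable_of_memLp (hp : 1 ≤ p)
    (h : MemLp f (ENNReal.ofReal p) ((gaussP a).restrict V)) :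
    Integrable f ((gaussP a).restrict V) :=
  h.integrable (by simpa using ENNReal.ofReal_le_ofReal hp)

/-- Since `weakD` is an arbitrary choice, uniqueness is needed to compute the energy from any
explicitly constructed family of derivatives. -/
theorem IsWeakDeriv.ae_unique (ha : ∀ i, 0 < a i) (hs : Summable a) (hp : 1 ≤ p) (hV : IsOpen V)
    {I : List ℕ} {g g' : Ell2 → ℝ} (h : IsWeakDeriv a p V I f g)
    (h' : IsWeakDeriv a p V I f g') : g =ᵐ[(gaussP a).restrict V] g' := by
  have hg := integrable_of_memLp hp h.1
  have hg' := integrable_of_memLp hp h'.1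
  have := ae_eq_zero_of_specialTest hV (hg.sub hg') fun φ hφ => by
    have hn : Nice V φ := .of_continuous hφ.contDiff.continuous (by
      obtain ⟨M, -, hM⟩ := hφ.exists_bound 0
      exact ⟨M, fun x _ => hM [] rfl x⟩)
    have e1 := h.2 φ (hφ.isTest ha hs)
    have e2 := h'.2 φ (hφ.isTest ha hs)
    simp only [Pi.sub_apply, sub_mul]
    rw [integral_sub (hn.integrable_mul hV.measurableSet hg)
      (hn.integrable_mul hV.measurableSet hg'), e1, e2, sub_self]
  filter_upwards [this] with x hx
  simpa [sub_eq_zero] using hx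

theorem isWeakDeriv_weakD {I : List ℕ} (h : ∃ g, IsWeakDeriv a p V I f g) :
    IsWeakDeriv a p V I f (weakD a p V I f) := by
  rw [weakD, dif_pos h]
  exact h.choose_spec

theorem isWeakDeriv_nil (h : MemLp f (ENNReal.ofReal p) ((gaussP a).restrict V)) :
    IsWeakDeriv a p V [] f f := ⟨h, fun _ _ => rfl⟩

theorem extWeak_of_isWeakDeriv (ha : ∀ i, 0 < a i) (hs : Summable a) (hp : 1 ≤ p)
    (hV : IsOpen V) (hb : Bornology.IsBounded V) {I : List ℕ} {i : ℕ} {g g' : Ell2 → ℝ}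
    (h : IsWeakDeriv a p V I f g) (h' : IsWeakDeriv a p V (i :: I) f g') :
    ExtWeak a V i g g' := by
  refine extWeak_of_specialTest hV hb (integrable_of_memLp hp h.1) (integrable_of_memLp hp h'.1)
    fun φ hφ => ?_
  rw [h'.2 φ (hφ.isTest ha hs), h.2 _ ((hφ.dualD a i).isTest ha hs)]
  rfl

theorem hasW_of_family (ha : ∀ i, 0 < a i) (hs : Summable a) (hp : 1 ≤ p)
    (hV : IsOpen V) (hb : Bornology.IsBounded V) {G : List ℕ → Ell2 → ℝ}
    (hG : ∀ I : List ℕ, I.length ≤ m → IsWeakDeriv a p V I f (G I)) (n : ℕ) (J : List ℕ)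
    (hJ : J.length + n ≤ m) :
    HasW a p V n (G J) (een a p (fun I => ∫⁻ x in V, ‖G I x‖ₑ ^ p ∂(gaussP a)) n J) := by
  induction n generalizing J with
  | zero => exact ⟨(hG J (by omega)).1, le_rfl⟩
  | succ n ih =>
    refine ⟨(hG J (by omega)).1, fun j => G (j :: J), _, fun j => ⟨?_, ih (j :: J) ?_⟩, le_rfl⟩
    · exact extWeak_of_isWeakDeriv ha hs hp hV hb (hG J (by omega))
        (hG (j :: J) (by simp only [List.length_cons]; omega))
    · simp only [List.length_cons]; omega

theorem hasW_of_memW (ha : ∀ i, 0 < a i) (hs : Summable a) (hp : 1 ≤ p)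
    (hV : IsOpen V) (hb : Bornology.IsBounded V) (h : MemW a m p V f) :
    HasW a p V m f (sobolevEnergy a m p V f) := by
  classical
  set G : List ℕ → Ell2 → ℝ := fun I => if I = [] then f else weakD a p V I f with hGdef
  have hG : ∀ I : List ℕ, I.length ≤ m → IsWeakDeriv a p V I f (G I) := by
    intro I hI
    by_cases hnil : I = []
    · subst hnil; simpa [hGdef] using isWeakDeriv_nil h.memLp
    · simp only [hGdef, if_neg hnil]
      apply isWeakDeriv_weakD
      have := h.exists_weakDeriv I.length (Finset.mem_Icc.2 ⟨List.length_pos_iff.2 hnil, hI⟩) I.get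
      rwa [List.ofFn_get] at this
  have key := hasW_of_family ha hs hp hV hb hG m [] (by simp)
  refine key.mono (le_of_eq ?_)
  rw [een_eq_sum ha (by linarith), sobolevEnergy]
  refine congrArg₂ _ (by simp [hGdef]) (Finset.sum_congr rfl fun k hk => tsum_congr fun I => ?_)
  have hne : List.ofFn I ≠ [] := by
    intro h0
    have := congrArg List.length h0
    simp only [List.length_ofFn, List.length_nil] at this
    have := (Finset.mem_Icc.1 hk).1
    omega
  simp only [List.append_nil, hGdef, if_neg hne]

/-- Weak derivatives of the first-order derivative `D j` are weak derivatives of `f` of one order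
higher. The identity between `f` and `D j` is tested against an iterated adjoint, which is why
`HasW` is built on `ExtWeak`. -/
theorem HasW.exists_family (hV : IsOpen V)
    (hb : Bornology.IsBounded V) {n : ℕ} (h : HasW a p V n f E) :
    ∃ G : List ℕ → Ell2 → ℝ, G [] = f ∧
      (∀ I : List ℕ, I.length ≤ n → IsWeakDeriv a p V I f (G I)) ∧
      een a p (fun I => ∫⁻ x in V, ‖G I x‖ₑ ^ p ∂(gaussP a)) n [] ≤ E := by
  classical
  induction n generalizing f E with
  | zero =>
    refine ⟨fun _ => f, rfl, fun I hI => ?_, h.2⟩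
    have : I = [] := List.length_eq_zero_iff.1 (by omega)
    subst this
    exact isWeakDeriv_nil h.1
  | succ n ih =>
    obtain ⟨h1, D, ε, hD, hE⟩ := h
    choose G hG0 hG hGE using fun j => ih (hD j).2
    -- The last entry of the list is the innermost derivative; it selects the branch `D j`, and the
    -- remaining list is handled by induction.
    set H : List ℕ → Ell2 → ℝ := fun I =>
      if hI : I = [] then f else G (I.getLast hI) I.dropLast with hH
    have hHa : ∀ I j, H (I ++ [j]) = G j I := by
      intro I j
      simp [hH]
    have hH0 : H [] = f := by simp [hH]
    refine ⟨H, hH0, fun I hI => ?_, ?_⟩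
    · rcases List.eq_nil_or_concat I with rfl | ⟨I', j, rfl⟩
      · rw [hH0]; exact isWeakDeriv_nil h1
      · simp only [List.concat_eq_append, List.length_append, List.length_singleton] at hI ⊢
        rw [hHa]
        have hw := hG j I' (by omega)
        refine ⟨hw.1, fun φ hφ => ?_⟩
        rw [hw.2 φ hφ, iterDualD_append,
          (hD j).1 _ _ (hφ.dirTest_iterDualD hV hb I' j)]
        rfl
    · simp only [een]
      rw [hH0]
      refine le_trans (add_le_add le_rfl (ENNReal.tsum_le_tsum fun j => ?_)) hE
      refine mul_le_mul_right ?_ _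
      have := een_append a p (fun I => ∫⁻ x in V, ‖H I x‖ₑ ^ p ∂(gaussP a)) n [] [j]
      simp only [List.nil_append, hHa] at this
      rw [this]
      exact hGE j

theorem HasW.memW (ha : ∀ i, 0 < a i) (hs : Summable a) (hp : 1 ≤ p) (hV : IsOpen V)
    (hb : Bornology.IsBounded V) (h : HasW a p V m f E) (hE : E < ⊤) :
    MemW a m p V f ∧ sobolevEnergy a m p V f ≤ E := by
  obtain ⟨G, hG0, hG, hGE⟩ := h.exists_family hV hb
  have hle : sobolevEnergy a m p V f ≤ E := by
    refine le_trans (le_of_eq ?_) hGE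
    rw [een_eq_sum ha (by linarith), sobolevEnergy, hG0]
    refine congrArg₂ _ rfl (Finset.sum_congr rfl fun k hk => tsum_congr fun I => ?_)
    congr 1
    rw [List.append_nil]
    have hI := hG (List.ofFn I) (by simpa using (Finset.mem_Icc.1 hk).2)
    refine lintegral_congr_ae ?_
    filter_upwards [(isWeakDeriv_weakD ⟨_, hI⟩).ae_unique ha hs hp hV hI] with x hx
    rw [hx]
  refine ⟨⟨h.memLp, fun k hk I => ⟨_, hG (List.ofFn I) ?_⟩, hle.trans_lt hE⟩, hle⟩
  simpa using (Finset.mem_Icc.1 hk).2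

end

/-! ### Calculus on two-dimensional slices -/

theorem FContinuousOn.continuousAt_plane {V : Set Ell2} (hV : IsOpen V) {u : Ell2 → ℝ}
    (hu : FContinuousOn V u) (i j : ℕ) {x : Ell2} (hx : x ∈ V) {z : ℝ × ℝ}
    (hz : x + (z.1 • e i + z.2 • e j) ∈ V) :
    ContinuousAt (fun z : ℝ × ℝ => u (x + (z.1 • e i + z.2 • e j))) z := by
  set l := max i j + 1 with hl
  have hsum : ∀ z : ℝ × ℝ, ∑ k : Fin l, ((if (k : ℕ) = i then z.1 else 0) +
      (if (k : ℕ) = j then z.2 else 0)) • e (k : ℕ) = z.1 • e i + z.2 • e j := fun z => by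
    simp_rw [add_smul]
    rw [Finset.sum_add_distrib, sum_ite_smul_e (by omega), sum_ite_smul_e (by omega)]
  have hc : ContinuousAt (fun (z : ℝ × ℝ) (k : Fin l) => (if (k : ℕ) = i then z.1 else 0) +
      (if (k : ℕ) = j then z.2 else 0)) z := by
    refine Continuous.continuousAt (continuous_pi fun k => ?_)
    split_ifs <;> fun_prop
  have := hu.continuousAt_comp hV hx hc (by rwa [hsum])
  simpa only [hsum] using this

/-- F-continuity makes the two partial derivatives jointly continuous on the plane, which yields
Fréchet differentiability there. This is all the chain rule needs; Fréchet differentiability on the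
whole space is not used. -/
theorem CFB.hasFDerivAt_plane {V : Set Ell2} (hV : IsOpen V) {u : Ell2 → ℝ}
    (hu : CFB V u) (i j : ℕ) {x : Ell2} (hx : x ∈ V) {z : ℝ × ℝ}
    (hz : x + (z.1 • e i + z.2 • e j) ∈ V) :
    HasFDerivAt (fun z : ℝ × ℝ => u (x + (z.1 • e i + z.2 • e j)))
      (_root_.lineDeriv ℝ u (x + (z.1 • e i + z.2 • e j)) (e i) • ContinuousLinearMap.fst ℝ ℝ ℝ +
        _root_.lineDeriv ℝ u (x + (z.1 • e i + z.2 • e j)) (e j) • ContinuousLinearMap.snd ℝ ℝ ℝ)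
      z := by
  have hcont : Continuous fun z : ℝ × ℝ => x + (z.1 • e i + z.2 • e j) := by fun_prop
  have hev : ∀ᶠ v in 𝓝 z, x + (v.1 • e i + v.2 • e j) ∈ V := hcont.continuousAt (hV.mem_nhds hz)
  have h := hasStrictFDerivAt_uncurry_coprod (𝕜 := ℝ) (u := z)
    (f := fun s t => u (x + (s • e i + t • e j)))
    (f₁ := fun s t => ContinuousLinearMap.toSpanSingleton ℝ
      (_root_.lineDeriv ℝ u (x + (s • e i + t • e j)) (e i)))
    (f₂ := fun s t => ContinuousLinearMap.toSpanSingleton ℝ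
      (_root_.lineDeriv ℝ u (x + (s • e i + t • e j)) (e j))) ?_ ?_ ?_ ?_
  · refine h.hasFDerivAt.congr_fderiv ?_
    ext <;> simp [Function.HasUncurry.uncurry]
  · filter_upwards [hev] with v hv
    have h1 := (hu.niceDeriv i).hasDeriv _ hv
    rw [HasLineDerivAt, ← sub_self v.1] at h1
    have h2 := h1.comp_sub_const v.1 v.1
    refine HasDerivAt.hasFDerivAt (h2.congr_of_eventuallyEq (Eventually.of_forall fun s => ?_))
    simp only [sub_smul]
    congr 1; abel
  · filter_upwards [hev] with v hv
    have h1 := (hu.niceDeriv j).hasDeriv _ hv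
    rw [HasLineDerivAt, ← sub_self v.2] at h1
    have h2 := h1.comp_sub_const v.2 v.2
    refine HasDerivAt.hasFDerivAt (h2.congr_of_eventuallyEq (Eventually.of_forall fun s => ?_))
    simp only [sub_smul]
    congr 1; abel
  · have := (hu.lineDeriv i).nice.fcontinuous.continuousAt_plane hV i j hx hz
    exact (ContinuousLinearMap.toSpanSingletonCLE (𝕜 := ℝ) (E := ℝ)).continuous.continuousAt.comp this
  · have := (hu.lineDeriv j).nice.fcontinuous.continuousAt_plane hV i j hx hz
    exact (ContinuousLinearMap.toSpanSingletonCLE (𝕜 := ℝ) (E := ℝ)).continuous.continuousAt.comp this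

theorem CFB.lineDeriv_comm {V : Set Ell2} (hV : IsOpen V) {u : Ell2 → ℝ} (hu : CFB V u)
    (i j : ℕ) {x : Ell2} (hx : x ∈ V) :
    _root_.lineDeriv ℝ (fun y => _root_.lineDeriv ℝ u y (e i)) x (e j) =
      _root_.lineDeriv ℝ (fun y => _root_.lineDeriv ℝ u y (e j)) x (e i) := by
  have h0 : x + ((0 : ℝ × ℝ).1 • e i + (0 : ℝ × ℝ).2 • e j) = x := by simp
  have hcont : Continuous fun z : ℝ × ℝ => x + (z.1 • e i + z.2 • e j) := by fun_prop
  have hev : ∀ᶠ v in 𝓝 (0 : ℝ × ℝ), x + (v.1 • e i + v.2 • e j) ∈ V :=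
    hcont.continuousAt (hV.mem_nhds (by rwa [h0]))
  have hf := hev.mono fun v hv => hu.hasFDerivAt_plane hV i j hx (z := v) hv
  have h1 := (hu.lineDeriv i).hasFDerivAt_plane hV i j hx (z := 0) (by rwa [h0])
  have h2 := (hu.lineDeriv j).hasFDerivAt_plane hV i j hx (z := 0) (by rwa [h0])
  rw [h0] at h1 h2
  have hx' := (h1.smul_const (ContinuousLinearMap.fst ℝ ℝ ℝ)).add
    (h2.smul_const (ContinuousLinearMap.snd ℝ ℝ ℝ))
  have := second_derivative_symmetric_of_eventually hf hx' (0, 1) (1, 0)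
  simpa using this

/-- The derivative of a smooth function along a path in a two-dimensional slice. -/
theorem CFB.hasDerivAt_path {V : Set Ell2} (hV : IsOpen V) {u : Ell2 → ℝ} (hu : CFB V u)
    (i j : ℕ) {x : Ell2} (hx : x ∈ V) {c d : ℝ → ℝ} {c' d' : ℝ} (hc : HasDerivAt c c' 0)
    (hd : HasDerivAt d d' 0) (hc0 : c 0 = 0) (hd0 : d 0 = 0) :
    HasDerivAt (fun s => u (x + (c s • e i + d s • e j)))
      (_root_.lineDeriv ℝ u x (e i) * c' + _root_.lineDeriv ℝ u x (e j) * d') 0 := by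
  have h0 : x + ((c 0, d 0).1 • e i + (c 0, d 0).2 • e j) = x := by simp [hc0, hd0]
  have h1 := hu.hasFDerivAt_plane hV i j hx (z := (c 0, d 0)) (by rwa [h0])
  rw [h0] at h1
  have := h1.comp_hasDerivAt (0 : ℝ) (f := fun s => (c s, d s)) (hc.prodMk hd)
  refine HasDerivAt.congr_deriv this ?_
  simp

/-! ### The behaviour of chart maps along lines -/

/-- The displacement stays in the plane of the images of `e l` and `e A`. For `l = B` only the
second direction remains, because the chart discards the old coordinate `B`. -/
theorem chartMap_add_smul (A B : ℕ) (g : Ell2 → ℝ) (x : Ell2) (l : ℕ) (s : ℝ) :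
    chartMap A B g (x + s • e l) = chartMap A B g x +
      ((if l = B then 0 else s) • e (Equiv.swap A B l) + (g (x + s • e l) - g x) • e A) := by
  ext i
  simp only [chartMap_apply, add_coord, smul_coord, e_apply, Equiv.swap_apply_def]
  split_ifs <;> subst_vars <;> simp_all

theorem chartMap_hasDeriv_comp {W : Set Ell2} (hW : IsOpen W) {A B : ℕ}
    {g u : Ell2 → ℝ} (hu : CFB W u) {x : Ell2} (hTx : chartMap A B g x ∈ W) {l : ℕ} {g' : ℝ}
    (hg : HasLineDerivAt ℝ g g' x (e l)) :
    HasLineDerivAt ℝ (fun y => u (chartMap A B g y))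
      ((if l = B then 0 else lineDeriv ℝ u (chartMap A B g x) (e (Equiv.swap A B l))) +
        lineDeriv ℝ u (chartMap A B g x) (e A) * g') x (e l) := by
  rw [HasLineDerivAt]
  simp_rw [chartMap_add_smul]
  have hc : HasDerivAt (fun s : ℝ => if l = B then 0 else s) (if l = B then 0 else 1) 0 := by
    split_ifs
    exacts [hasDerivAt_const _ _, hasDerivAt_id _]
  have hd : HasDerivAt (fun s : ℝ => g (x + s • e l) - g x) g' 0 := hg.sub_const _
  have := hu.hasDerivAt_path hW (Equiv.swap A B l) A hTx hc hd (by simp) (by simp)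
  refine this.congr_deriv ?_
  split_ifs <;> simp

section

/-! ### Pairs of mutually inverse chart maps -/

/-- The maps `chartMap A B g` and `chartMap B A h` are mutually inverse bijections between the
bounded open sets `V` and `W`. -/
structure ChartPair (A B : ℕ) (V W : Set Ell2) (g h : Ell2 → ℝ) : Prop where
  isOpen_left : IsOpen V
  isOpen_right : IsOpen W
  bounded_left : Bornology.IsBounded V
  bounded_right : Bornology.IsBounded W
  smooth_left : CFB V g
  smooth_right : CFB W h
  mapsTo_left : Set.MapsTo (chartMap A B g) V W
  mapsTo_right : Set.MapsTo (chartMap B A h) W V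
  leftInv : ∀ x ∈ V, chartMap B A h (chartMap A B g x) = x
  rightInv : ∀ y ∈ W, chartMap A B g (chartMap B A h y) = y
  deriv_left : ∃ c > 0, ∀ x ∈ V, c ≤ |lineDeriv ℝ g x (e B)|
  deriv_right : ∃ c > 0, ∀ y ∈ W, c ≤ |lineDeriv ℝ h y (e A)|
  support_left : ∀ E, UnifIncl E V → ∀ l, ∃ c > 0, ∀ x ∈ E, ∀ s : ℝ, |s| ≤ c →
    chartMap A B g x + s • e l ∈ W
  support_right : ∀ E, UnifIncl E W → ∀ l, ∃ c > 0, ∀ y ∈ E, ∀ s : ℝ, |s| ≤ c →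
    chartMap B A h y + s • e l ∈ V

namespace ChartPair

variable {a : ℕ → ℝ} {p : ℝ} {A B : ℕ} {V W : Set Ell2} {g h f : Ell2 → ℝ}

/-- The structure is arranged in left and right pairs so that every estimate is proved in one
direction only. -/
theorem symm (H : ChartPair A B V W g h) : ChartPair B A W V h g :=
  ⟨H.2, H.1, H.4, H.3, H.6, H.5, H.8, H.7, H.10, H.9, H.12, H.11, H.14, H.13⟩

theorem comp_eq_coord (H : ChartPair A B V W g h) {x : Ell2} (hx : x ∈ V) :
    h (chartMap A B g x) = x B := by
  have := congrArg (fun y : Ell2 => y B) (H.leftInv x hx)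
  simpa [chartMap_apply] using this

theorem lineDeriv_comp_eq (H : ChartPair A B V W g h) {x : Ell2} (hx : x ∈ V) (l : ℕ) :
    (if l = B then 0 else lineDeriv ℝ h (chartMap A B g x) (e (Equiv.swap A B l))) +
      lineDeriv ℝ h (chartMap A B g x) (e A) * lineDeriv ℝ g x (e l) =
        if B = l then 1 else 0 := by
  have h1 := chartMap_hasDeriv_comp H.isOpen_right H.smooth_right (H.mapsTo_left hx)
    ((H.smooth_left.niceDeriv l).hasDeriv x hx)
  have h2 := ((NiceDeriv.coord H.bounded_left l B).congr H.isOpen_left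
    (fun y hy => (H.comp_eq_coord hy).symm) (fun _ _ => rfl)).hasDeriv x hx
  exact h1.lineDeriv.symm.trans h2.lineDeriv

theorem lineDeriv_left_ne (H : ChartPair A B V W g h) {x : Ell2} (hx : x ∈ V) :
    lineDeriv ℝ g x (e B) ≠ 0 := by
  obtain ⟨c, hc, h⟩ := H.deriv_left
  intro h0
  have := h x hx
  rw [h0, abs_zero] at this
  linarith

theorem lineDeriv_mul_self (H : ChartPair A B V W g h) {x : Ell2} (hx : x ∈ V) :
    lineDeriv ℝ h (chartMap A B g x) (e A) * lineDeriv ℝ g x (e B) = 1 := by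
  simpa using H.lineDeriv_comp_eq hx B

/-- Implicit differentiation: the identity `h ∘ chartMap A B g = (· B)` is differentiated along `e
(σ j)` and along `e B`, with σ the transposition of `A` and `B`, and the derivative of `h` along `e
A` is eliminated. -/
theorem lineDeriv_mul (H : ChartPair A B V W g h) {x : Ell2} (hx : x ∈ V) {j : ℕ} (hj : j ≠ A) :
    lineDeriv ℝ h (chartMap A B g x) (e j) * lineDeriv ℝ g x (e B) =
      -lineDeriv ℝ g x (e (Equiv.swap A B j)) := by
  have hl : Equiv.swap A B j ≠ B := by
    rwa [Ne, Equiv.swap_apply_eq_iff, Equiv.swap_apply_right]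
  have h1 := H.lineDeriv_comp_eq hx (Equiv.swap A B j)
  rw [if_neg hl, if_neg hl.symm, Equiv.swap_apply_self] at h1
  have h2 := H.lineDeriv_mul_self hx
  linear_combination lineDeriv ℝ g x (e B) * h1 - lineDeriv ℝ g x (e (Equiv.swap A B j)) * h2

/-! ### The change of variables as an identity of measures -/

/-- The density of the change of variables. -/
def density (a : ℕ → ℝ) (A B : ℕ) (g : Ell2 → ℝ) : Ell2 → ℝ :=
  chartDensity a A B g fun x => lineDeriv ℝ g x (e B)

theorem chartMap_eq_of_eq {g₁ g₂ : Ell2 → ℝ} {x : Ell2} (h : g₁ x = g₂ x) :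
    chartMap A B g₁ x = chartMap A B g₂ x := by simp only [chartMap, h]

theorem measurable_chartMap (hg : Measurable g) : Measurable (chartMap A B g) := by
  have h1 := measurable_coord A
  have h2 := measurable_coord B
  refine (measurable_id.add ((hg.sub h1).smul_const _)).add ?_
  split_ifs
  exacts [measurable_const, (h1.sub h2).smul_const _]

theorem measurable_chartDensity {w : Ell2 → ℝ} (hg : Measurable g) (hw : Measurable w) :
    Measurable (chartDensity a A B g w) := by
  have h1 := measurable_coord A
  have h2 := measurable_coord B
  exact hw.abs.mul (((measurable_rho a A).comp hg).mul (((measurable_rho a B).comp h1).div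
    (((measurable_rho a A).comp h1).mul ((measurable_rho a B).comp h2))))

/-- The function `g` is Borel on `V` only. Extending it and its derivative by zero gives globally
measurable representatives without changing anything on `V`. -/
theorem exists_measurable (H : ChartPair A B V W g h) : ∃ g₁ J : Ell2 → ℝ,
    Measurable g₁ ∧ Measurable J ∧ (∀ x ∈ V, g₁ x = g x) ∧ (∀ x ∈ V, J x = density a A B g x) := by
  have hm := H.isOpen_left.measurableSet
  refine ⟨V.indicator g, _, H.smooth_left.nice.measurable_indicator hm,
    measurable_chartDensity (a := a) (A := A) (B := B)
      (H.smooth_left.nice.measurable_indicator hm)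
      ((H.smooth_left.lineDeriv B).nice.measurable_indicator hm),
    fun x hx => Set.indicator_of_mem hx _, fun x hx => ?_⟩
  simp only [density, chartDensity, Set.indicator_of_mem hx]

/-- As an identity of measures, the change of variables transfers integrability, almost everywhere
measurability and signed integrals at once. -/
theorem map_withDensity (ha : ∀ i, 0 < a i) (H : ChartPair A B V W g h) {g₁ J : Ell2 → ℝ}
    (hg₁ : Measurable g₁) (hg : ∀ x ∈ V, g₁ x = g x)
    (hJ' : ∀ x ∈ V, J x = density a A B g x) :
    (((gaussP a).restrict V).withDensity fun x => ENNReal.ofReal (J x)).map (chartMap A B g₁) =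
      (gaussP a).restrict W := by
  have hm := H.isOpen_left.measurableSet
  have hT : ∀ x ∈ V, chartMap A B g₁ x = chartMap A B g x := fun x hx =>
    chartMap_eq_of_eq (hg x hx)
  have hTm := measurable_chartMap (A := A) (B := B) hg₁
  have hw := (H.smooth_left.lineDeriv B).nice.measurable_indicator hm
  ext s hs
  rw [Measure.map_apply hTm hs, ← lintegral_indicator_one hs,
    lintegral_chartMap ha A B hm H.isOpen_right.measurableSet hg₁ hw ?_ ?_ ?_
      (measurable_one.indicator hs),
    withDensity_apply _ (hTm hs), ← lintegral_indicator (hTm hs)]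
  · refine setLIntegral_congr_fun hm fun x hx => ?_
    by_cases hxs : chartMap A B g₁ x ∈ s
    · rw [Set.indicator_of_mem (by exact hxs), Set.indicator_of_mem hxs, Pi.one_apply, one_mul,
        hJ' x hx]
      simp only [density, chartDensity, Set.indicator_of_mem hx, hg x hx]
    · rw [Set.indicator_of_notMem (by exact hxs), Set.indicator_of_notMem hxs, zero_mul]
  · intro x hx
    rw [Set.indicator_of_mem hx]
    refine ((H.smooth_left.niceDeriv B).hasDeriv x hx).congr_of_eventuallyEq ?_
    filter_upwards [H.isOpen_left.mem_nhds hx] with y hy using hg y hy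
  · intro x hx y hy hxy
    rw [hT x hx, hT y hy] at hxy
    rw [← H.leftInv x hx, hxy, H.leftInv y hy]
  · refine Set.Subset.antisymm ?_ fun y hy => ⟨_, H.mapsTo_right hy, ?_⟩
    · rintro _ ⟨x, hx, rfl⟩
      rw [hT x hx]
      exact H.mapsTo_left hx
    · rw [hT _ (H.mapsTo_right hy), H.rightInv y hy]

theorem density_pos (ha : ∀ i, 0 < a i) (H : ChartPair A B V W g h) {x : Ell2} (hx : x ∈ V) :
    0 < density a A B g x := by
  have hr := rho_pos ha
  have := abs_pos.2 (H.lineDeriv_left_ne hx)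
  exact mul_pos this (mul_pos (hr _ _) (div_pos (hr _ _) (mul_pos (hr _ _) (hr _ _))))

theorem aestronglyMeasurable_comp (ha : ∀ i, 0 < a i) (H : ChartPair A B V W g h)
    (hf : AEStronglyMeasurable f ((gaussP a).restrict V)) :
    AEStronglyMeasurable (f ∘ chartMap B A h) ((gaussP a).restrict W) := by
  obtain ⟨h₁, J, hh₁, hJ, hh, hJ'⟩ := H.symm.exists_measurable (a := a)
  rw [← H.symm.map_withDensity ha hh₁ hh hJ'] at hf
  have h1 := hf.comp_measurable (measurable_chartMap hh₁)
  have hW := H.isOpen_right.measurableSet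
  -- The density is strictly positive on `W`, so the weighted measure has no additional null sets.
  have hac : (gaussP a).restrict W ≪
      ((gaussP a).restrict W).withDensity fun x => ENNReal.ofReal (J x) := by
    refine withDensity_absolutelyContinuous' hJ.ennreal_ofReal.aemeasurable ?_
    filter_upwards [ae_restrict_mem hW] with y hy
    have := H.symm.density_pos ha hy
    rw [← hJ' y hy] at this
    simpa using this
  refine (h1.mono_ac hac).congr ?_
  filter_upwards [ae_restrict_mem hW] with y hy
  simp only [Function.comp_apply, chartMap_eq_of_eq (hh y hy)]

theorem integral_eq (ha : ∀ i, 0 < a i) (H : ChartPair A B V W g h) {F : Ell2 → ℝ}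
    (hF : AEStronglyMeasurable F ((gaussP a).restrict W)) :
    ∫ y in W, F y ∂(gaussP a) =
      ∫ x in V, density a A B g x * F (chartMap A B g x) ∂(gaussP a) := by
  obtain ⟨g₁, J, hg₁, hJ, hg, hJ'⟩ := H.exists_measurable (a := a)
  have hm := H.map_withDensity ha hg₁ hg hJ'
  rw [← hm] at hF ⊢
  rw [integral_map (measurable_chartMap hg₁).aemeasurable hF,
    integral_withDensity_eq_integral_toReal_smul hJ.ennreal_ofReal
      (Eventually.of_forall fun x => ENNReal.ofReal_lt_top)]
  refine setIntegral_congr_fun H.isOpen_left.measurableSet fun x hx => ?_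
  simp only [chartMap_eq_of_eq (hg x hx), hJ' x hx, smul_eq_mul,
    ENNReal.toReal_ofReal (H.density_pos ha hx).le]

theorem lintegral_comp_le (ha : ∀ i, 0 < a i) (H : ChartPair A B V W g h) {M : ℝ}
    (hM : ∀ x ∈ V, density a A B g x ≤ M) {F : Ell2 → ℝ≥0∞}
    (hF : AEMeasurable (F ∘ chartMap B A h) ((gaussP a).restrict W)) :
    ∫⁻ y in W, F (chartMap B A h y) ∂(gaussP a) ≤
      ENNReal.ofReal M * ∫⁻ x in V, F x ∂(gaussP a) := by
  obtain ⟨g₁, J, hg₁, hJ, hg, hJ'⟩ := H.exists_measurable (a := a)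
  have hm := H.map_withDensity ha hg₁ hg hJ'
  have hV := H.isOpen_left.measurableSet
  have hF' := hF
  rw [← hm] at hF'
  calc ∫⁻ y in W, F (chartMap B A h y) ∂(gaussP a)
      = ∫⁻ x, F (chartMap B A h (chartMap A B g₁ x))
          ∂(((gaussP a).restrict V).withDensity fun x => ENNReal.ofReal (J x)) := by
        rw [← hm]
        exact lintegral_map' hF' (measurable_chartMap hg₁).aemeasurable
    _ = ∫⁻ x in V, ENNReal.ofReal (J x) * F (chartMap B A h (chartMap A B g₁ x)) ∂(gaussP a) :=
        lintegral_withDensity_eq_lintegral_mul₀' hJ.ennreal_ofReal.aemeasurable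
          (hF'.comp_measurable (measurable_chartMap hg₁))
    _ ≤ ∫⁻ x in V, ENNReal.ofReal M * F x ∂(gaussP a) := by
        refine setLIntegral_mono' hV fun x hx => ?_
        rw [chartMap_eq_of_eq (hg x hx), H.leftInv x hx, hJ' x hx]
        exact mul_le_mul_left (ENNReal.ofReal_le_ofReal (hM x hx)) _
    _ = _ := lintegral_const_mul' _ _ ENNReal.ofReal_ne_top

theorem memLp_comp (ha : ∀ i, 0 < a i) (hp : 1 ≤ p) (H : ChartPair A B V W g h) {M : ℝ}
    (hM : ∀ x ∈ V, density a A B g x ≤ M)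
    (hf : MemLp f (ENNReal.ofReal p) ((gaussP a).restrict V)) :
    MemLp (f ∘ chartMap B A h) (ENNReal.ofReal p) ((gaussP a).restrict W) ∧
      ∫⁻ y in W, ‖(f ∘ chartMap B A h) y‖ₑ ^ p ∂(gaussP a) ≤
        ENNReal.ofReal M * ∫⁻ x in V, ‖f x‖ₑ ^ p ∂(gaussP a) := by
  have hm := H.aestronglyMeasurable_comp ha hf.1
  have hle := H.lintegral_comp_le ha hM (F := fun x => ‖f x‖ₑ ^ p) (hm.enorm.pow_const p)
  have hp0 : ENNReal.ofReal p ≠ 0 := by simpa using by linarith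
  have hpr : (ENNReal.ofReal p).toReal = p := ENNReal.toReal_ofReal (by linarith)
  refine ⟨⟨hm, ?_⟩, hle⟩
  rw [eLpNorm_lt_top_iff_lintegral_rpow_enorm_lt_top hp0 ENNReal.ofReal_ne_top, hpr]
  refine hle.trans_lt (ENNReal.mul_lt_top ENNReal.ofReal_lt_top ?_)
  have := hf.2
  rwa [eLpNorm_lt_top_iff_lintegral_rpow_enorm_lt_top hp0 ENNReal.ofReal_ne_top, hpr] at this

end ChartPair

end

section

/-! ### Transported test functions -/

section Pieces

variable {a : ℕ → ℝ} {V : Set Ell2} {u u' w w' g g' : Ell2 → ℝ} {l : ℕ}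

theorem continuous_rho (ha : ∀ i, 0 < a i) (i : ℕ) : Continuous (rho a i) :=
  continuous_iff_continuousAt.2 fun t => (hasDerivAt_rho ha i t).continuousAt

theorem NiceDeriv.rho_comp (ha : ∀ i, 0 < a i) (hu : NiceDeriv V l u u') (i : ℕ) :
    NiceDeriv V l (fun x => rho a i (u x))
      fun x => -(u x / a i ^ 2) * rho a i (u x) * u' x := by
  have := continuous_rho ha i
  exact hu.comp_real (hasDerivAt_rho ha i) (by fun_prop)

theorem NiceDeriv.inv_rho_comp (ha : ∀ i, 0 < a i) (hu : NiceDeriv V l u u') (i : ℕ) :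
    NiceDeriv V l (fun x => (rho a i (u x))⁻¹)
      fun x => u x / a i ^ 2 * (rho a i (u x))⁻¹ * u' x := by
  have h0 : ∀ t, rho a i t ≠ 0 := fun t => (rho_pos ha i t).ne'
  have hc := (continuous_rho ha i).inv₀ h0
  refine hu.comp_real (F := fun t => (rho a i t)⁻¹) (F' := fun t => t / a i ^ 2 * (rho a i t)⁻¹)
    (fun t => ?_) ((continuous_id.div_const _).mul hc)
  refine ((hasDerivAt_rho ha i t).inv (h0 t)).congr_deriv ?_
  have := h0 t
  field_simp

/-- The Gaussian factor in the density of a change of variables exchanging the coordinates `A`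
and `B`. -/
def swapKernel (a : ℕ → ℝ) (A B : ℕ) (x : Ell2) : ℝ :=
  rho a B (x A) * ((rho a A (x A))⁻¹ * (rho a B (x B))⁻¹)

/-- The logarithmic derivative of `swapKernel` along `e l`. -/
def swapKernelLog (a : ℕ → ℝ) (A B l : ℕ) (x : Ell2) : ℝ :=
  if l = B then x B / a B ^ 2 else x l / a l ^ 2 - x l / a (Equiv.swap A B l) ^ 2

theorem niceDeriv_swapKernel (ha : ∀ i, 0 < a i) (hb : Bornology.IsBounded V) (A B l : ℕ) :
    NiceDeriv V l (swapKernel a A B) fun x => swapKernelLog a A B l x * swapKernel a A B x := by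
  have h1 := (NiceDeriv.coord hb l A).rho_comp ha B
  have h2 := (NiceDeriv.coord hb l A).inv_rho_comp ha A
  have h3 := (NiceDeriv.coord hb l B).inv_rho_comp ha B
  refine (h1.mul (h2.mul h3)).congr_deriv fun x _ => ?_
  simp only [swapKernel, swapKernelLog, Equiv.swap_apply_def]
  by_cases hlB : l = B
  · subst hlB
    by_cases hA : A = l
    · subst hA; simp only [if_true]; ring
    · simp only [if_true, if_neg hA]; ring
  · by_cases hA : l = A
    · subst hA
      simp only [if_true, if_neg hlB, if_neg (Ne.symm hlB)]; ring
    · simp only [if_neg hlB, if_neg (Ne.symm hlB), if_neg hA, if_neg (Ne.symm hA)]; ring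

/-- The sign of a function bounded away from zero is locally constant along lines. -/
theorem niceDeriv_sign (hV : IsOpen V) (hw : NiceDeriv V l w w') {c : ℝ} (hc : 0 < c)
    (h : ∀ x ∈ V, c ≤ |w x|) : NiceDeriv V l (fun x => w x * |w x|⁻¹) fun _ => 0 where
  nice := hw.nice.mul ((hw.nice.comp_continuous continuous_abs).inv hc fun x hx => by
    rw [abs_abs]; exact h x hx)
  nice' := .const 0
  hasDeriv x hx := by
    have h0 : w x ≠ 0 := fun h0 => by
      have := h x hx; rw [h0, abs_zero] at this; linarith
    have hcont : ContinuousAt (fun s : ℝ => w (x + s • e l)) 0 :=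
      hw.nice.fcontinuous.continuousAt_line hV hx l
    refine (hasDerivAt_const (0 : ℝ) (w x * |w x|⁻¹)).congr_of_eventuallyEq ?_
    have h00 : w (x + (0 : ℝ) • e l) = w x := by simp
    rcases lt_or_gt_of_ne h0 with hneg | hpos
    · filter_upwards [hcont.eventually (gt_mem_nhds (h00.trans_lt hneg))] with s hs
      rw [abs_of_neg hs, abs_of_neg hneg, inv_neg, inv_neg, mul_neg, mul_neg,
        mul_inv_cancel₀ hs.ne, mul_inv_cancel₀ h0]
    · filter_upwards [hcont.eventually (lt_mem_nhds (hpos.trans_eq h00.symm))] with s hs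
      rw [abs_of_pos hs, abs_of_pos hpos, mul_inv_cancel₀ hs.ne', mul_inv_cancel₀ h0]

end Pieces

theorem FContinuousOn.comp_chartMap {V : Set Ell2} {g u : Ell2 → ℝ} (hg : FContinuousOn V g)
    (hu : Continuous u) (A B : ℕ) : FContinuousOn V fun x => u (chartMap A B g x) := by
  intro x hx l
  refine hu.comp_continuousOn ?_
  have h1 := hg x hx l
  have h2 : ∀ i, Continuous fun s : Fin l → ℝ => (x + ∑ k : Fin l, s k • e (k : ℕ) : Ell2) i :=
    fun i => (continuous_coord i).comp (by fun_prop)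
  have h3 : Continuous fun s : Fin l → ℝ => (x + ∑ k : Fin l, s k • e (k : ℕ) : Ell2) := by
    fun_prop
  refine (h3.continuousOn.add ((h1.sub (h2 A).continuousOn).smul continuousOn_const)).add ?_
  split_ifs
  exacts [continuousOn_const, (((h2 A).sub (h2 B)).smul continuous_const).continuousOn]

theorem SpecialTest.cfb {a : ℕ → ℝ} (ha : ∀ i, 0 < a i) (hs : Summable a) {V : Set Ell2}
    {φ : Ell2 → ℝ} (h : SpecialTest V φ) : CFB V φ := by
  obtain ⟨M, -, hM⟩ := h.exists_bound 0
  exact ⟨(h.isTest ha hs).smooth, M, fun x _ => hM [] rfl x⟩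

theorem SpecialTest.continuous_lineDeriv {V : Set Ell2} {φ : Ell2 → ℝ} (h : SpecialTest V φ)
    (i : ℕ) : Continuous fun x => _root_.lineDeriv ℝ φ x (e i) :=
  (contDiff_partialD h.contDiff [i]).continuous

namespace ChartPair

variable {a : ℕ → ℝ} {p : ℝ} {A B : ℕ} {V W : Set Ell2} {g h f φ : Ell2 → ℝ}

theorem nice_comp (H : ChartPair A B V W g h) {u : Ell2 → ℝ} (hu : Continuous u)
    (hb : ∃ M : ℝ, ∀ y ∈ W, |u y| ≤ M) : Nice V fun x => u (chartMap A B g x) where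
  fcontinuous := H.smooth_left.nice.fcontinuous.comp_chartMap hu A B
  measurable := by
    have hm := H.smooth_left.nice.measurable_indicator H.isOpen_left.measurableSet
    have := (hu.measurable.comp (measurable_chartMap (A := A) (B := B) hm)).comp
      (measurable_subtype_coe (p := (· ∈ V)))
    convert this using 2 with x
    simp only [Function.comp_apply]
    rw [chartMap_eq_of_eq (Set.indicator_of_mem x.2 g)]
  bounded := by
    obtain ⟨M, hM⟩ := hb
    exact ⟨M, fun x hx => hM _ (H.mapsTo_left hx)⟩

/-- The derivative along `e l` of the composition of `φ` with a chart map. -/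
def compDeriv (A B : ℕ) (g φ : Ell2 → ℝ) (l : ℕ) (x : Ell2) : ℝ :=
  (if l = B then 0 else lineDeriv ℝ φ (chartMap A B g x) (e (Equiv.swap A B l))) +
    lineDeriv ℝ φ (chartMap A B g x) (e A) * lineDeriv ℝ g x (e l)

theorem niceDeriv_comp (ha : ∀ i, 0 < a i) (hs : Summable a) (H : ChartPair A B V W g h)
    (hφ : SpecialTest W φ) (l : ℕ) :
    NiceDeriv V l (fun x => φ (chartMap A B g x)) (compDeriv A B g φ l) where
  nice := H.nice_comp hφ.contDiff.continuous (hφ.cfb ha hs).bounded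
  nice' := by
    have h1 := fun i => H.nice_comp (hφ.continuous_lineDeriv i) ((hφ.cfb ha hs).lineDeriv i).bounded
    refine Nice.add ?_ ((h1 A).mul (H.smooth_left.lineDeriv l).nice)
    split_ifs
    exacts [.const 0, h1 _]
  hasDeriv x hx := chartMap_hasDeriv_comp H.isOpen_right (hφ.cfb ha hs) (H.mapsTo_left hx)
    ((H.smooth_left.niceDeriv l).hasDeriv x hx)

/-- The test function `φ`, transported by a chart map and multiplied by the density of the change
of variables without its factor `lineDeriv ℝ g x (e B)`. -/
def transport (a : ℕ → ℝ) (A B : ℕ) (g φ : Ell2 → ℝ) (x : Ell2) : ℝ :=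
  (lineDeriv ℝ g x (e B) * |lineDeriv ℝ g x (e B)|⁻¹) *
    (rho a A (g x) * swapKernel a A B x) * φ (chartMap A B g x)

/-- A number times its sign is its absolute value. Keeping the sign in `transport` and withholding
the factor itself avoids second derivatives of `g` when `transport` is differentiated, since the
sign is locally constant along lines. -/
theorem transport_mul (H : ChartPair A B V W g h) {x : Ell2} (hx : x ∈ V) :
    transport a A B g φ x * lineDeriv ℝ g x (e B) =
      density a A B g x * φ (chartMap A B g x) := by
  have h0 := H.lineDeriv_left_ne hx
  have h1 : lineDeriv ℝ g x (e B) * |lineDeriv ℝ g x (e B)|⁻¹ * lineDeriv ℝ g x (e B) =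
      |lineDeriv ℝ g x (e B)| := by
    have := abs_pos.2 h0
    field_simp
    rw [sq_abs]
  simp only [transport, density, chartDensity, swapKernel]
  rw [div_eq_mul_inv, mul_inv]
  linear_combination (rho a A (g x) * (rho a B (x A) * ((rho a A (x A))⁻¹ * (rho a B (x B))⁻¹)) *
    φ (chartMap A B g x)) * h1

/-- The derivative of `transport` along `e l`. -/
def transportDeriv (a : ℕ → ℝ) (A B : ℕ) (g φ : Ell2 → ℝ) (l : ℕ) (x : Ell2) : ℝ :=
  (lineDeriv ℝ g x (e B) * |lineDeriv ℝ g x (e B)|⁻¹) *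
      (rho a A (g x) * swapKernel a A B x) * compDeriv A B g φ l x +
    transport a A B g φ x *
      (swapKernelLog a A B l x - g x / a A ^ 2 * lineDeriv ℝ g x (e l))

theorem dirTest_transport (ha : ∀ i, 0 < a i) (hs : Summable a) (H : ChartPair A B V W g h)
    (hφ : SpecialTest W φ) (l : ℕ) :
    DirTest V l (transport a A B g φ) (transportDeriv a A B g φ l) where
  deriv := by
    obtain ⟨c, hc, hw⟩ := H.deriv_left
    have h1 := niceDeriv_sign H.isOpen_left ((H.smooth_left.lineDeriv B).niceDeriv l) hc hw
    have h2 := (H.smooth_left.niceDeriv l).rho_comp ha A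
    have h3 := niceDeriv_swapKernel ha H.bounded_left A B l
    refine ((h1.mul (h2.mul h3)).mul (H.niceDeriv_comp ha hs hφ l)).congr_deriv fun x _ => ?_
    simp only [transportDeriv, transport]
    ring
  support := by
    obtain ⟨c, hc, hsupp⟩ := H.support_right _ hφ.support l
    refine ⟨c, hc, fun x hx h0 s hle => ?_⟩
    have := hsupp (chartMap A B g x) (right_ne_zero_of_mul h0) s hle
    rwa [H.leftInv x hx] at this

/-- The logarithmic derivative of the kernel along `e B` cancels the Gaussian term at `x B`.
Differentiating `rho a A (g x)` produces instead the Gaussian term at `g x`, which is coordinate `A`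
of the image. -/
theorem dual_transport_self (H : ChartPair A B V W g h) {x : Ell2} (hx : x ∈ V) :
    -transportDeriv a A B g φ B x + x B / a B ^ 2 * transport a A B g φ x =
      density a A B g x * dualD a A φ (chartMap A B g x) := by
  have h1 := H.transport_mul (a := a) (φ := fun _ => 1) hx
  simp only [transport, mul_one] at h1
  simp only [transportDeriv, compDeriv, swapKernelLog, if_true, transport, dualD, chartMap_apply,
    zero_add]
  linear_combination (-lineDeriv ℝ φ (chartMap A B g x) (e A) +
    g x / a A ^ 2 * φ (chartMap A B g x)) * h1

/-- Two adjoints are combined so that everything produced by the motion of coordinate `A` cancels.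
The second derivatives of `g` cancel by symmetry, and the logarithmic derivative of the kernel
replaces the variance of index `l` by that of index `j`. -/
theorem dual_transport_ne (H : ChartPair A B V W g h) {x : Ell2} (hx : x ∈ V) {j l : ℕ}
    (hj : j ≠ A) (hl : l = Equiv.swap A B j) :
    (-(lineDeriv ℝ (fun y => lineDeriv ℝ g y (e B)) x (e l) * transport a A B g φ x +
          lineDeriv ℝ g x (e B) * transportDeriv a A B g φ l x) +
        x l / a l ^ 2 * (lineDeriv ℝ g x (e B) * transport a A B g φ x)) +
      (-(-lineDeriv ℝ (fun y => lineDeriv ℝ g y (e l)) x (e B) * transport a A B g φ x +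
          -lineDeriv ℝ g x (e l) * transportDeriv a A B g φ B x) +
        x B / a B ^ 2 * (-lineDeriv ℝ g x (e l) * transport a A B g φ x)) =
      density a A B g x * dualD a j φ (chartMap A B g x) := by
  have hlB : l ≠ B := by rwa [hl, Ne, Equiv.swap_apply_eq_iff, Equiv.swap_apply_right]
  have hσ : Equiv.swap A B l = j := by rw [hl, Equiv.swap_apply_self]
  have hTj : chartMap A B g x j = x l := by
    rw [chartMap_apply, if_neg hj, hl, Equiv.swap_apply_def, if_neg hj]
    split_ifs with hjB <;> simp [hjB]
  have h1 := H.transport_mul (a := a) (φ := fun _ => 1) hx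
  have h2 := H.smooth_left.lineDeriv_comm H.isOpen_left B l hx
  simp only [transport, mul_one] at h1
  simp only [transportDeriv, compDeriv, swapKernelLog, if_true, if_neg hlB, transport, dualD, hTj,
    zero_add, hσ, h2]
  linear_combination (-lineDeriv ℝ φ (chartMap A B g x) (e j) +
    x l / a j ^ 2 * φ (chartMap A B g x)) * h1

end ChartPair

end

section

/-! ### The chain rule for weak derivatives -/

theorem Nice.dual {V : Set Ell2} (hb : Bornology.IsBounded V) (a : ℕ → ℝ) (i : ℕ)
    {φ φ' : Ell2 → ℝ} (hφ : Nice V φ) (hφ' : Nice V φ') :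
    Nice V fun x => -φ' x + x i / a i ^ 2 * φ x := by
  have hx : Nice V fun x => x i / a i ^ 2 := by
    simpa [div_eq_mul_inv] using (Nice.coord hb i).mul (.const (a i ^ 2)⁻¹)
  exact hφ'.neg.add (hx.mul hφ)

namespace ChartPair

variable {a : ℕ → ℝ} {p : ℝ} {A B : ℕ} {V W : Set Ell2} {g h f : Ell2 → ℝ}

theorem exists_density_le (ha : ∀ i, 0 < a i) (H : ChartPair A B V W g h) :
    ∃ M : ℝ, ∀ x ∈ V, density a A B g x ≤ M := by
  have h1 := (H.smooth_left.lineDeriv B).nice.comp_continuous continuous_abs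
  have h2 := H.smooth_left.nice.comp_continuous (continuous_rho ha A)
  have h3 := (niceDeriv_swapKernel ha H.bounded_left A B 0).nice
  obtain ⟨M, hM⟩ := (h1.mul (h2.mul h3)).bounded
  refine ⟨M, fun x hx => le_trans (le_of_eq ?_) ((le_abs_self _).trans (hM x hx))⟩
  simp only [density, chartDensity, swapKernel, div_eq_mul_inv, mul_inv]

/-- Only special tests on `W` have to be examined. Their transports are directional tests on `V`,
where the full strength of the hypothesis on `f` is available; changing variables back gives the
chain rule. -/
theorem extWeak_comp (ha : ∀ i, 0 < a i) (hs : Summable a) (hp : 1 ≤ p)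
    (H : ChartPair A B V W g h) {D : ℕ → Ell2 → ℝ}
    (hf : MemLp f (ENNReal.ofReal p) ((gaussP a).restrict V))
    (hD : ∀ j, MemLp (D j) (ENNReal.ofReal p) ((gaussP a).restrict V))
    (hfD : ∀ j, ExtWeak a V j f (D j)) (j : ℕ) :
    ExtWeak a W j (f ∘ chartMap B A h) fun y =>
      (if j = A then 0 else (D (Equiv.swap A B j) ∘ chartMap B A h) y) +
        (D B ∘ chartMap B A h) y * lineDeriv ℝ h y (e j) := by
  obtain ⟨M, hM⟩ := H.exists_density_le ha
  have hVm := H.isOpen_left.measurableSet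
  have hWm := H.isOpen_right.measurableSet
  have hfi := integrable_of_memLp hp hf
  have hDi := fun j => integrable_of_memLp hp (hD j)
  have hfS := integrable_of_memLp hp (H.memLp_comp ha hp hM hf).1
  have hDS := fun j => integrable_of_memLp hp (H.memLp_comp ha hp hM (hD j)).1
  have hGi : Integrable (fun y => (if j = A then 0 else (D (Equiv.swap A B j) ∘ chartMap B A h) y) +
      (D B ∘ chartMap B A h) y * lineDeriv ℝ h y (e j)) ((gaussP a).restrict W) := by
    refine Integrable.add ?_ ((H.smooth_right.lineDeriv j).nice.integrable_mul hWm (hDS B))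
    split_ifs
    exacts [integrable_zero _ _ _, hDS _]
  refine extWeak_of_specialTest H.isOpen_right H.bounded_right hfS hGi fun φ hφ => ?_
  have hφn := (hφ.cfb ha hs).nice
  rw [H.integral_eq ha (hφn.integrable_mul hWm hGi).1,
    H.integral_eq ha (((hφ.dualD a j).cfb ha hs).nice.integrable_mul hWm hfS).1]
  have hΦ := fun l => H.dirTest_transport ha hs hφ l
  have key : ∀ x ∈ V, ∀ v : ℝ,
      density a A B g x * ((f ∘ chartMap B A h) (chartMap A B g x) * v) =
        f x * (density a A B g x * v) := fun x hx v => by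
    rw [Function.comp_apply, H.leftInv x hx]; ring
  by_cases hj : j = A
  · subst hj
    -- The factor `D_A h` coming from the chain rule is the reciprocal of `D_B g`, so a single
    -- integration by parts along `e B` suffices.
    have hB := hfD B _ _ (hΦ B)
    refine Eq.trans (setIntegral_congr_fun hVm fun x hx => ?_)
      (hB.trans (setIntegral_congr_fun hVm fun x hx => ?_))
    · have h1 := H.transport_mul (a := a) (φ := φ) hx
      have h2 := H.lineDeriv_mul_self hx
      simp only [if_true, zero_add, Function.comp_apply, H.leftInv x hx]
      linear_combination (-D B x * lineDeriv ℝ h (chartMap j B g x) (e j)) * h1 +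
        D B x * transport a j B g φ x * h2
    · simp only
      rw [key x hx, ← H.dual_transport_self hx]
  · set l := Equiv.swap A B j with hl
    -- Since `D_j h = -D_l g / D_B g` at corresponding points, the integrand splits into `D l`
    -- tested against `D_B g` times the transport and `D B` tested against minus `D_l g` times it.
    have hΦl := (hΦ l).smul_nice ((H.smooth_left.lineDeriv B).niceDeriv l)
    have hΦB := (hΦ B).smul_nice (((H.smooth_left.lineDeriv l).niceDeriv B).neg)
    have hL := hfD l _ _ hΦl
    have hB := hfD B _ _ hΦB
    have e1 := integral_add (hΦl.deriv.nice.integrable_mul hVm (hDi l))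
      (hΦB.deriv.nice.integrable_mul hVm (hDi B))
    have e2 := integral_add
      ((hΦl.deriv.nice.dual H.bounded_left a l hΦl.deriv.nice').integrable_mul hVm hfi)
      ((hΦB.deriv.nice.dual H.bounded_left a B hΦB.deriv.nice').integrable_mul hVm hfi)
    rw [hL, hB, ← e2] at e1
    refine Eq.trans (setIntegral_congr_fun hVm fun x hx => ?_)
      (e1.trans (setIntegral_congr_fun hVm fun x hx => ?_))
    · have h1 := H.transport_mul (a := a) (φ := φ) hx
      have h2 := H.lineDeriv_mul hx hj
      simp only [if_neg hj, Function.comp_apply, H.leftInv x hx]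
      linear_combination (-D l x - D B x * lineDeriv ℝ h (chartMap A B g x) (e j)) * h1 +
        D B x * transport a A B g φ x * h2
    · simp only
      rw [key x hx, ← H.dual_transport_ne hx hj hl]
      exact (mul_add _ _ _).symm

/-! ### Sobolev energies under chart maps -/

/-- Induction on the order through the chain rule. Its first part is a composition of lower order.
Its second part is one such composition, that of `D B`, times the family of derivatives of `h`,
whose orders up to `n` are controlled by those of `h` up to `n + 1`. -/
theorem hasW_comp (ha : ∀ i, 0 < a i) (hs : Summable a) (hp : 1 ≤ p)
    (H : ChartPair A B V W g h) {M : ℝ≥0∞} (hM : M ≠ ⊤) {m : ℕ}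
    (hw : ∀ k ≤ m, ∀ y ∈ W, wsum a k h y ≤ M) {n : ℕ} (hn : n ≤ m) :
    ∃ C : ℝ≥0∞, C ≠ ⊤ ∧ ∀ f E, HasW a p V n f E →
      HasW a p W n (f ∘ chartMap B A h) (C * E) := by
  have hp0 : 0 ≤ p := by linarith
  obtain ⟨N, hN⟩ := H.exists_density_le ha
  induction n with
  | zero =>
    refine ⟨ENNReal.ofReal N, ENNReal.ofReal_ne_top, fun f E hf => ?_⟩
    have := H.memLp_comp ha hp hN hf.1
    exact ⟨this.1, this.2.trans (mul_le_mul_right hf.2 _)⟩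
  | succ n ih =>
    obtain ⟨C, hC, ih⟩ := ih (by omega)
    obtain ⟨C₂, hC₂, hmul⟩ := HasW.mul_family (a := a) hp H.isOpen_right H.bounded_right n
    -- Exchanging `A` and `B` changes the weight only at `j = B`; the second summand of the constant
    -- is the price of replacing weight `a B` by `a A`.
    obtain ⟨K, hK, hKle⟩ : ∃ K : ℝ≥0∞, K ≠ ⊤ ∧ ∀ j ≠ A, ENNReal.ofReal (a j) ^ p ≤
        K * ENNReal.ofReal (a (Equiv.swap A B j)) ^ p := by
      refine ⟨1 + ENNReal.ofReal (a B) ^ p * (ENNReal.ofReal (a A) ^ p)⁻¹, ?_, fun j hj => ?_⟩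
      · have h0 : ENNReal.ofReal (a A) ^ p ≠ 0 :=
          (ENNReal.rpow_pos (ENNReal.ofReal_pos.2 (ha A)) ENNReal.ofReal_ne_top).ne'
        have := ENNReal.inv_ne_top.2 h0
        finiteness
      · by_cases hB : j = B
        · subst hB
          rw [Equiv.swap_apply_right, add_mul, mul_assoc, ENNReal.inv_mul_cancel, mul_one]
          · exact le_add_self
          · exact (ENNReal.rpow_pos (ENNReal.ofReal_pos.2 (ha A)) ENNReal.ofReal_ne_top).ne'
          · finiteness
        · rw [Equiv.swap_apply_of_ne_of_ne hj hB, add_mul, one_mul]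
          exact le_self_add
    have haB : ENNReal.ofReal (a B) ^ p ≠ 0 :=
      (ENNReal.rpow_pos (ENNReal.ofReal_pos.2 (ha B)) ENNReal.ofReal_ne_top).ne'
    -- Dividing by its own weight bounds the energy of the single derivative `D B` by the total
    -- energy.
    set b : ℝ≥0∞ := (ENNReal.ofReal (a B) ^ p)⁻¹ with hb
    have hbt : b ≠ ⊤ := ENNReal.inv_ne_top.2 haB
    refine ⟨ENNReal.ofReal N + 2 ^ (p - 1) * (K * C + C₂ * M ^ p * (C * b)), by finiteness,
      fun f E hf => ?_⟩
    obtain ⟨hf1, D, ε, hD, hE⟩ := hf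
    obtain ⟨h1, h2⟩ := H.memLp_comp ha hp hN hf1
    have hEs : ∑' j, ENNReal.ofReal (a j) ^ p * ε j ≤ E := le_add_self.trans hE
    have hEB : ε B ≤ b * E := by
      have h3 := (ENNReal.le_tsum B).trans hEs
      calc ε B = b * (ENNReal.ofReal (a B) ^ p * ε B) := by
            rw [← mul_assoc, hb, ENNReal.inv_mul_cancel haB (by finiteness), one_mul]
        _ ≤ b * E := mul_le_mul_right h3 _
    obtain ⟨ε₂, hε₂, hε₂s⟩ := hmul ℕ (fun j y => lineDeriv ℝ h y (e j))
      (fun j => ENNReal.ofReal (a j)) M (fun j => H.smooth_right.lineDeriv j)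
      (fun k hk y hy => hw (k + 1) (by omega) y hy) _ _ (ih _ _ (hD B).2)
    set ε₁ : ℕ → ℝ≥0∞ := fun j => if j = A then 0 else C * ε (Equiv.swap A B j) with hε₁
    have hz : HasW a p W n (fun _ => 0) 0 := by
      clear * - hp
      induction n with
      | zero => exact ⟨MemLp.zero', by simp [ENNReal.zero_rpow_of_pos (zero_lt_one.trans_le hp)]⟩
      | succ n ih =>
        refine ⟨MemLp.zero', fun _ _ => 0, fun _ => 0, fun j => ⟨fun φ φ' _ => by simp, ih⟩, ?_⟩
        simp [ENNReal.zero_rpow_of_pos (zero_lt_one.trans_le hp)]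
    have hfirst : ∀ j, HasW a p W n
        (fun y => if j = A then 0 else (D (Equiv.swap A B j) ∘ chartMap B A h) y) (ε₁ j) := by
      intro j
      by_cases hj : j = A
      · simpa only [hε₁, if_pos hj] using hz
      · simpa only [hε₁, if_neg hj] using ih _ _ (hD (Equiv.swap A B j)).2
    refine ⟨h1, _, fun j => 2 ^ (p - 1) * (ε₁ j + ε₂ j), fun j => ⟨H.extWeak_comp ha hs hp hf1
      (fun j => (hD j).2.memLp) (fun j => (hD j).1) j,
      HasW.add H.isOpen_right H.bounded_right hp (hfirst j) (hε₂ j)⟩, ?_⟩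
    have hs1 : ∑' j, ENNReal.ofReal (a j) ^ p * ε₁ j ≤ K * C * E := by
      calc ∑' j, ENNReal.ofReal (a j) ^ p * ε₁ j
          ≤ ∑' j, K * C * (ENNReal.ofReal (a (Equiv.swap A B j)) ^ p * ε (Equiv.swap A B j)) := by
            refine ENNReal.tsum_le_tsum fun j => ?_
            by_cases hj : j = A
            · simp [hε₁, hj]
            · simp only [hε₁, if_neg hj]
              calc _ ≤ (K * ENNReal.ofReal (a (Equiv.swap A B j)) ^ p) *
                    (C * ε (Equiv.swap A B j)) := mul_le_mul_left (hKle j hj) _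
                _ = _ := by ring
        _ = K * C * ∑' j, ENNReal.ofReal (a j) ^ p * ε j := by
            rw [ENNReal.tsum_mul_left]
            congr 1
            exact (Equiv.swap A B).tsum_eq fun j => ENNReal.ofReal (a j) ^ p * ε j
        _ ≤ _ := mul_le_mul_right hEs _
    calc ∫⁻ y in W, ‖(f ∘ chartMap B A h) y‖ₑ ^ p ∂(gaussP a) +
          ∑' j, ENNReal.ofReal (a j) ^ p * (2 ^ (p - 1) * (ε₁ j + ε₂ j))
        = ∫⁻ y in W, ‖(f ∘ chartMap B A h) y‖ₑ ^ p ∂(gaussP a) +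
          2 ^ (p - 1) * (∑' j, ENNReal.ofReal (a j) ^ p * ε₁ j +
            ∑' j, ENNReal.ofReal (a j) ^ p * ε₂ j) := by
          rw [← ENNReal.tsum_add, ← ENNReal.tsum_mul_left]
          congr 1
          exact tsum_congr fun j => by ring
      _ ≤ ENNReal.ofReal N * E + 2 ^ (p - 1) * (K * C * E + C₂ * M ^ p * (C * (b * E))) := by
          refine add_le_add (h2.trans (mul_le_mul_right (le_self_add.trans hE) _))
            (mul_le_mul_right (add_le_add hs1 (hε₂s.trans ?_)) _)
          exact mul_le_mul_right (mul_le_mul_right hEB _) _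
      _ = _ := by ring

end ChartPair

end

/-! ### Bounds in the uniform Sobolev norm -/

theorem wsum_eq_tsum {a : ℕ → ℝ} (ha : ∀ i, 0 < a i) (k : ℕ) (w : Ell2 → ℝ) (x : Ell2) :
    wsum a k w x = ∑' I : Fin k → ℕ,
      ENNReal.ofReal ((∏ j, a (I j)) * |partialD (List.ofFn I) w x|) := by
  induction k generalizing w with
  | zero => simp [wsum, partialD, ← Real.norm_eq_abs]
  | succ k ih =>
    simp only [wsum]
    rw [tsum_fin_snoc]
    refine tsum_congr fun j => ?_
    rw [ih, ← ENNReal.tsum_mul_left]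
    refine tsum_congr fun I => ?_
    rw [ofFn_snoc, prod_snoc a I j, partialD_append, ← ENNReal.ofReal_mul (ha j).le]
    congr 1
    simp only [partialD]
    ring

theorem wsum_le_wInftyNorm {a : ℕ → ℝ} (ha : ∀ i, 0 < a i) {m k : ℕ} (hk : k ≤ m)
    {V : Set Ell2} (w : Ell2 → ℝ) {x : Ell2} (hx : x ∈ V) :
    wsum a k w x ≤ wInftyNorm a m V w := by
  rcases Nat.eq_zero_or_pos k with rfl | hk0
  · refine le_trans (le_iSup₂_of_le x hx ?_) (le_max_right _ _)
    exact (Real.enorm_eq_ofReal_abs _).le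
  · rw [wsum_eq_tsum ha]
    refine le_trans ?_ (le_max_left _ _)
    exact le_iSup₂_of_le k (Finset.mem_Icc.2 ⟨hk0, hk⟩) (le_iSup₂_of_le x hx le_rfl)

theorem abs_le_of_wInftyNorm_lt {a : ℕ → ℝ} {m : ℕ} {V : Set Ell2} {w : Ell2 → ℝ} {δ : ℝ}
    (h : wInftyNorm a m V w < ENNReal.ofReal δ) {x : Ell2} (hx : x ∈ V) : |w x| ≤ δ := by
  have h1 : ENNReal.ofReal |w x| < ENNReal.ofReal δ :=
    lt_of_le_of_lt (le_trans (le_iSup₂_of_le x hx le_rfl) (le_max_right _ _)) h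
  exact (ENNReal.ofReal_lt_ofReal_iff'.1 h1).1.le

theorem IsCFInfty.mono {V W : Set Ell2} {u : Ell2 → ℝ} (hu : IsCFInfty V u) (h : W ⊆ V) :
    IsCFInfty W u where
  differentiable I i x hx := hu.differentiable I i x (h hx)
  fcontinuous I := (hu.fcontinuous I).mono h
  measurable I := (hu.measurable I).comp (measurable_inclusion h)
  bounded I hI := by
    obtain ⟨M, hM⟩ := hu.bounded I hI
    exact ⟨M, fun x hx => hM x (h hx)⟩

/-! ### Displacements along lines -/

theorem abs_sub_le_of_lineDeriv_le {u : Ell2 → ℝ} {x : Ell2} {l : ℕ} {s M : ℝ}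
    (hd : ∀ t : ℝ, |t| ≤ |s| → LineDifferentiableAt ℝ u (x + t • e l) (e l))
    (hM : ∀ t : ℝ, |t| ≤ |s| → |lineDeriv ℝ u (x + t • e l) (e l)| ≤ M) :
    |u (x + s • e l) - u x| ≤ M * |s| := by
  have hderiv : ∀ t ∈ Set.Icc (-|s|) |s|, HasDerivWithinAt (fun t : ℝ => u (x + t • e l))
      (lineDeriv ℝ u (x + t • e l) (e l)) (Set.Icc (-|s|) |s|) t := by
    intro t ht
    have h1 := (hd t (abs_le.2 ht)).hasLineDerivAt
    rw [HasLineDerivAt, ← sub_self t] at h1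
    refine HasDerivAt.hasDerivWithinAt ((h1.comp_sub_const t t).congr_of_eventuallyEq
      (Eventually.of_forall fun r => ?_))
    simp only [sub_smul]
    congr 1; abel
  have := Convex.norm_image_sub_le_of_norm_hasDerivWithin_le hderiv
    (fun t ht => hM t (abs_le.2 ht)) (convex_Icc _ _)
    (x := 0) (y := s) (by simp) ⟨neg_abs_le s, le_abs_self s⟩
  simpa using this

theorem norm_chartMap_add_smul_sub_le {A B : ℕ} {g : Ell2 → ℝ} {x : Ell2} {l : ℕ} {s M : ℝ}
    (hd : ∀ t : ℝ, |t| ≤ |s| → LineDifferentiableAt ℝ g (x + t • e l) (e l))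
    (hM : ∀ t : ℝ, |t| ≤ |s| → |lineDeriv ℝ g (x + t • e l) (e l)| ≤ M) :
    ‖chartMap A B g (x + s • e l) - chartMap A B g x‖ ≤ (1 + M) * |s| := by
  rw [chartMap_add_smul, add_sub_cancel_left]
  refine (norm_add_le _ _).trans ?_
  rw [norm_smul, norm_smul, norm_e, norm_e, mul_one, mul_one, add_mul, one_mul]
  refine add_le_add ?_ (abs_sub_le_of_lineDeriv_le hd hM)
  split_ifs <;> simp

/-- Uniform inclusion of images is assumed for the larger chart only, so a displaced image point is
first seen to lie in `W'`. Its preimage has moved by at most `(1 + |M|) * |s|`, hence is still in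
`V`, and therefore the point itself lies in `W`. -/
theorem exists_chartMap_add_smul_mem {A B : ℕ} {V W W' E : Set Ell2} {g h : Ell2 → ℝ}
    (hh : IsCFInfty W' h) (hE : UnifIncl E V) (hTE : UnifIncl (chartMap A B g '' E) W')
    (hleft : ∀ x ∈ V, chartMap B A h (chartMap A B g x) = x)
    (hright : ∀ y ∈ W', chartMap A B g (chartMap B A h y) = y)
    (hmaps : Set.MapsTo (chartMap A B g) V W) (l : ℕ) :
    ∃ c > 0, ∀ x ∈ E, ∀ s : ℝ, |s| ≤ c → chartMap A B g x + s • e l ∈ W := by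
  obtain ⟨M, hM⟩ := hh.bounded [l] (by simp)
  obtain ⟨r, R, hr, -, hEV, -⟩ := id hE
  obtain ⟨r', R', hr', -, hEW, -⟩ := hTE
  have hM1 : 0 < 1 + |M| := by positivity
  refine ⟨min (r' / 2) (r / (2 * (1 + |M|))), by positivity, fun x hx s hs => ?_⟩
  have hmem : ∀ t : ℝ, |t| ≤ |s| → chartMap A B g x + t • e l ∈ W' := fun t ht => by
    refine hEW _ (Set.mem_image_of_mem _ hx) ?_
    rw [Metric.mem_ball, dist_eq_norm, add_sub_cancel_left, norm_smul, norm_e, mul_one]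
    have := ht.trans (hs.trans (min_le_left _ _))
    rw [Real.norm_eq_abs]
    linarith
  have hy := hmem s le_rfl
  rw [← hright _ hy]
  refine hmaps (hEV x hx ?_)
  have h1 := norm_chartMap_add_smul_sub_le (A := B) (B := A) (g := h)
    (fun t ht => hh.differentiable [] l _ (hmem t ht))
    (fun t ht => (hM _ (hmem t ht)).trans (le_abs_self M))
  rw [hleft x (hE.subset hx)] at h1
  rw [Metric.mem_ball, dist_eq_norm]
  refine h1.trans_lt ?_
  have h2 := mul_le_mul_of_nonneg_left (hs.trans (min_le_right _ _)) hM1.le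
  refine h2.trans_lt ?_
  rw [show (1 + |M|) * (r / (2 * (1 + |M|))) = r / 2 by field_simp]
  linarith

theorem isBounded_image_chartMap {A B : ℕ} {V : Set Ell2} {g : Ell2 → ℝ}
    (hV : Bornology.IsBounded V) (hg : ∃ M : ℝ, ∀ x ∈ V, |g x| ≤ M) :
    Bornology.IsBounded (chartMap A B g '' V) := by
  obtain ⟨R, hR⟩ := hV.exists_norm_le
  obtain ⟨M, hM⟩ := hg
  rw [isBounded_iff_forall_norm_le]
  refine ⟨R + (M + R) + (R + R), ?_⟩
  rintro _ ⟨x, hx, rfl⟩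
  have h1 := hR x hx
  have h2 := fun i => (abs_coord_le x i).trans h1
  have hR0 : 0 ≤ R := (norm_nonneg x).trans h1
  unfold chartMap
  refine (norm_add_le _ _).trans (add_le_add ((norm_add_le _ _).trans (add_le_add h1 ?_)) ?_)
  · rw [norm_smul, norm_e, mul_one]
    exact (norm_sub_le _ _).trans (add_le_add (hM x hx) (h2 A))
  · split_ifs
    · simpa using hR0
    · rw [norm_smul, norm_e, mul_one]
      exact (norm_sub_le _ _).trans (add_le_add (h2 A) (h2 B))

/-! ### The chart pair of a straightening -/

theorem chartPair_of_isStraightening {a : ℕ → ℝ} {m : ℕ} {O U : Set Ell2} (hO : IsOpen O)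
    {x₀ : Ell2} {g h : Ell2 → ℝ} (hg : IsDefiningFunction O x₀ U g) {i₀ : ℕ} {r₀ r₁ δ : ℝ}
    (hψ : IsStraightening O x₀ U g i₀ r₀ h) (hr : r₁ < r₀)
    (hδ : IsControlled a m O g i₀ h (Metric.ball x₀ r₁) δ) :
    ChartPair 0 i₀ (Metric.ball x₀ r₁ ∩ O) (psi i₀ g '' Metric.ball x₀ r₁ ∩ halfSpace) g h := by
  have hsub : Metric.ball x₀ r₁ ⊆ Metric.ball x₀ r₀ := Metric.ball_subset_ball hr.le
  have hinj : Set.InjOn (psi i₀ g) (Metric.ball x₀ r₀) := fun x hx y hy hxy =>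
    congrArg Subtype.val (hψ.isOpenEmbedding.injective (a₁ := ⟨x, hx⟩) (a₂ := ⟨y, hy⟩) hxy)
  have hleft : ∀ x ∈ Metric.ball x₀ r₀, tau i₀ h (psi i₀ g x) = x := by
    intro x hx
    ext i
    simp only [tau_apply, psi_apply, hψ.h_psi x hx]
    split_ifs <;> simp_all
  have hright : ∀ y ∈ psi i₀ g '' Metric.ball x₀ r₀, psi i₀ g (tau i₀ h y) = y := by
    rintro _ ⟨x, hx, rfl⟩
    rw [hleft x hx]
  have hmaps : Set.MapsTo (psi i₀ g) (Metric.ball x₀ r₁ ∩ O)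
      (psi i₀ g '' Metric.ball x₀ r₁ ∩ halfSpace) := fun x hx =>
    ⟨Set.mem_image_of_mem _ hx.1, (hψ.image_inter.subset
      (Set.mem_image_of_mem _ (⟨hsub hx.1, hx.2⟩ : x ∈ Metric.ball x₀ r₀ ∩ O))).2⟩
  have hmaps' : Set.MapsTo (tau i₀ h) (psi i₀ g '' Metric.ball x₀ r₁ ∩ halfSpace)
      (Metric.ball x₀ r₁ ∩ O) := by
    rintro _ ⟨⟨x, hx, rfl⟩, hH⟩
    rw [hleft x (hsub hx)]
    have hmem : psi i₀ g x ∈ psi i₀ g '' Metric.ball x₀ r₀ ∩ halfSpace :=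
      ⟨Set.mem_image_of_mem _ (hsub hx), hH⟩
    obtain ⟨x', hx', hxx⟩ := hψ.image_inter.superset hmem
    rw [hinj hx'.1 (hsub hx) hxx] at hx'
    exact ⟨hx, hx'.2⟩
  have hW : psi i₀ g '' (Metric.ball x₀ r₁ ∩ O) =
      psi i₀ g '' Metric.ball x₀ r₁ ∩ halfSpace :=
    Set.Subset.antisymm (Set.image_subset_iff.2 hmaps) fun y hy =>
      ⟨_, hmaps' hy, hright y (Set.image_mono hsub hy.1)⟩
  have hV' : Metric.ball x₀ r₁ ∩ O ⊆ Metric.ball x₀ r₀ ∩ O :=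
    Set.inter_subset_inter_left _ hsub
  have hW' : psi i₀ g '' Metric.ball x₀ r₁ ∩ halfSpace ⊆
      psi i₀ g '' Metric.ball x₀ r₀ ∩ halfSpace :=
    Set.inter_subset_inter_left _ (Set.image_mono hsub)
  have hgb : ∃ M : ℝ, ∀ x ∈ Metric.ball x₀ r₁ ∩ O, |g x| ≤ M :=
    ⟨δ, fun x hx => abs_le_of_wInftyNorm_lt hδ.norm_g ⟨hx.2, hx.1⟩⟩
  have hVb : Bornology.IsBounded (Metric.ball x₀ r₁ ∩ O) :=
    Metric.isBounded_ball.subset Set.inter_subset_left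
  have hhs : IsOpen halfSpace := isOpen_lt continuous_const (continuous_coord 0)
  have hgU : IsCFInfty (Metric.ball x₀ r₀ ∩ O) g :=
    hg.smooth.mono (Set.inter_subset_left.trans hψ.ball_subset)
  have hhU := hψ.h_smooth.mono (Set.inter_subset_left (t := halfSpace))
  refine
    { isOpen_left := Metric.isOpen_ball.inter hO
      isOpen_right := IsOpen.inter ?_ hhs
      bounded_left := hVb
      bounded_right := by rw [← hW]; exact isBounded_image_chartMap hVb hgb
      smooth_left := ⟨hgU.mono hV', hgb⟩
      smooth_right := ⟨hhU.mono hW', δ, fun y hy => abs_le_of_wInftyNorm_lt hδ.norm_h hy⟩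
      mapsTo_left := hmaps
      mapsTo_right := by rw [← tau_eq_chartMap]; exact hmaps'
      leftInv := by rw [← tau_eq_chartMap]; exact fun x hx => hleft x (hsub hx.1)
      rightInv := by
        rw [← tau_eq_chartMap]; exact fun y hy => hright y (Set.image_mono hsub hy.1)
      deriv_left := ⟨1 / δ, one_div_pos.2 hδ.delta_pos, fun x hx => (hδ.deriv_g x hx.1).1.le⟩
      deriv_right := ⟨1 / δ, one_div_pos.2 hδ.delta_pos, fun y hy => (hδ.deriv_h y hy.1).1.le⟩
      support_left := fun E hE => exists_chartMap_add_smul_mem hhU hE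
        (hψ.psi_unifIncl E (hE.mono subset_rfl hV'))
        (by rw [← tau_eq_chartMap]; exact fun x hx => hleft x (hsub hx.1))
        (by rw [← tau_eq_chartMap]; exact fun y hy => hright y hy.1) hmaps
      support_right := fun E hE => exists_chartMap_add_smul_mem hgU hE
        (by rw [← tau_eq_chartMap]; exact hψ.tau_unifIncl E (hE.mono subset_rfl hW'))
        (by rw [← tau_eq_chartMap]; exact fun y hy => hright y (Set.image_mono hsub hy.1))
        (by rw [← tau_eq_chartMap]; exact fun x hx => hleft x hx.1)
        (by rw [← tau_eq_chartMap]; exact hmaps') }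
  have himg : psi i₀ g '' Metric.ball x₀ r₁ = (fun x : Metric.ball x₀ r₀ => psi i₀ g x) ''
      (Subtype.val ⁻¹' Metric.ball x₀ r₁) := by
    ext y
    constructor
    · rintro ⟨x, hx, rfl⟩
      exact ⟨⟨x, hsub hx⟩, hx, rfl⟩
    · rintro ⟨x, hx, rfl⟩
      exact ⟨x, hx, rfl⟩
  rw [himg]
  exact hψ.isOpenEmbedding.isOpenMap _ (Metric.isOpen_ball.preimage continuous_subtype_val)

/-! ### Sobolev norms under chart maps -/

theorem sobolevEnergy_congr {a : ℕ → ℝ} {m : ℕ} {p : ℝ} {V : Set Ell2} (hV : MeasurableSet V)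
    {f f' : Ell2 → ℝ} (h : ∀ x ∈ V, f x = f' x) :
    sobolevEnergy a m p V f = sobolevEnergy a m p V f' := by
  classical
  have h1 : ∀ I, weakD a p V I f = weakD a p V I f' := fun I => by
    have : IsWeakDeriv a p V I f = IsWeakDeriv a p V I f' := by
      funext u
      have hφ : ∀ φ : Ell2 → ℝ, ∫ x in V, f x * iterDualD a I φ x ∂(gaussP a) =
          ∫ x in V, f' x * iterDualD a I φ x ∂(gaussP a) := fun φ =>
        setIntegral_congr_fun hV fun x hx => congrArg (· * iterDualD a I φ x) (h x hx)
      simp only [IsWeakDeriv, hφ]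
    -- The two functions have equal, not merely equivalent up to null sets, predicates of weak
    -- derivatives, so the choice made in `weakD` is literally the same.
    exact congrArg (fun Q : (Ell2 → ℝ) → Prop => if H : ∃ g, Q g then H.choose else 0) this
  have h2 : ∫⁻ x in V, ‖f x‖ₑ ^ p ∂(gaussP a) = ∫⁻ x in V, ‖f' x‖ₑ ^ p ∂(gaussP a) :=
    setLIntegral_congr_fun hV fun x hx => congrArg (‖·‖ₑ ^ p) (h x hx)
  simp only [sobolevEnergy, h1, h2]

theorem sobolevNorm_le_of_energy_le {a : ℕ → ℝ} {m : ℕ} {p : ℝ} (hp : 1 ≤ p) {V W : Set Ell2}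
    {f F : Ell2 → ℝ} {C : ℝ≥0∞} (hC : C ≠ ⊤) (hf : sobolevEnergy a m p V f < ⊤)
    (h : sobolevEnergy a m p W F ≤ C * sobolevEnergy a m p V f) :
    sobolevNorm a m p W F ≤ C.toReal ^ (1 / p) * sobolevNorm a m p V f := by
  have hp' : 0 ≤ 1 / p := by positivity
  rw [sobolevNorm, sobolevNorm, ← Real.mul_rpow ENNReal.toReal_nonneg ENNReal.toReal_nonneg,
    ← ENNReal.toReal_mul]
  exact Real.rpow_le_rpow ENNReal.toReal_nonneg
    (ENNReal.toReal_mono (ENNReal.mul_ne_top hC hf.ne) h) hp'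

theorem ChartPair.exists_sobolevNorm_le {a : ℕ → ℝ} (ha : ∀ i, 0 < a i) (hs : Summable a)
    {m : ℕ} {p : ℝ} (hp : 1 ≤ p) {A B : ℕ} {V W : Set Ell2} {g h : Ell2 → ℝ}
    (H : ChartPair A B V W g h) {M : ℝ≥0∞} (hM : M ≠ ⊤) (hh : wInftyNorm a m W h ≤ M) :
    ∃ C : ℝ, 0 ≤ C ∧ ∀ f, MemW a m p V f → MemW a m p W (f ∘ chartMap B A h) ∧
      sobolevNorm a m p W (f ∘ chartMap B A h) ≤ C * sobolevNorm a m p V f := by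
  obtain ⟨C, hC, hcomp⟩ := H.hasW_comp ha hs hp hM
    (fun k hk y hy => (wsum_le_wInftyNorm ha hk h hy).trans hh) (le_refl m)
  refine ⟨C.toReal ^ (1 / p), by positivity, fun f hf => ?_⟩
  have h1 := hcomp f _ (hasW_of_memW ha hs hp H.isOpen_left H.bounded_left hf)
  have h2 := h1.memW ha hs hp H.isOpen_right H.bounded_right
    (ENNReal.mul_lt_top hC.lt_top hf.energy_lt_top)
  exact ⟨h2.1, sobolevNorm_le_of_energy_le hp hC hf.energy_lt_top h2.2⟩

theorem ChartPair.sobolevNorm_comp_comp {a : ℕ → ℝ} {m : ℕ} {p : ℝ} {A B : ℕ} {V W : Set Ell2}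
    {g h : Ell2 → ℝ} (H : ChartPair A B V W g h) (f : Ell2 → ℝ) :
    sobolevNorm a m p V ((f ∘ chartMap B A h) ∘ chartMap A B g) = sobolevNorm a m p V f := by
  rw [sobolevNorm, sobolevNorm, sobolevEnergy_congr H.isOpen_left.measurableSet fun x hx => ?_]
  simp only [Function.comp_apply, H.leftInv x hx]

end GaussSobolev

end

/-! ### The two-sided estimates -/

theorem mainTheorem5
    (a : ℕ → ℝ) (ha_pos : ∀ i, 0 < a i) (ha_sum : Summable a) (ha_lt : ∑' i, a i < 1)
    (m : ℕ) (hm : 1 ≤ m) (p : ℝ) (hp : 1 ≤ p)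
    (O : Set GaussSobolev.Ell2) (hO : IsOpen O)
    (x₀ : GaussSobolev.Ell2) (hx₀ : x₀ ∈ frontier O)
    (U : Set GaussSobolev.Ell2) (g : GaussSobolev.Ell2 → ℝ)
    (hg : GaussSobolev.IsDefiningFunction O x₀ U g)
    (i₀ : ℕ) (r₀ : ℝ) (h : GaussSobolev.Ell2 → ℝ)
    (hψ : GaussSobolev.IsStraightening O x₀ U g i₀ r₀ h)
    (r₁ : ℝ) (hr₁ : 0 < r₁) (hr₁₀ : r₁ < r₀) (δ : ℝ)
    (U₀ : Set GaussSobolev.Ell2) (hU₀ : U₀ = Metric.ball x₀ r₁)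
    (hδ : GaussSobolev.IsControlled a m O g i₀ h U₀ δ)
    (V₀ : Set GaussSobolev.Ell2)
    (hV₀ : V₀ = GaussSobolev.psi i₀ g '' U₀ ∩ GaussSobolev.halfSpace) :
    ∃ C : ℝ, 0 < C ∧
      (∀ f : GaussSobolev.Ell2 → ℝ, GaussSobolev.MemW a m p (U₀ ∩ O) f →
        GaussSobolev.MemW a m p V₀ (f ∘ GaussSobolev.tau i₀ h) ∧
        GaussSobolev.sobolevNorm a m p (U₀ ∩ O) f / C ≤
          GaussSobolev.sobolevNorm a m p V₀ (f ∘ GaussSobolev.tau i₀ h) ∧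
        GaussSobolev.sobolevNorm a m p V₀ (f ∘ GaussSobolev.tau i₀ h) ≤
          C * GaussSobolev.sobolevNorm a m p (U₀ ∩ O) f) ∧
      (∀ F : GaussSobolev.Ell2 → ℝ, GaussSobolev.MemW a m p V₀ F →
        GaussSobolev.MemW a m p (U₀ ∩ O) (F ∘ GaussSobolev.psi i₀ g) ∧
        GaussSobolev.sobolevNorm a m p V₀ F / C ≤
          GaussSobolev.sobolevNorm a m p (U₀ ∩ O) (F ∘ GaussSobolev.psi i₀ g) ∧
        GaussSobolev.sobolevNorm a m p (U₀ ∩ O) (F ∘ GaussSobolev.psi i₀ g) ≤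
          C * GaussSobolev.sobolevNorm a m p V₀ F) := by

  subst hU₀ hV₀
  have H := GaussSobolev.chartPair_of_isStraightening hO hg hψ hr₁₀ hδ
  obtain ⟨C₁, hC₁, h₁⟩ := H.exists_sobolevNorm_le ha_pos ha_sum hp ENNReal.ofReal_ne_top
    hδ.norm_h.le
  obtain ⟨C₂, hC₂, h₂⟩ := H.symm.exists_sobolevNorm_le ha_pos ha_sum hp ENNReal.ofReal_ne_top
    (by rw [Set.inter_comm]; exact hδ.norm_g.le)
  rw [GaussSobolev.tau_eq_chartMap, GaussSobolev.psi_eq_chartMap] at *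
  have hnorm : ∀ V f, 0 ≤ GaussSobolev.sobolevNorm a m p V f := fun V f =>
    Real.rpow_nonneg ENNReal.toReal_nonneg _
  -- The two one-sided constants may vanish; the added `1` makes the common constant positive.
  have hC : 0 < C₁ + C₂ + 1 := by positivity
  have hle₁ : ∀ {r : ℝ}, 0 ≤ r → C₁ * r ≤ (C₁ + C₂ + 1) * r := fun hr => by nlinarith
  have hle₂ : ∀ {r : ℝ}, 0 ≤ r → C₂ * r ≤ (C₁ + C₂ + 1) * r := fun hr => by nlinarith
  refine ⟨C₁ + C₂ + 1, hC, fun f hf => ?_, fun F hF => ?_⟩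
  · obtain ⟨hm₁, hn₁⟩ := h₁ f hf
    -- The lower bound is the upper bound of the opposite chart applied to the composed function.
    have hn₂ := (h₂ _ hm₁).2
    rw [H.sobolevNorm_comp_comp] at hn₂
    refine ⟨hm₁, ?_, hn₁.trans (hle₁ (hnorm _ _))⟩
    rw [div_le_iff₀' hC]
    exact hn₂.trans (hle₂ (hnorm _ _))
  · obtain ⟨hm₂, hn₂⟩ := h₂ F hF
    have hn₁ := (h₁ _ hm₂).2
    rw [H.symm.sobolevNorm_comp_comp] at hn₁
    refine ⟨hm₂, ?_, hn₂.trans (hle₂ (hnorm _ _))⟩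
    rw [div_le_iff₀' hC]
    exact hn₁.trans (hle₁ (hnorm _ _))
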